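/- Let $q\in\mathbb{C}$ with $|q|>1$, fix a determination of $\log q$, and write $q^\alpha=e^{\alpha\log q}$ for $\alpha\in\mathbb{C}$. For $|p|>1$ put $\Theta_p(z)=\sum_{\ell\in\mathbb{Z}}p^{-\ell(\ell+1)/2}z^\ell$, and let $\sigma_q^i$ act on functions and on formal power series by $z\mapsto q^iz$. Let $\mathcal{M}(\mathbb{C}^*)$ be the field of meromorphic functions on $\mathbb{C}^*$, and $\mathcal{M}(\mathbb{C}^*,0)$ the field of functions meromorphic on some punctured neighbourhood of $0$. For $\mu\in\mathbb{Q}_{>0}$ and $K\in\mathbb{N}^*$ with $K/\mu\in\mathbb{N}^*$, and $\lambda\in\mathbb{C}^*$: * $\hat{\mathcal{B}}_\mu\big(\sum_{\ell\ge 0} a_\ell z^\ell\big)=\sum_{\ell\ge 0} a_\ell q^{-\ell(\ell-1)/(2\mu)}\zeta^\ell$. * $\mathbb{H}^{[\lambda]}_{\mu,K}$ is the set of $f\in\mathcal{M}(\mathbb{C}^*,0)$ for which there are $\varepsilon>0$ and a connected domain $\Omega\subset\mathbb{C}$ containing $\bigcup_{\ell\in K^{-1}\mathbb{Z}}\{z\in\mathbb{C}^*: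 |z-\lambda q^\ell|<\varepsilon|q^\ell\lambda|\}$ such that $f$ continues to an analytic function on $\Omega$ satisfying, for some $L,M>0$, $|f(z)|<L\,|\Theta_{|q|^{1/\mu}}(M|z|)|$ for all $z\in\Omega\setminus\{0\}$. * For $f\in\mathbb{H}^{[\lambda]}_{\mu,K}$, $$\mathcal{L}^{[\lambda]}_{\mu,K}(f)(z)=\frac{\mu}{K}\sum_{\ell\in K^{-1}\mathbb{Z}}\frac{f(q^\ell\lambda)}{\Theta_{q^{1/\mu}}\big(q^{1/\mu+\ell}\lambda/z\big)},$$ where $f(q^\ell\lambda)$ is the value of the analytic continuation of $f$. That $\mathcal{L}^{[\lambda]}_{\mu,K}(f)$ is defined means that, whichever such continuation is used, this series converges absolutely for $z\neq0$ small with $z\notin-\lambda q^{K^{-1}\mathbb{Z}}$, and that its sum is given there by one element of $\mathcal{M}(\mathbb{C}^*,0)$. The Newton polygon of a $q$-difference operator $P=\sum_i b_i\sigma_q^i$ (a finite sum over $i\in\mathbb{Z}$, with $b_i\in\mathbb{C}[z]$) is the convex hull of the points $(i,j)$, $j\in\mathbb{Z}$, with $b_i\neq0$ and $j\geq v_0(b_i)$,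 where $v_0$ is the $z$-adic valuation. Its slopes are the slopes of the edges of the lower part of its boundary. **Theorem.** Let $\hat h\in\mathbb{C}[[z]]$, let $a\in\mathbb{C}[z]$, and let $P$ be a $q$-difference operator as above with $P(\hat h)=a$. Assume that $P$ has at least one positive slope. Let $\mu_1<\dots<\mu_r$ ($r\geq1$) be the positive slopes of $P$ and put $\mu_{r+1}=+\infty$, $\kappa_i^{-1}=\mu_i^{-1}-\mu_{i+1}^{-1}$ for $1\le i\le r$. Let $K\in\mathbb{N}^*$ be minimal such that $K/\kappa_i\in\mathbb{N}^*$ for all $i$, and $n\in\mathbb{N}^*$ minimal such that $n/\kappa_r\in\mathbb{N}^*$. Then there is a finite set $\Sigma\subset\mathbb{C}^*/q^{n^{-1}\mathbb{Z}}$ such that for every $\lambda\in\mathbb{C}^*$ whose class is not in $\Sigma$: 1. the series $\hat{\mathcal{B}}_{\kappa_1}\circ\dots\circ\hat{\mathcal{B}}_{\kappa_r}(\hat h)$ converges near $0$ and its sum belongs to $\mathbb{H}^{[\lambda]}_{\kappa_1,K}$; 2. for $i=1,\dots,r-1$ successively, $\mathcal{L}^{[\lambda]}_{\kappa_i,K}\circ\dots\circ\mathcal{L}^{[\lambda]}_{\kappa_1,K}\circ\hat{\mathcal{B}}_{\kappa_1}\circ\dots\circ\hat{\mathcal{B}}_{\kappa_r}(\hat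 h)$ is defined and belongs to $\mathbb{H}^{[\lambda]}_{\kappa_{i+1},K}$; 3. the function $$S_q^{[\lambda]}(\hat h)=\mathcal{L}^{[\lambda]}_{\kappa_r,n}\circ\mathcal{L}^{[\lambda]}_{\kappa_{r-1},K}\circ\dots\circ\mathcal{L}^{[\lambda]}_{\kappa_1,K}\circ\hat{\mathcal{B}}_{\kappa_1}\circ\dots\circ\hat{\mathcal{B}}_{\kappa_r}(\hat h)$$ is defined, extends to an element of $\mathcal{M}(\mathbb{C}^*)$, and satisfies $P\big(S_q^{[\lambda]}(\hat h)\big)=a$. -/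

import Mathlib

open Filter Topology

noncomputable section

/-- `q ^ α := exp (α log q)`, where `logq` is the chosen determination of `log q`. -/
def qpow (logq α : ℂ) : ℂ := Complex.exp (α * logq)

/-- The Theta function `Θ_p(z) = ∑_{ℓ ∈ ℤ} p ^ (-ℓ(ℓ+1)/2) z ^ ℓ`
(for `|p| > 1` and `z ≠ 0`; the integer `ℓ(ℓ+1)` is even). -/
def qTheta (p z : ℂ) : ℂ := ∑' l : ℤ, p ^ (-(l * (l + 1) / 2)) * z ^ l

/-- The subgroup `q ^ (N⁻¹ ℤ)` of `ℂ*`. -/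
def qSpiral (logq : ℂ) (N : ℕ) : Subgroup ℂˣ :=
  Subgroup.zpowers (Units.mk0 (qpow logq (1 / (N : ℂ))) (Complex.exp_ne_zero _))

/-! ### `q`-difference operators -/

/-- A `q`-difference operator `∑_i b_i σ_q ^ i` with polynomial coefficients is encoded by the
finitely supported family `i ↦ b_i`, `i ∈ ℤ`. -/
abbrev QDiffOp : Type := ℤ →₀ Polynomial ℂ

/-- Action on formal power series: `σ_q ^ i` sends `h(z)` to `h(q ^ i z)`. -/
def QDiffOp.onSeries (P : QDiffOp) (q : ℂ) (h : PowerSeries ℂ) : PowerSeries ℂ :=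
  P.sum fun i b => (b : PowerSeries ℂ) * PowerSeries.rescale (q ^ i) h

/-- Action on functions: `σ_q ^ i` sends `f(z)` to `f(q ^ i z)`. -/
def QDiffOp.onFun (P : QDiffOp) (q : ℂ) (f : ℂ → ℂ) (z : ℂ) : ℂ :=
  P.sum fun i b => b.eval z * f (q ^ i * z)

/-- The Newton polygon: the convex hull of the `(i, j)` with `j ≥ v₀(b_i)`, where `v₀` is the
`z`-adic valuation (infinite, hence no point, when `b_i = 0`). -/
def QDiffOp.newtonPolygon (P : QDiffOp) : Set (ℝ × ℝ) :=
  convexHull ℝ {x | ∃ i j : ℤ, P i ≠ 0 ∧ ((P i).natTrailingDegree : ℤ) ≤ j ∧ x = ((i : ℝ), (j : ℝ))}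

/-- `s` is the slope of an edge of the lower part of the boundary of the Newton polygon: some line
of slope `s` lies below the polygon and meets it in two points with distinct abscissas. -/
def QDiffOp.IsSlope (P : QDiffOp) (s : ℚ) : Prop :=
  ∃ x ∈ P.newtonPolygon, ∃ y ∈ P.newtonPolygon, x.1 < y.1 ∧
    y.2 - x.2 = (s : ℝ) * (y.1 - x.1) ∧
    ∀ p ∈ P.newtonPolygon, x.2 + (s : ℝ) * (p.1 - x.1) ≤ p.2

/-- The set of positive slopes. -/
def QDiffOp.positiveSlopes (P : QDiffOp) : Set ℚ := {s | 0 < s ∧ P.IsSlope s}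

/-- The orders `κ_i`, with `κ_i⁻¹ = μ_i⁻¹ - μ_{i+1}⁻¹` and `μ_{r+1}⁻¹ = 0` (`μ_{r+1} = +∞`). -/
def kappa {r : ℕ} (μ : Fin r → ℚ) (i : Fin r) : ℚ :=
  ((μ i)⁻¹ - if h : (i : ℕ) + 1 < r then (μ ⟨(i : ℕ) + 1, h⟩)⁻¹ else 0)⁻¹

/-! ### The `q`-Borel transformation -/

/-- The `q`-Borel transformation of order `μ`. -/
def qBorel (logq : ℂ) (μ : ℚ) (h : PowerSeries ℂ) : PowerSeries ℂ :=
  PowerSeries.mk fun l =>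
    PowerSeries.coeff l h * qpow logq (-((l : ℂ) * ((l : ℂ) - 1)) / (2 * (μ : ℂ)))

/-- The composite `B_{κ_1} ∘ ⋯ ∘ B_{κ_r}`; the order `κ_r` is applied first. -/
def qBorelIter (logq : ℂ) {r : ℕ} (κ : Fin r → ℚ) (h : PowerSeries ℂ) : PowerSeries ℂ :=
  (List.ofFn κ).foldr (qBorel logq) h

/-! ### The `q`-Laplace transformation -/

/-- `f ∈ 𝓜(ℂ*, 0)`: `f` is meromorphic on some punctured neighbourhood of `0`. -/
def MeromorphicNearZero (f : ℂ → ℂ) : Prop :=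
  ∃ δ : ℝ, 0 < δ ∧ MeromorphicOn f {z | 0 < ‖z‖ ∧ ‖z‖ < δ}

/-- `F` is an analytic continuation of `f ∈ 𝓜(ℂ*, 0)` to the connected domain `Ω`, where `Ω`
contains the discs `|z - λ q ^ ℓ| < ε |q ^ ℓ λ|`, `ℓ ∈ K⁻¹ ℤ`, of `ℂ*` for some `ε > 0`, and
`F` has `q ^ (1/μ)`-exponential growth of order `1`. Meromorphic functions are compared off the
discrete sets where the values are not meaningful; the growth bound is void at `z = 0`, where the
right-hand side is infinite. -/
structure IsGrowthContinuation (logq : ℂ) (μ : ℚ) (K : ℕ) (lam : ℂ)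
    (f : ℂ → ℂ) (Ω : Set ℂ) (F : ℂ → ℂ) : Prop where
  isOpen : IsOpen Ω
  isConnected : IsConnected Ω
  discs : ∃ ε : ℝ, 0 < ε ∧ ∀ l : ℤ, ∀ z : ℂ, z ≠ 0 →
    ‖z - lam * qpow logq ((l : ℂ) / K)‖ < ε * ‖qpow logq ((l : ℂ) / K) * lam‖ → z ∈ Ω
  analytic : AnalyticOnNhd ℂ F Ω
  continues : ∃ δ : ℝ, 0 < δ ∧ ∀ z ∈ Ω, z ≠ 0 → ‖z‖ < δ → ∀ᶠ w in 𝓝[≠] z, F w = f w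
  growth : ∃ L M : ℝ, 0 < L ∧ 0 < M ∧ ∀ z ∈ Ω, z ≠ 0 →
    ‖F z‖ < L * ‖qTheta ((‖qpow logq (1 / (μ : ℂ))‖ : ℝ) : ℂ) ((M * ‖z‖ : ℝ) : ℂ)‖

/-- The growth space `ℍ_{μ,K}^{[λ]}`. -/
def MemH (logq : ℂ) (μ : ℚ) (K : ℕ) (lam : ℂ) (f : ℂ → ℂ) : Prop :=
  MeromorphicNearZero f ∧ ∃ Ω F, IsGrowthContinuation logq μ K lam f Ω F

/-- `f` belongs to `ℍ_{μ,K}^{[λ]}` and `g ∈ 𝓜(ℂ*, 0)` is its `q`-Laplace transform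
`(μ/K) ∑_{ℓ ∈ K⁻¹ ℤ} f(q ^ ℓ λ) / Θ_{q ^ (1/μ)}(q ^ (1/μ + ℓ) λ / z)`. The values `f(q ^ ℓ λ)`
are those of the analytic continuation of `f` (the sum does not depend on it), and for `z ≠ 0`
small off the spiral `-λ q ^ (K⁻¹ ℤ)`, where the denominators vanish, the sum converges to
`g z`. -/
def IsQLaplace (logq : ℂ) (μ : ℚ) (K : ℕ) (lam : ℂ) (f g : ℂ → ℂ) : Prop :=
  MemH logq μ K lam f ∧ MeromorphicNearZero g ∧
    ∀ Ω F, IsGrowthContinuation logq μ K lam f Ω F →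
      ∀ᶠ z in 𝓝[≠] (0 : ℂ), (∀ l : ℤ, z ≠ -(qpow logq ((l : ℂ) / K) * lam)) →
        HasSum (fun l : ℤ => (μ : ℂ) / K *
          (F (qpow logq ((l : ℂ) / K) * lam) /
            qTheta (qpow logq (1 / (μ : ℂ)))
              (qpow logq (1 / (μ : ℂ) + (l : ℂ) / K) * lam / z))) (g z)

end

/-! Put ρ = q^(1/K) and let σ be z ↦ ρz. Every operator that occurs is a finite sum of terms c z^j
σ^m. Let τ_0 > ⋯ > τ_s be the inverses of the positive slopes, τ_(s+1) = 0, and T_i = K τ_i. The T_i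
are natural numbers, and T_i - T_(i+1) = K/κ_i =: N_i. Multiplying the k-th coefficient of a series
by ρ^(-T k(k-1)/2) turns z^j σ^(Ki) into a multiple of z^j σ^(Ki - Tj). The Borel transforms
together do this with T = T_0. A discrete Laplace transform with Theta base ρ^N undoes part of it,
replacing T by T - N (`hasSum_shift_spiralLaplace`); this is the functional equation Θ_p(pz) = z
Θ_p(z). So the theorem is a descent T_0 > T_1 > ⋯ > T_(s+1) = 0. The invariant is `IsStage`, the
start is `exists_initial_stage`, one step is `IsStage.exists_laplace`, and at level 0 the equation
is the original one.

Three facts carry the descent. Convergence: at level T_0 the largest shift Ki - T_0 j is attained at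
a point of minimal ordinate. Its term dominates the recursion for the coefficients, which are
therefore geometrically bounded (`exists_geometric_bound`). Continuation: the equation solved for
its largest shift gives f(z) from values of f at points of smaller modulus. A solution near 0 thus
extends to ℂ*, with singularities only on the ρ-spirals through the roots of the leading coefficient
(`exists_continuation`). Growth: the vertex v between the edges of inverse slopes τ_i and τ_(i+1)
maximises both Ki' - T_i j and Ki' - T_(i+1) j over the points (i', j) of the support
(`exists_vertex`). Hence the leading coefficient at level T_i has degree exactly v.2, and going back
k steps from ρ^l z costs at most a constant times |ρ|^(lk/N_i). These factors accumulate to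
|ρ|^(l²/(2N_i)) up to a geometric factor (`growth_of_recursion`), which is the order of growth of
the Theta function of base |ρ|^(N_i). So f lies in the growth space, and its Laplace series
converges near 0.

The Laplace transform is a mean of quotients of Laurent series by Theta functions. The zeros of the
latter are known from the triple product (`qTheta_ne_zero`), so off the spiral of -λ the quotients
are analytic and bounded near 0 along dilates of a compact set. This restores the invariant. The
directions to exclude are the ρ-spirals of finitely many roots, and each of them meets finitely many
classes modulo q^(ℤ/n). -/

noncomputable section

/-! ### Triangular numbers over the integers -/

/-- The triangular number `l (l + 1) / 2` of an integer. -/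
def triang (l : ℤ) : ℤ := l * (l + 1) / 2

theorem triang_mul_two (l : ℤ) : triang l * 2 = l * (l + 1) :=
  Int.ediv_mul_cancel (Int.even_mul_succ_self l).two_dvd

theorem triang_eq_of_mul_two {l t : ℤ} (h : t * 2 = l * (l + 1)) : triang l = t := by
  have := triang_mul_two l
  omega

theorem triang_add (a b : ℤ) : triang (a + b) = triang a + triang b + a * b :=
  triang_eq_of_mul_two (by linear_combination triang_mul_two a + triang_mul_two b)

theorem triang_zero : triang 0 = 0 := rfl

theorem triang_one : triang 1 = 1 := rfl

theorem triang_neg_one_sub (a : ℤ) : triang (-1 - a) = triang a :=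
  triang_eq_of_mul_two (by linear_combination triang_mul_two a)

theorem triang_sub_one (a : ℤ) : triang (a - 1) = triang a - a := by
  rw [sub_eq_add_neg, triang_add, show triang (-1) = 0 from rfl]; ring

theorem triang_neg (a : ℤ) : triang (-a) = triang a - a := by
  rw [← triang_sub_one, ← triang_neg_one_sub (a - 1)]; congr 1; ring

/-! ### Laurent series -/

/-- Powers are monotone in the base for l ≥ 0 and antitone for l ≤ 0; the sum of the two end values
covers both signs, so one majorant serves a two-sided series on an annulus. -/
theorem zpow_le_zpow_add_zpow {a b x : ℝ} (ha : 0 < a) (hax : a ≤ x) (hxb : x ≤ b) (l : ℤ) :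
    x ^ l ≤ a ^ l + b ^ l := by
  have hx : 0 < x := ha.trans_le hax
  have hb : 0 < b := hx.trans_le hxb
  rcases le_total 0 l with hl | hl
  · have := zpow_le_zpow_left₀ hl hx.le hxb
    have h2 : 0 < a ^ l := zpow_pos ha _
    linarith
  · have := zpow_le_zpow_left₀ (n := -l) (by omega) ha.le hax
    have h2 : 0 < b ^ l := zpow_pos hb _
    have h3 : x ^ l ≤ a ^ l := by
      have := inv_anti₀ (zpow_pos ha _) this
      simpa only [zpow_neg, inv_inv] using this
    linarith

theorem summable_laurent {g : ℤ → ℂ} {z : ℂ} (h : Summable fun l : ℤ => ‖g l‖ * ‖z‖ ^ l) :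
    Summable fun l : ℤ => g l * z ^ l := by
  refine Summable.of_norm ?_
  simpa only [norm_mul, norm_zpow] using h

theorem differentiableAt_laurent {g : ℤ → ℂ} {X : ℝ} (hX : 0 ≤ X)
    (h : ∀ x : ℝ, X < x → Summable fun l : ℤ => ‖g l‖ * x ^ l) {z : ℂ} (hz : X < ‖z‖) :
    DifferentiableAt ℂ (fun z => ∑' l : ℤ, g l * z ^ l) z := by
  obtain ⟨a, hXa, haz⟩ := exists_between hz
  have ha : 0 < a := hX.trans_lt hXa
  set b := ‖z‖ + 1
  have hopen : IsOpen {w : ℂ | a < ‖w‖ ∧ ‖w‖ < b} :=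
    (isOpen_lt continuous_const continuous_norm).inter (isOpen_lt continuous_norm continuous_const)
  have hu : Summable fun l : ℤ => ‖g l‖ * (a ^ l + b ^ l) := by
    have := (h a hXa).add (h b (by simp only [b]; linarith))
    simpa only [mul_add] using this
  have := Complex.differentiableOn_tsum_of_summable_norm (F := fun (l : ℤ) (w : ℂ) => g l * w ^ l)
    hu (fun l w hw => ((differentiableAt_id.zpow (Or.inl
      (norm_pos_iff.1 (ha.trans hw.1)))).const_mul (g l)).differentiableWithinAt) hopen
    (fun l w hw => by
      rw [norm_mul, norm_zpow]
      exact mul_le_mul_of_nonneg_left (zpow_le_zpow_add_zpow ha hw.1.le hw.2.le l) (norm_nonneg _))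
  exact this.differentiableAt (hopen.mem_nhds ⟨haz, by simp [b]⟩)

/-! ### The Theta function -/

theorem summable_gaussian_nat {P x : ℝ} (hP : 1 < P) (hx : 0 < x) :
    Summable fun n : ℕ => P ^ (-triang n) * x ^ n := by
  have hP0 : 0 < P := zero_lt_one.trans hP
  refine summable_of_ratio_test_tendsto_lt_one zero_lt_one
    (Eventually.of_forall fun n => by positivity) ?_
  have h1 : Tendsto (fun n : ℕ => x * P⁻¹ * P⁻¹ ^ n) atTop (𝓝 (x * P⁻¹ * 0)) :=
    (tendsto_pow_atTop_nhds_zero_of_lt_one (by positivity) (inv_lt_one_of_one_lt₀ hP)).const_mul _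
  rw [mul_zero] at h1
  refine h1.congr fun n => ?_
  rw [Real.norm_of_nonneg (by positivity), Real.norm_of_nonneg (by positivity), Nat.cast_succ,
    triang_add, triang_one, mul_one, pow_succ, neg_add, neg_add, zpow_add₀ hP0.ne',
    zpow_add₀ hP0.ne', zpow_neg P (n : ℤ), zpow_natCast, zpow_neg_one, inv_pow]
  have : P ^ (-triang n) ≠ 0 := (zpow_pos hP0 _).ne'
  field_simp

theorem summable_gaussian {P x : ℝ} (hP : 1 < P) (hx : 0 < x) :
    Summable fun l : ℤ => P ^ (-triang l) * x ^ l := by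
  refine Summable.of_nat_of_neg_add_one ?_ ?_
  · simpa only [zpow_natCast] using summable_gaussian_nat hP hx
  · have := (summable_gaussian_nat hP (inv_pos.2 hx)).mul_left x⁻¹
    refine this.congr fun n => ?_
    rw [show (-((n : ℤ) + 1)) = -1 - n by ring, triang_neg_one_sub, zpow_sub₀ hx.ne', zpow_neg_one,
      zpow_natCast, inv_pow]
    ring

theorem norm_theta_term (p z : ℂ) (l : ℤ) :
    ‖p ^ (-triang l) * z ^ l‖ = ‖p‖ ^ (-triang l) * ‖z‖ ^ l := by
  rw [norm_mul, norm_zpow, norm_zpow]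

theorem hasSum_qTheta {p z : ℂ} (hp : 1 < ‖p‖) (hz : z ≠ 0) :
    HasSum (fun l : ℤ => p ^ (-triang l) * z ^ l) (qTheta p z) := by
  refine Summable.hasSum (Summable.of_norm ?_)
  simpa only [norm_theta_term] using summable_gaussian hp (norm_pos_iff.2 hz)

theorem differentiableAt_qTheta {p z : ℂ} (hp : 1 < ‖p‖) (hz : z ≠ 0) :
    DifferentiableAt ℂ (qTheta p) z :=
  differentiableAt_laurent (g := fun l => p ^ (-triang l)) le_rfl
    (fun x hx => by simpa only [norm_zpow] using summable_gaussian hp hx) (norm_pos_iff.2 hz)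

theorem qTheta_mul {p z : ℂ} (hp : 1 < ‖p‖) (hz : z ≠ 0) : qTheta p (p * z) = z * qTheta p z := by
  have hp0 : p ≠ 0 := norm_pos_iff.1 (zero_lt_one.trans hp)
  have h1 := hasSum_qTheta hp (mul_ne_zero hp0 hz)
  have h2 := (hasSum_qTheta hp hz).mul_left z
  rw [← (Equiv.addRight (1 : ℤ)).hasSum_iff] at h1
  refine h1.unique (h2.congr_fun ?_)
  intro l
  simp only [Function.comp, Equiv.coe_addRight]
  rw [triang_add, triang_one, mul_zpow, zpow_add_one₀ hz, mul_one, ← mul_assoc, ← zpow_add₀ hp0]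
  rw [show -(triang l + 1 + l) + (l + 1) = -triang l by ring]
  ring

/-- Iterating the functional equation in both directions. This is how the values of Θ along a spiral
reduce to a single value times an explicit Gaussian weight. -/
theorem qTheta_zpow_mul {p z : ℂ} (hp : 1 < ‖p‖) (hz : z ≠ 0) (k : ℤ) :
    qTheta p (p ^ k * z) = p ^ triang (k - 1) * z ^ k * qTheta p z := by
  have hp0 : p ≠ 0 := norm_pos_iff.1 (zero_lt_one.trans hp)
  have step : ∀ k : ℤ, qTheta p (p ^ (k + 1) * z) = p ^ k * z * qTheta p (p ^ k * z) := fun k => by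
    rw [zpow_add_one₀ hp0, mul_comm (p ^ k), mul_assoc,
      qTheta_mul hp (mul_ne_zero (zpow_ne_zero _ hp0) hz)]
  induction k using Int.induction_on with
  | zero => simp [show triang (-1) = 0 from rfl]
  | succ k ih =>
    rw [step, ih, show (k : ℤ) + 1 - 1 = (k - 1) + 1 by ring, triang_add, triang_one, mul_one,
      zpow_add_one₀ hz, show triang (k - 1) + 1 + ((k : ℤ) - 1) = triang (k - 1) + k by ring,
      zpow_add₀ hp0]
    ring
  | pred k ih =>
    have h := step (-k - 1)
    rw [sub_add_cancel, ih] at h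
    have hne : p ^ (-(k : ℤ) - 1) * z ≠ 0 := mul_ne_zero (zpow_ne_zero _ hp0) hz
    apply mul_left_cancel₀ hne
    rw [← h, triang_sub_one (-(k : ℤ) - 1), zpow_sub_one₀ hz (-(k : ℤ)), zpow_sub₀ hp0 (triang _)]
    have := zpow_ne_zero (-(k : ℤ) - 1) hp0
    field_simp

/-- The Theta function of positive real arguments dominates each of its terms. -/
theorem le_norm_qTheta_ofReal {P x : ℝ} (hP : 1 < P) (hx : 0 < x) (l : ℤ) :
    P ^ (-triang l) * x ^ l ≤ ‖qTheta (P : ℂ) (x : ℂ)‖ := by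
  have hP0 : 0 < P := zero_lt_one.trans hP
  have h : qTheta (P : ℂ) (x : ℂ) = ((∑' l : ℤ, P ^ (-triang l) * x ^ l : ℝ) : ℂ) := by
    rw [Complex.ofReal_tsum]; unfold qTheta; push_cast; rfl
  rw [h, Complex.norm_real]
  refine le_trans ?_ (le_abs_self _)
  exact (summable_gaussian hP hx).le_tsum l fun _ _ => by positivity

/-- The sum of the moduli of the terms of the Theta function. -/
def realTheta (P x : ℝ) : ℝ := ∑' l : ℤ, P ^ (-triang l) * x ^ l

theorem hasSum_realTheta {P x : ℝ} (hP : 1 < P) (hx : 0 < x) :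
    HasSum (fun l : ℤ => P ^ (-triang l) * x ^ l) (realTheta P x) :=
  (summable_gaussian hP hx).hasSum

theorem ofReal_realTheta (P x : ℝ) : ((realTheta P x : ℝ) : ℂ) = qTheta (P : ℂ) (x : ℂ) := by
  rw [realTheta, Complex.ofReal_tsum]; unfold qTheta; push_cast; rfl

theorem one_le_realTheta {P x : ℝ} (hP : 1 < P) (hx : 0 < x) : 1 ≤ realTheta P x := by
  have hP0 : 0 < P := zero_lt_one.trans hP
  have := (summable_gaussian hP hx).le_tsum 0 fun _ _ => by positivity
  simpa [triang_zero, realTheta] using this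

theorem realTheta_zpow_mul {P x : ℝ} (hP : 1 < P) (hx : 0 < x) (k : ℤ) :
    realTheta P (P ^ k * x) = P ^ triang (k - 1) * x ^ k * realTheta P x := by
  have h := qTheta_zpow_mul (p := (P : ℂ)) (z := (x : ℂ))
    (by rw [Complex.norm_real, Real.norm_of_nonneg (by linarith)]; exact hP)
    (by exact_mod_cast hx.ne') k
  have : ((P : ℂ) ^ k * x) = ((P ^ k * x : ℝ) : ℂ) := by push_cast; rfl
  rw [this, ← ofReal_realTheta, ← ofReal_realTheta] at h
  exact_mod_cast h

theorem continuousAt_realTheta {P x : ℝ} (hP : 1 < P) (hx : 0 < x) :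
    ContinuousAt (realTheta P) x := by
  have h1 : realTheta P = fun x : ℝ => (qTheta (P : ℂ) (x : ℂ)).re := by
    funext x; rw [← ofReal_realTheta, Complex.ofReal_re]
  rw [h1]
  have h2 : ContinuousAt (qTheta (P : ℂ)) (x : ℂ) := (differentiableAt_qTheta
    (by rw [Complex.norm_real, Real.norm_of_nonneg (by linarith)]; exact hP)
    (by exact_mod_cast hx.ne')).continuousAt
  exact Complex.continuous_re.continuousAt.comp
    (ContinuousAt.comp (f := fun x : ℝ => (x : ℂ)) h2 Complex.continuous_ofReal.continuousAt)

/-! ### The zeros of the Theta function -/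

/-- The `q`-Pochhammer symbol `(u; u)_n`. -/
def pochSelf (u : ℂ) (n : ℕ) : ℂ := ∏ k ∈ Finset.range n, (1 - u ^ (k + 1))

theorem pochSelf_succ (u : ℂ) (n : ℕ) : pochSelf u (n + 1) = pochSelf u n * (1 - u ^ (n + 1)) :=
  Finset.prod_range_succ _ _

theorem one_sub_pow_ne_zero {u : ℂ} (hu : ‖u‖ < 1) (k : ℕ) : 1 - u ^ (k + 1) ≠ 0 := by
  intro h
  have : ‖u ^ (k + 1)‖ = 1 := by rw [← sub_eq_zero.1 h, norm_one]
  rw [norm_pow] at this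
  exact (pow_lt_one₀ (norm_nonneg _) hu (Nat.succ_ne_zero k)).ne this

theorem pochSelf_ne_zero {u : ℂ} (hu : ‖u‖ < 1) (n : ℕ) : pochSelf u n ≠ 0 :=
  Finset.prod_ne_zero_iff.2 fun k _ => one_sub_pow_ne_zero hu k

/-- The Gaussian binomial coefficient. -/
def gaussBinom (u : ℂ) (n j : ℕ) : ℂ := pochSelf u n / (pochSelf u j * pochSelf u (n - j))

theorem gaussBinom_succ_succ {u : ℂ} (hu : ‖u‖ < 1) {n j : ℕ} (hj : j < n) :
    gaussBinom u (n + 1) (j + 1) = gaussBinom u n (j + 1) + u ^ (n - j) * gaussBinom u n j := by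
  obtain ⟨i, rfl⟩ : ∃ i, n = j + 1 + i := ⟨n - j - 1, by omega⟩
  unfold gaussBinom
  rw [show j + 1 + i + 1 - (j + 1) = i + 1 by omega, show j + 1 + i - (j + 1) = i by omega,
    show j + 1 + i - j = i + 1 by omega, pochSelf_succ u (j + 1 + i), pochSelf_succ u i,
    pochSelf_succ u j]
  have h1 := pochSelf_ne_zero hu i
  have h2 := pochSelf_ne_zero hu j
  have h3 := one_sub_pow_ne_zero hu i
  have h4 := one_sub_pow_ne_zero hu j
  field_simp
  ring

theorem gaussBinom_zero {u : ℂ} (hu : ‖u‖ < 1) (n : ℕ) : gaussBinom u n 0 = 1 := by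
  simp [gaussBinom, show pochSelf u 0 = 1 from rfl, pochSelf_ne_zero hu n]

theorem gaussBinom_self {u : ℂ} (hu : ‖u‖ < 1) (n : ℕ) : gaussBinom u n n = 1 := by
  simp [gaussBinom, show pochSelf u 0 = 1 from rfl, pochSelf_ne_zero hu n]

/-- The `q`-binomial theorem. -/
theorem prod_one_add_pow_mul {u : ℂ} (hu : ‖u‖ < 1) (y : ℂ) (n : ℕ) :
    ∏ k ∈ Finset.range n, (1 + u ^ k * y) =
      ∑ j ∈ Finset.range (n + 1), gaussBinom u n j * u ^ (j.choose 2) * y ^ j := by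
  induction n with
  | zero => simp [gaussBinom_zero hu]
  | succ n ih =>
    rw [Finset.prod_range_succ, ih, mul_add, mul_one, Finset.sum_mul]
    rw [Finset.sum_range_succ' _ (n + 1), Finset.sum_range_succ' _ n,
      Finset.sum_range_succ _ n, Finset.sum_range_succ _ n]
    have key : ∀ j ∈ Finset.range n,
        gaussBinom u (n + 1) (j + 1) * u ^ ((j + 1).choose 2) * y ^ (j + 1) =
        gaussBinom u n (j + 1) * u ^ ((j + 1).choose 2) * y ^ (j + 1) +
        gaussBinom u n j * u ^ (j.choose 2) * y ^ j * (u ^ n * y) := by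
      intro j hj
      have hj := Finset.mem_range.1 hj
      rw [gaussBinom_succ_succ hu hj, show (j + 1).choose 2 = j + j.choose 2 by
        rw [Nat.choose_succ_succ' j 1, Nat.choose_one_right]]
      have : u ^ n = u ^ (n - j) * u ^ j := by rw [← pow_add]; congr 1; omega
      rw [this]
      ring
    rw [Finset.sum_congr rfl key, Finset.sum_add_distrib, gaussBinom_self hu, gaussBinom_self hu,
      gaussBinom_zero hu, gaussBinom_zero hu, show (n + 1).choose 2 = n + n.choose 2 by
        rw [Nat.choose_succ_succ' n 1, Nat.choose_one_right]]
    simp only [Nat.choose_zero_succ, pow_zero]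
    ring

theorem prod_zpow_neg_mul {u z : ℂ} (hu0 : u ≠ 0) (m : ℕ) :
    ∏ k ∈ Finset.range m, (u ^ (-(k : ℤ)) * z) = u ^ (-triang ((m : ℤ) - 1)) * z ^ m := by
  induction m with
  | zero => simp [show triang (-1) = 0 from rfl]
  | succ m ih =>
    rw [Finset.prod_range_succ, ih, pow_succ, Nat.cast_succ, add_sub_cancel_right, triang_sub_one,
      show -triang m = -(triang m - m) + -(m : ℤ) by ring, zpow_add₀ hu0]
    ring

/-- A finite form of the Jacobi triple product identity. -/
theorem finite_triple_product {u z : ℂ} (hu : ‖u‖ < 1) (hu0 : u ≠ 0) (hz : z ≠ 0) (m : ℕ) :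
    (∏ k ∈ Finset.range m, (1 + u ^ (k + 1) * z)) * ∏ k ∈ Finset.range m, (1 + u ^ k * z⁻¹) =
      ∑ j ∈ Finset.range (2 * m + 1),
        gaussBinom u (2 * m) j * u ^ triang ((j : ℤ) - m) * z ^ ((j : ℤ) - m) := by
  -- The factor u^(1-m) centres the 2m exponents: half the factors then become 1 + u^(k+1) z, and
  -- the other half, after a monomial is pulled out, 1 + u^k z⁻¹.
  have h := prod_one_add_pow_mul hu (u ^ (1 - (m : ℤ)) * z) (2 * m)
  rw [two_mul, Finset.prod_range_add] at h
  have h1 : ∏ k ∈ Finset.range m, (1 + u ^ (m + k) * (u ^ (1 - (m : ℤ)) * z)) =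
      ∏ k ∈ Finset.range m, (1 + u ^ (k + 1) * z) := by
    refine Finset.prod_congr rfl fun k _ => ?_
    rw [← mul_assoc, ← zpow_natCast u (m + k), ← zpow_add₀ hu0, ← zpow_natCast u (k + 1)]
    congr 3; push_cast; ring
  have h2 : ∏ k ∈ Finset.range m, (1 + u ^ k * (u ^ (1 - (m : ℤ)) * z)) =
      u ^ (-triang ((m : ℤ) - 1)) * z ^ m * ∏ k ∈ Finset.range m, (1 + u ^ k * z⁻¹) := by
    rw [← prod_zpow_neg_mul hu0, ← Finset.prod_mul_distrib, ← Finset.prod_range_reflect]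
    refine Finset.prod_congr rfl fun k hk => ?_
    have hk := Finset.mem_range.1 hk
    have e : u ^ (-(k : ℤ)) * z * (1 + u ^ k * z⁻¹) = 1 + u ^ (-(k : ℤ)) * z := by
      have := pow_ne_zero k hu0
      rw [zpow_neg, zpow_natCast]
      field_simp
      ring
    rw [e, ← mul_assoc, ← zpow_natCast u (m - 1 - k), ← zpow_add₀ hu0]
    congr 3
    omega
  rw [h1, h2] at h
  have hne : u ^ (-triang ((m : ℤ) - 1)) * z ^ m ≠ 0 :=
    mul_ne_zero (zpow_ne_zero _ hu0) (pow_ne_zero _ hz)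
  apply mul_left_cancel₀ hne
  rw [← two_mul] at h
  rw [mul_comm (∏ k ∈ Finset.range m, (1 + u ^ (k + 1) * z)), ← mul_assoc, h, Finset.mul_sum]
  refine Finset.sum_congr rfl fun j _ => ?_
  rw [mul_pow, zpow_sub₀ hz, zpow_natCast, zpow_natCast, sub_eq_add_neg (j : ℤ), triang_add,
    triang_neg, triang_sub_one, ← zpow_natCast (u ^ (1 - (m : ℤ))), ← zpow_mul,
    ← zpow_natCast u (j.choose 2)]
  have hj : ((j.choose 2 : ℕ) : ℤ) = triang j - j := by
    rw [← triang_sub_one]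
    symm
    apply triang_eq_of_mul_two
    rw [sub_add_cancel]
    have := Nat.triangle_succ (j - 1)
    rcases j with _ | j
    · simp
    · have h3 := Nat.choose_two_right (j + 1)
      have h4 : (j + 1) * (j + 1 - 1) / 2 * 2 = (j + 1) * (j + 1 - 1) :=
        Nat.div_mul_cancel (by
          rw [Nat.add_sub_cancel, mul_comm]; exact (Nat.even_mul_succ_self j).two_dvd)
      rw [← h3] at h4
      zify at h4
      push_cast at h4 ⊢
      rw [h4]; ring
  rw [hj]
  have e : u ^ (triang ↑j + (triang ↑m - ↑m) + ↑j * -↑m) =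
      u ^ (triang (j : ℤ) - j) * u ^ ((1 - (m : ℤ)) * j) * u ^ (triang (m : ℤ) - m) := by
    rw [← zpow_add₀ hu0, ← zpow_add₀ hu0]; congr 1; ring
  rw [e, zpow_neg]
  have := zpow_ne_zero (triang (m : ℤ) - m) hu0
  have := pow_ne_zero m hz
  field_simp

theorem exists_tendsto_pochSelf {u : ℂ} (hu : ‖u‖ < 1) :
    ∃ c : ℂ, c ≠ 0 ∧ Tendsto (pochSelf u) atTop (𝓝 c) := by
  have hs : Summable fun k : ℕ => ‖-u ^ (k + 1)‖ := by
    simp only [norm_neg, norm_pow]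
    exact (summable_nat_add_iff 1).2 (summable_geometric_of_lt_one (norm_nonneg _) hu)
  refine ⟨∏' k : ℕ, (1 + -u ^ (k + 1)), tprod_one_add_ne_zero_of_summable
    (fun k => by simpa [← sub_eq_add_neg] using one_sub_pow_ne_zero hu k) hs, ?_⟩
  refine (multipliable_one_add_of_summable hs).hasProd.tendsto_prod_nat.congr fun n => ?_
  simp only [pochSelf, sub_eq_add_neg]

theorem exists_tendsto_prod_one_add {u w : ℂ} (hu : ‖u‖ < 1) (hw : ∀ k : ℕ, 1 + u ^ k * w ≠ 0) :
    ∃ c : ℂ, c ≠ 0 ∧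
      Tendsto (fun m : ℕ => ∏ k ∈ Finset.range m, (1 + u ^ k * w)) atTop (𝓝 c) := by
  have hs : Summable fun k : ℕ => ‖u ^ k * w‖ := by
    simp only [norm_mul, norm_pow]
    exact (summable_geometric_of_lt_one (norm_nonneg _) hu).mul_right _
  exact ⟨_, tprod_one_add_ne_zero_of_summable hw hs,
    (multipliable_one_add_of_summable hs).hasProd.tendsto_prod_nat⟩

/-- With u = 1/p, the finite triple products converge to a nonzero limit, since their infinite
factors converge absolutely and none vanishes off -p^ℤ. Their expansions converge to a multiple of
Θ_p(z), so Θ_p(z) cannot vanish. -/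
theorem qTheta_ne_zero {p z : ℂ} (hp : 1 < ‖p‖) (hz : z ≠ 0) (h : ∀ k : ℤ, z ≠ -p ^ k) :
    qTheta p z ≠ 0 := by
  have hp0 : p ≠ 0 := norm_pos_iff.1 (zero_lt_one.trans hp)
  set u := p⁻¹ with hu_def
  have hu0 : u ≠ 0 := inv_ne_zero hp0
  have hu : ‖u‖ < 1 := by rw [hu_def, norm_inv]; exact inv_lt_one_of_one_lt₀ hp
  obtain ⟨c, hc, hct⟩ := exists_tendsto_pochSelf hu
  obtain ⟨c₁, hc₁, hct₁⟩ := exists_tendsto_prod_one_add (w := u * z) hu (fun k hk => by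
    apply h (k + 1)
    have e : u ^ (k + 1) * z = -1 := by rw [pow_succ]; linear_combination hk
    rw [hu_def, inv_pow, inv_mul_eq_iff_eq_mul₀ (pow_ne_zero _ hp0)] at e
    rw [e, show (k : ℤ) + 1 = ((k + 1 : ℕ) : ℤ) by push_cast; rfl, zpow_natCast]; ring)
  obtain ⟨c₂, hc₂, hct₂⟩ := exists_tendsto_prod_one_add (w := z⁻¹) hu (fun k hk => by
    apply h (-k)
    have e : u ^ k = -z := by
      have : u ^ k * z⁻¹ = -1 := by linear_combination hk
      rw [mul_inv_eq_iff_eq_mul₀ hz] at this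
      rw [this]; ring
    rw [zpow_neg, zpow_natCast, ← inv_pow, ← hu_def, e, neg_neg])
  have hprod := hct₁.mul hct₂
  -- the coefficients of the finite products
  set coef : ℕ → ℤ → ℂ := fun m l => if l ∈ Finset.Icc (-(m : ℤ)) m then
    gaussBinom u (2 * m) (m + l).toNat * u ^ triang l * z ^ l else 0 with hcoef
  have hfin : ∀ m : ℕ, (∏ k ∈ Finset.range m, (1 + u ^ k * (u * z))) *
      ∏ k ∈ Finset.range m, (1 + u ^ k * z⁻¹) = ∑' l : ℤ, coef m l := by
    intro m
    have e1 : ∏ k ∈ Finset.range m, (1 + u ^ k * (u * z)) =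
        ∏ k ∈ Finset.range m, (1 + u ^ (k + 1) * z) :=
      Finset.prod_congr rfl fun k _ => by rw [pow_succ, mul_assoc]
    rw [e1, finite_triple_product hu hu0 hz, tsum_eq_sum (s := Finset.Icc (-(m : ℤ)) m)
      (fun l hl => if_neg hl)]
    refine Finset.sum_nbij' (fun j : ℕ => (j : ℤ) - m) (fun l : ℤ => (m + l).toNat) ?_ ?_ ?_ ?_ ?_
    · intro j hj
      simp only [Finset.mem_range, Finset.mem_Icc] at hj ⊢
      omega
    · intro l hl
      simp only [Finset.mem_range, Finset.mem_Icc] at hl ⊢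
      omega
    · intro j _
      simp
    · intro l hl
      simp only [Finset.mem_Icc] at hl
      omega
    · intro j hj
      have hj := Finset.mem_range.1 hj
      rw [if_pos (by simp only [Finset.mem_Icc]; omega)]
      simp
  have hbd : ∃ A : ℝ, ∀ n, ‖pochSelf u n‖ ≤ A := by
    obtain ⟨A, hA⟩ := hct.norm.bddAbove_range
    exact ⟨A, fun n => hA ⟨n, rfl⟩⟩
  have hbd' : ∃ A : ℝ, ∀ n, ‖(pochSelf u n)⁻¹‖ ≤ A := by
    obtain ⟨A, hA⟩ := (hct.inv₀ hc).norm.bddAbove_range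
    exact ⟨A, fun n => hA ⟨n, rfl⟩⟩
  obtain ⟨A, hA⟩ := hbd
  obtain ⟨A', hA'⟩ := hbd'
  have hA0 : 0 ≤ A := (norm_nonneg _).trans (hA 0)
  have hA'0 : 0 ≤ A' := (norm_nonneg _).trans (hA' 0)
  -- Dominated convergence: (u;u)_n and its inverse are bounded, so the Gaussian binomials are
  -- bounded uniformly in m and l, and the Theta series itself is the majorant. For fixed l the
  -- coefficient tends to c / (c * c).
  have hlim : Tendsto (fun m : ℕ => ∑' l : ℤ, coef m l) atTop
      (𝓝 (∑' l : ℤ, c / (c * c) * u ^ triang l * z ^ l)) := by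
    refine tendsto_tsum_of_dominated_convergence
      (bound := fun l : ℤ => A * (A' * A') * (‖p‖ ^ (-triang l) * ‖z‖ ^ l))
      ((summable_gaussian hp (norm_pos_iff.2 hz)).mul_left _) ?_ ?_
    · intro l
      have t1 : Tendsto (fun m : ℕ => 2 * m) atTop atTop :=
        tendsto_atTop_mono (fun m => by simp only [id]; omega) tendsto_id
      have t2 : Tendsto (fun m : ℕ => ((m : ℤ) + l).toNat) atTop atTop := by
        refine tendsto_atTop.2 fun b => ?_
        filter_upwards [eventually_ge_atTop (b + l.natAbs)] with m hm
        omega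
      have t3 : Tendsto (fun m : ℕ => 2 * m - ((m : ℤ) + l).toNat) atTop atTop := by
        refine tendsto_atTop.2 fun b => ?_
        filter_upwards [eventually_ge_atTop (b + l.natAbs)] with m hm
        omega
      have t4 := (((hct.comp t1).div ((hct.comp t2).mul (hct.comp t3)) (mul_ne_zero hc hc)).mul_const
        (u ^ triang l)).mul_const (z ^ l)
      refine t4.congr' ?_
      filter_upwards [eventually_ge_atTop l.natAbs] with m hm
      simp only [hcoef]
      rw [if_pos (by simp only [Finset.mem_Icc]; omega)]
      rfl
    · refine Eventually.of_forall fun m l => ?_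
      simp only [hcoef]
      split_ifs with hl
      · rw [norm_mul, norm_mul, norm_zpow, norm_zpow, hu_def, norm_inv, inv_zpow', ← hu_def,
          mul_assoc]
        refine mul_le_mul_of_nonneg_right ?_ (by positivity)
        rw [gaussBinom, div_eq_mul_inv, mul_inv, norm_mul, norm_mul]
        gcongr
        exacts [hA _, hA' _, hA' _]
      · rw [norm_zero]; positivity
  have huniq := tendsto_nhds_unique (hprod.congr hfin) hlim
  intro h0
  have : ∑' l : ℤ, c / (c * c) * u ^ triang l * z ^ l = c / (c * c) * qTheta p z := by
    unfold qTheta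
    rw [← tsum_mul_left]
    refine tsum_congr fun l => ?_
    rw [hu_def, inv_zpow', mul_assoc]; rfl
  rw [this, h0, mul_zero] at huniq
  exact mul_ne_zero hc₁ hc₂ huniq

/-! ### Complements of discrete spirals -/

/-- The complement in `ℂ*` of the discrete spirals `ρ ^ ℤ w`, `w ∈ Z`. -/
def offSpirals (ρ : ℂ) (Z : Set ℂ) : Set ℂ := {z | z ≠ 0 ∧ ∀ w ∈ Z, ∀ l : ℤ, z ≠ ρ ^ l * w}

theorem zpow_mul_mem_offSpirals {ρ : ℂ} (hρ : ρ ≠ 0) {Z : Set ℂ} {z : ℂ} (hz : z ∈ offSpirals ρ Z)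
    (k : ℤ) : ρ ^ k * z ∈ offSpirals ρ Z := by
  refine ⟨mul_ne_zero (zpow_ne_zero _ hρ) hz.1, fun w hw l h => hz.2 w hw (l - k) ?_⟩
  apply mul_left_cancel₀ (zpow_ne_zero k hρ)
  rw [h, ← mul_assoc, ← zpow_add₀ hρ, add_sub_cancel]

/-- A spiral is locally finite in ℂ*: the moduli of its points form a geometric progression. -/
theorem finite_zpow_mem_annulus {R : ℝ} (hR : 1 < R) {w a b : ℝ} (hw : 0 < w) (ha : 0 < a) :
    {l : ℤ | a < R ^ l * w ∧ R ^ l * w < b}.Finite := by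
  obtain ⟨n, hn⟩ := pow_unbounded_of_one_lt (b / w) hR
  obtain ⟨m, hm⟩ := pow_unbounded_of_one_lt (w / a) hR
  refine (Set.finite_Ioo (-(m : ℤ)) n).subset fun l hl => ⟨?_, ?_⟩
  · rw [← zpow_lt_zpow_iff_right₀ hR, zpow_neg, zpow_natCast]
    rw [div_lt_iff₀ ha] at hm
    have : w < R ^ m * (R ^ l * w) := hm.trans (mul_lt_mul_of_pos_left hl.1 (by positivity))
    rw [← mul_assoc] at this
    have h1 : 1 < R ^ m * R ^ l := by
      by_contra hcon
      have := mul_le_of_le_one_left hw.le (not_lt.1 hcon)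
      linarith
    rwa [inv_lt_iff_one_lt_mul₀' (by positivity)]
  · rw [← zpow_lt_zpow_iff_right₀ hR, zpow_natCast]
    refine lt_trans ?_ hn
    rw [lt_div_iff₀ hw]
    exact hl.2

theorem eventually_ne_zpow_mul {ρ : ℂ} (hρ : 1 < ‖ρ‖) {z : ℂ} (hz : z ≠ 0) (w : ℂ) :
    ∀ᶠ y in 𝓝[≠] z, ∀ l : ℤ, y ≠ ρ ^ l * w := by
  rcases eq_or_ne w 0 with rfl | hw
  · filter_upwards [nhdsWithin_le_nhds (isOpen_ne.mem_nhds hz)] with y hy l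
    simpa using hy
  have hz' : 0 < ‖z‖ := norm_pos_iff.2 hz
  have hfin := finite_zpow_mem_annulus hρ (b := 2 * ‖z‖) (norm_pos_iff.2 hw) (half_pos hz')
  have hB : ((fun l : ℤ => ρ ^ l * w) '' {l | ‖z‖ / 2 < ‖ρ‖ ^ l * ‖w‖ ∧
      ‖ρ‖ ^ l * ‖w‖ < 2 * ‖z‖} \ {z}).Finite := (hfin.image _).subset Set.sdiff_subset
  have h1 : ∀ᶠ y in 𝓝[≠] z, y ∉ ((fun l : ℤ => ρ ^ l * w) '' {l | ‖z‖ / 2 < ‖ρ‖ ^ l * ‖w‖ ∧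
      ‖ρ‖ ^ l * ‖w‖ < 2 * ‖z‖} \ {z}) :=
    nhdsWithin_le_nhds (hB.isClosed.isOpen_compl.mem_nhds fun h => h.2 rfl)
  have h2 : ∀ᶠ y in 𝓝[≠] z, ‖z‖ / 2 < ‖y‖ ∧ ‖y‖ < 2 * ‖z‖ :=
    nhdsWithin_le_nhds (((isOpen_lt continuous_const continuous_norm).inter
      (isOpen_lt continuous_norm continuous_const)).mem_nhds ⟨half_lt_self hz', by
        change ‖z‖ < 2 * ‖z‖; linarith⟩)
  filter_upwards [h1, h2, self_mem_nhdsWithin] with y hy1 hy2 hy3 l hl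
  refine hy1 ⟨⟨l, ?_, hl.symm⟩, hy3⟩
  rw [hl, norm_mul, norm_zpow] at hy2
  exact hy2

theorem offSpirals_mem_nhdsNE {ρ : ℂ} (hρ : 1 < ‖ρ‖) {Z : Set ℂ} (hZ : Z.Finite) {z : ℂ}
    (hz : z ≠ 0) : offSpirals ρ Z ∈ 𝓝[≠] z := by
  have h1 : ∀ᶠ y in 𝓝[≠] z, ∀ w ∈ Z, ∀ l : ℤ, y ≠ ρ ^ l * w :=
    (eventually_all_finite hZ).2 fun w _ => eventually_ne_zpow_mul hρ hz w
  filter_upwards [h1, nhdsWithin_le_nhds (isOpen_ne.mem_nhds hz)] with y hy hy0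
  exact ⟨hy0, hy⟩

theorem isOpen_offSpirals {ρ : ℂ} (hρ : 1 < ‖ρ‖) {Z : Set ℂ} (hZ : Z.Finite) :
    IsOpen (offSpirals ρ Z) := by
  rw [isOpen_iff_mem_nhds]
  intro z hz
  have := offSpirals_mem_nhdsNE hρ hZ hz.1
  rw [mem_nhdsWithin_iff_exists_mem_nhds_inter] at this
  obtain ⟨u, hu, hsub⟩ := this
  refine mem_of_superset hu fun y hy => ?_
  rcases eq_or_ne y z with rfl | hyz
  · exact hz
  · exact hsub ⟨hy, hyz⟩

/-- The complement of a countable set in a real vector space of dimension at least 2 is path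
connected. -/
theorem isPathConnected_offSpirals {ρ : ℂ} {Z : Set ℂ} (hZ : Z.Finite) :
    IsPathConnected (offSpirals ρ Z) := by
  have hc : ({0} ∪ ⋃ w ∈ Z, Set.range fun l : ℤ => ρ ^ l * w).Countable :=
    (Set.countable_singleton _).union (hZ.countable.biUnion fun w _ => Set.countable_range _)
  have := hc.isPathConnected_compl_of_one_lt_rank (by
    rw [Complex.rank_real_complex]; exact Cardinal.one_lt_two)
  convert! this using 1
  ext z
  simp only [offSpirals, Set.mem_ofPred_eq, Set.mem_compl_iff, Set.mem_union, Set.mem_singleton_iff,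
    Set.mem_iUnion, Set.mem_range, not_or, not_exists, eq_comm (a := z)]
  tauto

/-- A relatively compact connected neighbourhood of a path from `lam` to `ρ lam` off the spirals. -/
theorem exists_connected_nhd {ρ : ℂ} (hρ : 1 < ‖ρ‖) {Z : Set ℂ} (hZ : Z.Finite) {lam : ℂ}
    (hlam : lam ∈ offSpirals ρ Z) : ∃ V C : Set ℂ, IsOpen V ∧ IsConnected V ∧ V ⊆ C ∧ IsCompact C ∧
      C ⊆ offSpirals ρ Z ∧ lam ∈ V ∧ ρ * lam ∈ V := by
  have hρ0 : ρ ≠ 0 := norm_pos_iff.1 (zero_lt_one.trans hρ)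
  have hρl : ρ * lam ∈ offSpirals ρ Z := by simpa using zpow_mul_mem_offSpirals hρ0 hlam 1
  obtain ⟨γ, hγ⟩ := (isPathConnected_offSpirals hZ).joinedIn lam hlam _ hρl
  have hcomp : IsCompact (Set.range γ) := isCompact_range γ.continuous
  obtain ⟨δ, hδ, hsub⟩ := hcomp.exists_cthickening_subset_open (isOpen_offSpirals hρ hZ)
    (Set.range_subset_iff.2 hγ)
  have hmem : ∀ t, γ t ∈ Metric.thickening δ (Set.range γ) := fun t =>
    Metric.self_subset_thickening hδ _ ⟨t, rfl⟩
  refine ⟨Metric.thickening δ (Set.range γ), Metric.cthickening δ (Set.range γ),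
    Metric.isOpen_thickening, ?_, Metric.thickening_subset_cthickening _ _, hcomp.cthickening, hsub,
    by simpa using hmem 0, by simpa using hmem 1⟩
  rw [← add_ball_zero]
  have h1 : IsConnected (Set.range γ) := isConnected_range γ.continuous
  have h2 : IsConnected (Metric.ball (0 : ℂ) δ) :=
    ⟨⟨0, Metric.mem_ball_self hδ⟩, (convex_ball _ _).isPreconnected⟩
  have := (h1.prod h2).image (fun x : ℂ × ℂ => x.1 + x.2) continuous_add.continuousOn
  rwa [Set.add_image_prod (s := Set.range γ) (t := Metric.ball 0 δ)] at this

/-- The union of the dilates `ρ ^ l V`, `l ∈ ℤ`. -/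
def spiralHull (ρ : ℂ) (V : Set ℂ) : Set ℂ := ⋃ l : ℤ, (fun z => ρ ^ l * z) '' V

theorem isOpen_spiralHull {ρ : ℂ} (hρ : ρ ≠ 0) {V : Set ℂ} (hV : IsOpen V) :
    IsOpen (spiralHull ρ V) :=
  isOpen_iUnion fun l => (Homeomorph.mulLeft₀ _ (zpow_ne_zero l hρ)).isOpenMap V hV

/-- Consecutive dilates of V share the point ρ^(l+1) lam, so they form a chain. -/
theorem isConnected_spiralHull {ρ : ℂ} (hρ : ρ ≠ 0) {V : Set ℂ} (hV : IsConnected V) {lam : ℂ}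
    (h1 : lam ∈ V) (h2 : ρ * lam ∈ V) : IsConnected (spiralHull ρ V) := by
  refine IsConnected.iUnion_of_chain (fun l => hV.image _ (by fun_prop)) fun l => ?_
  refine ⟨ρ ^ l * (ρ * lam), ⟨_, h2, rfl⟩, ⟨lam, h1, ?_⟩⟩
  simp only [Order.succ_eq_add_one, zpow_add_one₀ hρ]
  ring

/-- Bounds on each dilate of a compact set give a bound on finitely many of them. -/
theorem exists_bound_zpow_mul {ρ : ℂ} {U C : Set ℂ} (hC : IsCompact C)
    (hU : ∀ z ∈ C, ∀ l : ℤ, ρ ^ l * z ∈ U) {f : ℂ → ℂ} (hf : ContinuousOn f U) {l₀ : ℤ} {B₀ : ℝ}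
    (hB₀ : ∀ l ≤ l₀, ∀ c ∈ C, ‖f (ρ ^ l * c)‖ ≤ B₀) (l₁ : ℤ) :
    ∃ B : ℝ, 1 ≤ B ∧ ∀ l ≤ l₁, ∀ c ∈ C, ‖f (ρ ^ l * c)‖ ≤ B := by
  have h : ∀ l : ℤ, ∃ b : ℝ, ∀ c ∈ C, ‖f (ρ ^ l * c)‖ ≤ b := fun l =>
    hC.exists_bound_of_continuousOn (f := fun c => f (ρ ^ l * c))
      (hf.comp (by fun_prop) fun z hz => hU z hz l)
  choose b hb using h
  refine ⟨1 + |B₀| + ∑ l ∈ Finset.Icc l₀ l₁, |b l|, ?_, fun l hl c hc => ?_⟩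
  · have : 0 ≤ ∑ l ∈ Finset.Icc l₀ l₁, |b l| := Finset.sum_nonneg fun _ _ => abs_nonneg _
    have := abs_nonneg B₀
    linarith
  · have h0 : 0 ≤ ∑ l ∈ Finset.Icc l₀ l₁, |b l| := Finset.sum_nonneg fun _ _ => abs_nonneg _
    rcases le_total l l₀ with h1 | h1
    · have := hB₀ l h1 c hc
      have := le_abs_self B₀
      linarith
    · have h2 := hb l c hc
      have h3 : |b l| ≤ ∑ l ∈ Finset.Icc l₀ l₁, |b l| :=
        Finset.single_le_sum (f := fun l => |b l|) (fun _ _ => abs_nonneg _)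
          (Finset.mem_Icc.2 ⟨h1, hl⟩)
      have := le_abs_self (b l)
      have := abs_nonneg B₀
      linarith

/-! ### Difference operators with shifts in the powers of `ρ` -/

/-- The operator `∑ s ∈ S, c_s z ^ (j_s) σ ^ (m_s)`, where `σ` is `z ↦ ρ z`. -/
def shiftOp {ι : Type*} (ρ : ℂ) (S : Finset ι) (c : ι → ℂ) (j : ι → ℕ) (m : ι → ℤ)
    (f : ℂ → ℂ) (z : ℂ) : ℂ :=
  ∑ s ∈ S, c s * z ^ j s * f (ρ ^ m s * z)

/-- The coefficient of `σ ^ e` in the operator `∑ s ∈ S, c_s z ^ (j_s) σ ^ (m_s)`. -/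
def topPoly {ι : Type*} (S : Finset ι) (c : ι → ℂ) (j : ι → ℕ) (m : ι → ℤ) (e : ℤ) :
    Polynomial ℂ :=
  ∑ s ∈ S with m s = e, Polynomial.C (c s) * Polynomial.X ^ j s

/-- The right-hand side of the equation `∑ s ∈ S, c_s z ^ (j_s) σ ^ (m_s) f = A`, solved for the
value of `f` under the highest shift `σ ^ e`. -/
def solveTop {ι : Type*} (ρ : ℂ) (S : Finset ι) (c : ι → ℂ) (j : ι → ℕ) (m : ι → ℤ) (e : ℤ)
    (A : Polynomial ℂ) (f : ℂ → ℂ) (z : ℂ) : ℂ :=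
  (A.eval (ρ ^ (-e) * z) - ∑ s ∈ S with ¬ m s = e,
    c s * (ρ ^ (-e) * z) ^ j s * f (ρ ^ (m s - e) * z)) /
    (topPoly S c j m e).eval (ρ ^ (-e) * z)

section ShiftOp

variable {ι : Type*} {ρ : ℂ} {S : Finset ι} {c : ι → ℂ} {j : ι → ℕ} {m : ι → ℤ} {e : ℤ}
  {A : Polynomial ℂ} {f g : ℂ → ℂ} {Z : Set ℂ}

theorem shiftOp_eq_topPoly_add (hρ : ρ ≠ 0) (z : ℂ) :
    shiftOp ρ S c j m f (ρ ^ (-e) * z) =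
      (topPoly S c j m e).eval (ρ ^ (-e) * z) * f z + ∑ s ∈ S with ¬ m s = e,
        c s * (ρ ^ (-e) * z) ^ j s * f (ρ ^ (m s - e) * z) := by
  unfold shiftOp topPoly
  rw [← Finset.sum_filter_add_sum_filter_not S (fun s => m s = e)]
  congr 1
  · rw [Polynomial.eval_finsetSum, Finset.sum_mul]
    refine Finset.sum_congr rfl fun s hs => ?_
    rw [(Finset.mem_filter.1 hs).2, ← mul_assoc (ρ ^ e), ← zpow_add₀ hρ]
    simp
  · refine Finset.sum_congr rfl fun s _ => ?_
    rw [← mul_assoc (ρ ^ m s), ← zpow_add₀ hρ, sub_eq_add_neg]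

theorem eq_solveTop (hρ : ρ ≠ 0) {z : ℂ}
    (hb : (topPoly S c j m e).eval (ρ ^ (-e) * z) ≠ 0)
    (h : shiftOp ρ S c j m f (ρ ^ (-e) * z) = A.eval (ρ ^ (-e) * z)) :
    f z = solveTop ρ S c j m e A f z := by
  rw [shiftOp_eq_topPoly_add hρ] at h
  rw [solveTop, ← h, add_sub_cancel_right, mul_div_cancel_left₀ _ hb]

theorem shiftOp_eq_of_eq_solveTop (hρ : ρ ≠ 0) {z : ℂ}
    (hb : (topPoly S c j m e).eval (ρ ^ (-e) * z) ≠ 0)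
    (h : f z = solveTop ρ S c j m e A f z) :
    shiftOp ρ S c j m f (ρ ^ (-e) * z) = A.eval (ρ ^ (-e) * z) := by
  rw [shiftOp_eq_topPoly_add hρ, h, solveTop, mul_div_cancel₀ _ hb, sub_add_cancel]

theorem solveTop_congr {z : ℂ} (h : ∀ s ∈ S, m s ≠ e → f (ρ ^ (m s - e) * z) =
    g (ρ ^ (m s - e) * z)) : solveTop ρ S c j m e A f z = solveTop ρ S c j m e A g z := by
  unfold solveTop
  congr 2
  refine Finset.sum_congr rfl fun s hs => ?_
  rw [h s (Finset.mem_filter.1 hs).1 (Finset.mem_filter.1 hs).2]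

theorem topPoly_eval_ne_zero (hρ : ρ ≠ 0)
    (hroots : ∀ w, (topPoly S c j m e).IsRoot w → w ∈ Z) {z : ℂ} (hz : z ∈ offSpirals ρ Z) (k : ℤ) :
    (topPoly S c j m e).eval (ρ ^ k * z) ≠ 0 := fun h => by
  refine hz.2 _ (hroots _ h) (-k) ?_
  rw [← mul_assoc, ← zpow_add₀ hρ]
  simp

theorem analyticAt_solveTop {z : ℂ}
    (hb : (topPoly S c j m e).eval (ρ ^ (-e) * z) ≠ 0)
    (h : ∀ s ∈ S, m s ≠ e → AnalyticAt ℂ f (ρ ^ (m s - e) * z)) :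
    AnalyticAt ℂ (solveTop ρ S c j m e A f) z := by
  have hp : ∀ p : Polynomial ℂ, AnalyticAt ℂ (fun z => p.eval (ρ ^ (-e) * z)) z := fun p =>
    Differentiable.analyticAt (p.differentiable.comp (by fun_prop)) z
  refine ((hp A).sub (Finset.analyticAt_fun_sum _ fun s hs => ?_)).div (hp _) hb
  obtain ⟨hs, hne⟩ := Finset.mem_filter.1 hs
  refine AnalyticAt.mul (by fun_prop) ?_
  exact AnalyticAt.fun_comp (h s hs hne) (by fun_prop)

theorem meromorphicAt_solveTop {z : ℂ}
    (h : ∀ s ∈ S, m s ≠ e → MeromorphicAt f (ρ ^ (m s - e) * z)) :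
    MeromorphicAt (solveTop ρ S c j m e A f) z := by
  have hp : ∀ p : Polynomial ℂ, MeromorphicAt (fun z => p.eval (ρ ^ (-e) * z)) z := fun p =>
    (Differentiable.analyticAt (p.differentiable.comp (by fun_prop)) z).meromorphicAt
  refine ((hp A).sub (MeromorphicAt.fun_sum fun s hs => ?_)).div (hp _)
  obtain ⟨hs, hne⟩ := Finset.mem_filter.1 hs
  refine MeromorphicAt.mul (AnalyticAt.meromorphicAt (by fun_prop)) ?_
  exact MeromorphicAt.comp_analyticAt (g := fun z => ρ ^ (m s - e) * z) (h s hs hne) (by fun_prop)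

/-- The equation solved for its top shift expresses f(z) through f(ρ^(m-e) z) with m < e, that is,
through points whose modulus is smaller by a factor at least |ρ|. Each use of it enlarges the disc
of definition by the factor |ρ|; divisions are by the top coefficient only, so new singularities
stay on the spirals of its roots. -/
theorem exists_continuation (hρ : 1 < ‖ρ‖) (hZ : Z.Finite) (hm : ∀ s ∈ S, m s ≤ e)
    (hroots : ∀ w, (topPoly S c j m e).IsRoot w → w ∈ Z) {f₀ : ℂ → ℂ} {δ : ℝ} (hδ : 0 < δ)
    (hmer : ∀ z, z ≠ 0 → ‖z‖ < δ → MeromorphicAt f₀ z)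
    (han : ∀ z ∈ offSpirals ρ Z, ‖z‖ < δ → AnalyticAt ℂ f₀ z)
    (heq : ∀ z ∈ offSpirals ρ Z, ‖z‖ < δ → shiftOp ρ S c j m f₀ z = A.eval z) :
    ∃ f : ℂ → ℂ, (∃ δ' > 0, ∀ z, ‖z‖ < δ' → f z = f₀ z) ∧ (∀ z, z ≠ 0 → MeromorphicAt f z) ∧
      (∀ z ∈ offSpirals ρ Z, AnalyticAt ℂ f z) ∧
      ∀ z ∈ offSpirals ρ Z, shiftOp ρ S c j m f z = A.eval z := by
  have hρ0 : ρ ≠ 0 := norm_pos_iff.1 (zero_lt_one.trans hρ)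
  have hρn : 0 < ‖ρ‖ := norm_pos_iff.2 hρ0
  set U := offSpirals ρ Z with hU
  have hb : ∀ z ∈ U, ∀ k : ℤ, (topPoly S c j m e).eval (ρ ^ k * z) ≠ 0 := fun z hz k =>
    topPoly_eval_ne_zero hρ0 hroots hz k
  -- The equation is used at ρ^(-e) z, which for negative e is larger than z; both points have to
  -- lie in the disc of radius δ.
  obtain ⟨δ', hδ', hδ'δ, hδ'e⟩ : ∃ δ' > 0, δ' ≤ δ ∧ ∀ z : ℂ, ‖z‖ < δ' → ‖ρ ^ (-e) * z‖ < δ := by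
    refine ⟨min δ (‖ρ‖ ^ e * δ), by positivity, min_le_left _ _, fun z hz => ?_⟩
    have := hz.trans_le (min_le_right _ _)
    rw [norm_mul, norm_zpow, zpow_neg, inv_mul_lt_iff₀ (by positivity)]
    exact this
  have hsmall : ∀ s ∈ S, m s ≠ e → ∀ (z : ℂ) (k : ℕ), ‖z‖ < δ' * ‖ρ‖ ^ (k + 1) →
      ‖ρ ^ (m s - e) * z‖ < δ' * ‖ρ‖ ^ k := by
    intro s hs hne z k hz
    have h1 : m s - e ≤ -1 := by have := hm s hs; omega
    rw [norm_mul, norm_zpow]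
    calc ‖ρ‖ ^ (m s - e) * ‖z‖ ≤ ‖ρ‖ ^ (-1 : ℤ) * ‖z‖ := by
          gcongr; exact hρ.le
      _ < ‖ρ‖ ^ (-1 : ℤ) * (δ' * ‖ρ‖ ^ (k + 1)) := by gcongr
      _ = δ' * ‖ρ‖ ^ k := by rw [zpow_neg_one, pow_succ]; field_simp
  have hle : ∀ (z : ℂ) (k : ℕ), ‖z‖ < δ' * ‖ρ‖ ^ k → ‖z‖ < δ' * ‖ρ‖ ^ (k + 1) := by
    intro z k hz
    refine hz.trans_le ?_
    gcongr
    · exact hρ.le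
    · omega
  -- successive extensions
  set F : ℕ → ℂ → ℂ := fun k => Nat.rec f₀
    (fun _ G z => if ‖z‖ < δ' then f₀ z else solveTop ρ S c j m e A G z) k with hF
  have hF0 : F 0 = f₀ := rfl
  have hFs : ∀ k z, F (k + 1) z = if ‖z‖ < δ' then f₀ z else solveTop ρ S c j m e A (F k) z :=
    fun k z => rfl
  have hstab : ∀ k z, ‖z‖ < δ' * ‖ρ‖ ^ k → F (k + 1) z = F k z := by
    intro k
    induction k with
    | zero =>
      intro z hz
      rw [pow_zero, mul_one] at hz
      rw [hFs, if_pos hz, hF0]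
    | succ k ih =>
      intro z hz
      rw [hFs (k + 1), hFs k]
      split_ifs with h
      · rfl
      · exact solveTop_congr fun s hs hne => ih _ (hsmall s hs hne z k hz)
  have hstab' : ∀ k i z, ‖z‖ < δ' * ‖ρ‖ ^ k → F (k + i) z = F k z := by
    intro k i
    induction i with
    | zero => intro z _; rfl
    | succ i ih =>
      intro z hz
      rw [← add_assoc, hstab (k + i) z, ih z hz]
      refine hz.trans_le ?_
      gcongr
      · exact hρ.le
      · omega
  have hex : ∀ z : ℂ, ∃ k : ℕ, ‖z‖ < δ' * ‖ρ‖ ^ k := fun z => by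
    obtain ⟨k, hk⟩ := pow_unbounded_of_one_lt (‖z‖ / δ') hρ
    exact ⟨k, by rwa [div_lt_iff₀' hδ'] at hk⟩
  choose k hk using hex
  -- Any step that reaches z would do: the successive extensions agree wherever the earlier one is
  -- valid.
  set f : ℂ → ℂ := fun z => F (k z) z with hf
  have hfF : ∀ i z, ‖z‖ < δ' * ‖ρ‖ ^ i → f z = F i z := by
    intro i z hz
    rcases le_total i (k z) with h | h
    · obtain ⟨t, ht⟩ := Nat.exists_eq_add_of_le h
      rw [hf]; dsimp only; rw [ht, hstab' i t z hz]
    · obtain ⟨t, ht⟩ := Nat.exists_eq_add_of_le h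
      rw [ht, hstab' (k z) t z (hk z)]
  have hf₀ : ∀ z, ‖z‖ < δ' → f z = f₀ z := fun z hz => by
    rw [hfF 0 z (by simpa using hz), hF0]
  have hsolve : ∀ z ∈ U, f z = solveTop ρ S c j m e A f z := by
    intro z hz
    by_cases h : ‖z‖ < δ'
    · rw [hf₀ z h, eq_solveTop (A := A) hρ0 (hb z hz _)
        (heq _ (zpow_mul_mem_offSpirals hρ0 hz _) (hδ'e z h))]
      refine solveTop_congr fun s hs hne => (hf₀ _ ?_).symm
      simpa using hsmall s hs hne z 0 (hle z 0 (by simpa using h))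
    · rw [hfF (k z + 1) z (hle z _ (hk z)), hFs, if_neg h]
      exact solveTop_congr fun s hs hne => (hfF _ _ (hsmall s hs hne z _ (hle z _ (hk z)))).symm
  have hUo : IsOpen U := isOpen_offSpirals hρ hZ
  have hball : IsOpen {z : ℂ | ‖z‖ < δ'} := isOpen_lt continuous_norm continuous_const
  refine ⟨f, ⟨δ', hδ', hf₀⟩, fun z hz => ?_, fun z hz => ?_, fun z hz => ?_⟩
  · have main : ∀ i : ℕ, ∀ z, z ≠ 0 → ‖z‖ < δ' * ‖ρ‖ ^ i → MeromorphicAt f z := by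
      intro i
      induction i with
      | zero =>
        intro z hz0 hz
        rw [pow_zero, mul_one] at hz
        refine (hmer z hz0 (hz.trans_le hδ'δ)).congr (nhdsWithin_le_nhds ?_)
        filter_upwards [hball.mem_nhds hz] with y hy using (hf₀ y hy).symm
      | succ i ih =>
        intro z hz0 hz
        refine (meromorphicAt_solveTop (A := A) (c := c) (j := j) (ρ := ρ) (f := f) (S := S) (m := m)
          (e := e) fun s hs hne => ih _ (mul_ne_zero (zpow_ne_zero _ hρ0) hz0)
            (hsmall s hs hne z i hz)).congr ?_
        -- The solved equation holds only off the spirals, but these miss a punctured neighbourhood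
        -- of every point, and meromorphy depends on nothing more.
        filter_upwards [offSpirals_mem_nhdsNE hρ hZ hz0] with y hy using (hsolve y hy).symm
    exact main _ z hz (hk z)
  · have main : ∀ i : ℕ, ∀ z ∈ U, ‖z‖ < δ' * ‖ρ‖ ^ i → AnalyticAt ℂ f z := by
      intro i
      induction i with
      | zero =>
        intro z hzU hz
        rw [pow_zero, mul_one] at hz
        refine (han z hzU (hz.trans_le hδ'δ)).congr ?_
        filter_upwards [hball.mem_nhds hz] with y hy using (hf₀ y hy).symm
      | succ i ih =>
        intro z hzU hz
        refine (analyticAt_solveTop (A := A) (f := f) (hb z hzU _) fun s hs hne =>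
          ih _ (zpow_mul_mem_offSpirals hρ0 hzU _) (hsmall s hs hne z i hz)).congr ?_
        filter_upwards [hUo.mem_nhds hzU] with y hy using (hsolve y hy).symm
    exact main _ z hz (hk z)
  · have h1 : ρ ^ e * z ∈ U := zpow_mul_mem_offSpirals hρ0 hz e
    have h2 := shiftOp_eq_of_eq_solveTop hρ0 (hb _ h1 _) (hsolve _ h1)
    rwa [← mul_assoc, ← zpow_add₀ hρ0, neg_add_cancel, zpow_zero, one_mul] at h2

end ShiftOp

/-! ### Growth of solutions along the dilates of a compact set -/

/-- Induction resting on (l-k)² + 2lk = l² + k²: a step back by k with weight R^(2lk) turns the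
bound R^((l-k)²) into R^(l²) at the price of the constant R^(k²). The constant D absorbs all these
prices. -/
theorem growth_of_recursion {ι : Type*} {S : Finset ι} {k : ι → ℕ} {Cs : ι → ℝ} {Ca E B R D : ℝ}
    {u : ℤ → ℝ} (hCs : ∀ s ∈ S, 0 ≤ Cs s) (hCa : 0 ≤ Ca) (hE : 0 ≤ E) (hB : 1 ≤ B) (hR : 1 ≤ R)
    (hk : ∀ s ∈ S, 1 ≤ k s) (hD1 : 1 ≤ D) (hDE : E ≤ D)
    (hD : Ca * E + ∑ s ∈ S, Cs s * R ^ (2 * k s ^ 2) ≤ D)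
    (hu : ∀ l : ℤ, l ≤ 0 → u l ≤ B)
    (hrec : ∀ l : ℕ, 1 ≤ l →
      u l ≤ Ca * E ^ l + ∑ s ∈ S, Cs s * R ^ (2 * l * k s) * u ((l : ℤ) - k s)) (l : ℕ) :
    u l ≤ B * D ^ l * R ^ (l ^ 2) := by
  have hD0 : 0 < D := zero_lt_one.trans_le hD1
  have hB0 : 0 < B := zero_lt_one.trans_le hB
  have hR0 : 0 < R := zero_lt_one.trans_le hR
  induction l using Nat.strong_induction_on with
  | _ l ih =>
    rcases Nat.eq_zero_or_pos l with rfl | hl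
    · simpa using hu 0 le_rfl
    obtain ⟨n, rfl⟩ : ∃ n, l = n + 1 := ⟨l - 1, by omega⟩
    set W := B * D ^ n * R ^ ((n + 1) ^ 2) with hW
    have hWpos : 0 < W := by positivity
    have h1 : Ca * E ^ (n + 1) ≤ Ca * E * W := by
      have e1 : E ^ n ≤ D ^ n := pow_le_pow_left₀ hE hDE n
      have e2 : D ^ n ≤ W := by
        have : 1 ≤ R ^ ((n + 1) ^ 2) := one_le_pow₀ hR
        calc D ^ n ≤ B * D ^ n := le_mul_of_one_le_left (by positivity) hB
          _ ≤ _ := le_mul_of_one_le_right (by positivity) this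
      rw [pow_succ']
      calc Ca * (E * E ^ n) = Ca * E * E ^ n := by ring
        _ ≤ _ := mul_le_mul_of_nonneg_left (e1.trans e2) (by positivity)
    have h2 : ∀ s ∈ S, Cs s * R ^ (2 * (n + 1) * k s) * u (((n + 1 : ℕ) : ℤ) - k s) ≤
        Cs s * R ^ (2 * k s ^ 2) * W := by
      intro s hs
      rw [mul_assoc (Cs s), mul_assoc (Cs s)]
      refine mul_le_mul_of_nonneg_left ?_ (hCs s hs)
      have hks := hk s hs
      -- A step that stays at a nonnegative index uses the induction hypothesis; a step to a
      -- negative index uses the bound B, with 2(n+1)k ≤ 2k². The exponent 2k² in the hypothesis on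
      -- D suits both cases.
      rcases le_or_gt (k s) (n + 1) with h | h
      · obtain ⟨i, hi⟩ := Nat.exists_eq_add_of_le h
        have h3 := ih i (by omega)
        rw [hi, show (((k s + i : ℕ) : ℤ) - k s) = (i : ℤ) by push_cast; ring]
        calc R ^ (2 * (k s + i) * k s) * u i
            ≤ R ^ (2 * (k s + i) * k s) * (B * D ^ i * R ^ (i ^ 2)) := by gcongr
          _ = B * D ^ i * R ^ (k s ^ 2 + (n + 1) ^ 2) := by rw [hi]; ring
          _ ≤ B * D ^ n * R ^ (2 * k s ^ 2 + (n + 1) ^ 2) := by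
            have e1 : D ^ i ≤ D ^ n := pow_le_pow_right₀ hD1 (by omega)
            have e2 : R ^ (k s ^ 2 + (n + 1) ^ 2) ≤ R ^ (2 * k s ^ 2 + (n + 1) ^ 2) :=
              pow_le_pow_right₀ hR (by nlinarith)
            gcongr
          _ = R ^ (2 * k s ^ 2) * W := by rw [hW]; ring
      · have h3 := hu (((n + 1 : ℕ) : ℤ) - k s) (by omega)
        calc R ^ (2 * (n + 1) * k s) * u (((n + 1 : ℕ) : ℤ) - k s)
            ≤ R ^ (2 * (n + 1) * k s) * B := by gcongr
          _ ≤ R ^ (2 * k s ^ 2) * B := by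
            have e1 : R ^ (2 * (n + 1) * k s) ≤ R ^ (2 * k s ^ 2) :=
              pow_le_pow_right₀ hR (by rw [mul_assoc, sq]; gcongr)
            gcongr
          _ ≤ R ^ (2 * k s ^ 2) * W := by
            gcongr
            have e1 : 1 ≤ R ^ ((n + 1) ^ 2) := one_le_pow₀ hR
            have e2 : 1 ≤ D ^ n := one_le_pow₀ hD1
            calc B ≤ B * D ^ n := le_mul_of_one_le_right hB0.le e2
              _ ≤ _ := le_mul_of_one_le_right (by positivity) e1
    have h3 := hrec (n + 1) (by omega)
    calc u ((n + 1 : ℕ) : ℤ) ≤ Ca * E * W + ∑ s ∈ S, Cs s * R ^ (2 * k s ^ 2) * W :=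
          h3.trans (add_le_add h1 (Finset.sum_le_sum h2))
      _ = (Ca * E + ∑ s ∈ S, Cs s * R ^ (2 * k s ^ 2)) * W := by rw [add_mul, Finset.sum_mul]
      _ ≤ D * W := by gcongr
      _ = _ := by rw [hW]; ring

theorem pow_card_le_norm_prod_sub {a : ℝ} (ha : 0 ≤ a) {w : ℂ} (s : Multiset ℂ)
    (h : ∀ r ∈ s, a ≤ ‖w - r‖) : a ^ s.card ≤ ‖(s.map fun r => w - r).prod‖ := by
  induction s using Multiset.induction_on with
  | empty => simp
  | cons r s ih =>
    rw [Multiset.card_cons, Multiset.map_cons, Multiset.prod_cons, norm_mul, pow_succ']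
    exact mul_le_mul (h r (Multiset.mem_cons_self r s))
      (ih fun r' hr' => h r' (Multiset.mem_cons_of_mem hr')) (by positivity) (norm_nonneg _)

/-- Factor b over its roots and bound each factor below. For w at distance at least η|w| from the
roots, this makes |b(w)| comparable from below to |w|^deg b, for small as well as large w. -/
theorem leadingCoeff_mul_pow_le_norm_eval (b : Polynomial ℂ) {a : ℝ} (ha : 0 ≤ a) {w : ℂ}
    (h : ∀ r ∈ b.roots, a ≤ ‖w - r‖) : ‖b.leadingCoeff‖ * a ^ b.natDegree ≤ ‖b.eval w‖ := by
  have hs := IsAlgClosed.splits b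
  rw [hs.eval_eq_prod_roots, norm_mul, hs.natDegree_eq_card_roots]
  exact mul_le_mul_of_nonneg_left (pow_card_le_norm_prod_sub ha _ h) (norm_nonneg _)

/-- Bounds for the moduli of the points of a compact set of `offSpirals ρ Z`, and for their
distances to the spirals. -/
theorem exists_compact_bounds {ρ : ℂ} (hρ : 1 < ‖ρ‖) {Z : Set ℂ} (hZ : Z.Finite) {C : Set ℂ}
    (hC : IsCompact C) (hCU : C ⊆ offSpirals ρ Z) : ∃ a b η : ℝ, 0 < a ∧ a ≤ b ∧ 0 < η ∧
      (∀ z ∈ C, a ≤ ‖z‖ ∧ ‖z‖ ≤ b) ∧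
      ∀ z ∈ C, ∀ k : ℤ, ∀ r ∈ Z, η * ‖ρ ^ k * z‖ ≤ ‖ρ ^ k * z - r‖ := by
  have hρ0 : ρ ≠ 0 := norm_pos_iff.1 (zero_lt_one.trans hρ)
  rcases C.eq_empty_or_nonempty with rfl | hne
  · exact ⟨1, 1, 1, one_pos, le_rfl, one_pos, by simp, by simp⟩
  obtain ⟨x, hx, hxmin⟩ := hC.exists_isMinOn hne continuous_norm.continuousOn
  obtain ⟨y, hy, hymax⟩ := hC.exists_isMaxOn hne continuous_norm.continuousOn
  have hx0 : 0 < ‖x‖ := norm_pos_iff.2 (hCU hx).1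
  have hyx : ‖x‖ ≤ ‖y‖ := hxmin hy
  have hy0 : 0 < ‖y‖ := hx0.trans_le hyx
  obtain ⟨δ, hδ, hsub⟩ := hC.exists_thickening_subset_open (isOpen_offSpirals hρ hZ) hCU
  refine ⟨‖x‖, ‖y‖, δ / ‖y‖, hx0, hyx, by positivity, fun z hz => ⟨hxmin hz, hymax hz⟩,
    fun z hz k r hr => ?_⟩
  have h1 : δ ≤ ‖z - ρ ^ (-k) * r‖ := by
    by_contra hcon
    have : ρ ^ (-k) * r ∈ Metric.thickening δ C :=
      Metric.mem_thickening_iff.2 ⟨z, hz, by rw [dist_comm, dist_eq_norm]; exact not_le.1 hcon⟩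
    exact (hsub this).2 r hr (-k) rfl
  have h2 : ρ ^ k * z - r = ρ ^ k * (z - ρ ^ (-k) * r) := by
    rw [mul_sub, ← mul_assoc, ← zpow_add₀ hρ0, add_neg_cancel, zpow_zero, one_mul]
  rw [h2, norm_mul, norm_mul]
  have h3 : δ / ‖y‖ * ‖z‖ ≤ δ := by
    rw [div_mul_eq_mul_div, div_le_iff₀ hy0]
    exact mul_le_mul_of_nonneg_left (hymax hz) hδ.le
  calc δ / ‖y‖ * (‖ρ ^ k‖ * ‖z‖) = ‖ρ ^ k‖ * (δ / ‖y‖ * ‖z‖) := by ring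
    _ ≤ _ := mul_le_mul_of_nonneg_left (h3.trans h1) (norm_nonneg _)

section Growth

variable {ι : Type*} {ρ : ℂ} {S : Finset ι} {c : ι → ℂ} {j : ι → ℕ} {m : ι → ℤ} {e : ℤ}
  {A : Polynomial ℂ} {f : ℂ → ℂ} {Z : Set ℂ}

/-- On the dilates of C the top coefficient is bounded below by a multiple of |w|^deg, so the term
of index s in the solved equation has size about |ρ|^(l(j_s - deg)). The hypothesis `hN` says that
this is at most R^(2lk) with k = e - m_s the number of steps back, which is the form required by
`growth_of_recursion`. -/
theorem exists_growth_bound (hρ : 1 < ‖ρ‖) (hZ : Z.Finite) (hm : ∀ s ∈ S, m s ≤ e)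
    (hb0 : topPoly S c j m e ≠ 0)
    (hroots : ∀ w, (topPoly S c j m e).IsRoot w → w ∈ Z) {N : ℕ} {R : ℝ} (hR : 1 < R)
    (hρR : ‖ρ‖ = R ^ (2 * N))
    (hN : ∀ s ∈ S, (N : ℤ) * (j s - (topPoly S c j m e).natDegree) ≤ e - m s)
    (heq : ∀ z ∈ offSpirals ρ Z, shiftOp ρ S c j m f z = A.eval z) {C : Set ℂ} (hC : IsCompact C)
    (hCU : C ⊆ offSpirals ρ Z) {B : ℝ} (hB1 : 1 ≤ B)
    (hB : ∀ l : ℤ, l ≤ 0 → ∀ z ∈ C, ‖f (ρ ^ l * z)‖ ≤ B) :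
    ∃ D : ℝ, 1 ≤ D ∧ ∀ l : ℕ, ∀ z ∈ C, ‖f (ρ ^ (l : ℤ) * z)‖ ≤ B * D ^ l * R ^ (l ^ 2) := by
  have hρ0 : ρ ≠ 0 := norm_pos_iff.1 (zero_lt_one.trans hρ)
  have hρn : 0 < ‖ρ‖ := norm_pos_iff.2 hρ0
  have hR0 : 0 < R := zero_lt_one.trans hR
  obtain ⟨a, b, η, ha, hab, hη, hCab, hCη⟩ := exists_compact_bounds hρ hZ hC hCU
  set P := topPoly S c j m e with hP
  -- η bounds the distance of a dilate of C to the roots relative to its modulus, so β * ‖w‖ ^ deg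
  -- bounds the top coefficient below.
  set β := ‖P.leadingCoeff‖ * η ^ P.natDegree with hβ
  have hβ0 : 0 < β := by
    have := norm_pos_iff.2 (Polynomial.leadingCoeff_ne_zero.2 hb0)
    positivity
  have hlow : ∀ z ∈ C, ∀ k : ℤ, β * ‖ρ ^ k * z‖ ^ P.natDegree ≤ ‖P.eval (ρ ^ k * z)‖ := by
    intro z hz k
    have := leadingCoeff_mul_pow_le_norm_eval P (a := η * ‖ρ ^ k * z‖) (w := ρ ^ k * z)
      (by positivity) fun r hr => hCη z hz k r (hroots r (Polynomial.isRoot_of_mem_roots hr))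
    rwa [mul_pow, ← mul_assoc] at this
  -- the ratio of a monomial and the top coefficient
  set κ : ℕ → ℝ := fun i => (‖ρ‖ ^ (-e) * a) ^ ((i : ℤ) - P.natDegree) +
    (‖ρ‖ ^ (-e) * b) ^ ((i : ℤ) - P.natDegree) with hκ
  have hb : 0 < b := ha.trans_le hab
  have hκ0 : ∀ i, 0 ≤ κ i := fun i => by positivity
  have hratio : ∀ z ∈ C, ∀ (l i : ℕ), ‖ρ ^ (-e) * (ρ ^ (l : ℤ) * z)‖ ^ i /
      ‖P.eval (ρ ^ (-e) * (ρ ^ (l : ℤ) * z))‖ ≤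
      β⁻¹ * κ i * (R ^ (2 * N * l)) ^ ((i : ℤ) - P.natDegree) := by
    intro z hz l i
    have hz0 : z ≠ 0 := (hCU hz).1
    have e1 : ρ ^ (-e) * (ρ ^ (l : ℤ) * z) = ρ ^ (-e + l) * z := by
      rw [← mul_assoc, ← zpow_add₀ hρ0]
    have h1 := hlow z hz (-e + l)
    rw [← e1] at h1
    have hw : 0 < ‖ρ ^ (-e) * (ρ ^ (l : ℤ) * z)‖ := norm_pos_iff.2
      (mul_ne_zero (zpow_ne_zero _ hρ0) (mul_ne_zero (zpow_ne_zero _ hρ0) hz0))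
    set w := ρ ^ (-e) * (ρ ^ (l : ℤ) * z) with hw_def
    have hwn : ‖w‖ = R ^ (2 * N * l) * (‖ρ‖ ^ (-e) * ‖z‖) := by
      rw [hw_def, norm_mul, norm_mul, norm_zpow, norm_zpow, zpow_natCast, pow_mul R, ← hρR]; ring
    calc ‖w‖ ^ i / ‖P.eval w‖ ≤ ‖w‖ ^ i / (β * ‖w‖ ^ P.natDegree) := by gcongr
      _ = β⁻¹ * ‖w‖ ^ ((i : ℤ) - P.natDegree) := by
        rw [zpow_sub₀ hw.ne', zpow_natCast, zpow_natCast]; field_simp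
      _ = β⁻¹ * ((R ^ (2 * N * l)) ^ ((i : ℤ) - P.natDegree) *
          (‖ρ‖ ^ (-e) * ‖z‖) ^ ((i : ℤ) - P.natDegree)) := by rw [hwn, mul_zpow]
      _ ≤ β⁻¹ * ((R ^ (2 * N * l)) ^ ((i : ℤ) - P.natDegree) * κ i) := by
        have := zpow_le_zpow_add_zpow (a := ‖ρ‖ ^ (-e) * a) (b := ‖ρ‖ ^ (-e) * b)
          (x := ‖ρ‖ ^ (-e) * ‖z‖) (by positivity)
          (mul_le_mul_of_nonneg_left (hCab z hz).1 (by positivity))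
          (mul_le_mul_of_nonneg_left (hCab z hz).2 (by positivity)) ((i : ℤ) - P.natDegree)
        gcongr
      _ = _ := by ring
  set S' := S.filter fun s => ¬ m s = e with hS'
  set k : ι → ℕ := fun s => (e - m s).toNat with hk
  have hks : ∀ s ∈ S', 1 ≤ k s ∧ (k s : ℤ) = e - m s := by
    intro s hs
    obtain ⟨h1, h2⟩ := Finset.mem_filter.1 hs
    have := hm s h1
    simp only [hk]
    omega
  set Cs : ι → ℝ := fun s => ‖c s‖ * (β⁻¹ * κ (j s)) with hCs
  set E : ℝ := R ^ (2 * N * A.natDegree) with hE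
  set Ca : ℝ := ∑ i ∈ Finset.range (A.natDegree + 1), ‖A.coeff i‖ * (β⁻¹ * κ i) with hCa
  have hCs0 : ∀ s, 0 ≤ Cs s := fun s => by
    have := hκ0 (j s); positivity
  have hCa0 : 0 ≤ Ca := Finset.sum_nonneg fun i _ => by
    have := hκ0 i; positivity
  set D := 1 + E + (Ca * E + ∑ s ∈ S', Cs s * R ^ (2 * k s ^ 2)) with hD
  have hE0 : 0 ≤ E := by positivity
  have hsum0 : 0 ≤ ∑ s ∈ S', Cs s * R ^ (2 * k s ^ 2) := Finset.sum_nonneg fun s _ => by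
    have := hCs0 s; positivity
  have hCaE : 0 ≤ Ca * E := by positivity
  refine ⟨D, by linarith, fun l z hz => ?_⟩
  refine growth_of_recursion (u := fun l => ‖f (ρ ^ l * z)‖) (S := S') (k := k) (Cs := Cs)
    (Ca := Ca) (E := E) (fun s _ => hCs0 s) hCa0 hE0 hB1 hR.le (fun s hs => (hks s hs).1)
    (by linarith) (by linarith) (by linarith) (fun l hl => hB l hl z hz) (fun l hl => ?_) l
  have hzU : ρ ^ (l : ℤ) * z ∈ offSpirals ρ Z := zpow_mul_mem_offSpirals hρ0 (hCU hz) _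
  have hPne : P.eval (ρ ^ (-e) * (ρ ^ (l : ℤ) * z)) ≠ 0 := topPoly_eval_ne_zero hρ0 hroots hzU _
  have hsol := eq_solveTop (A := A) hρ0 hPne (heq _ (zpow_mul_mem_offSpirals hρ0 hzU _))
  have hRl : 1 ≤ R ^ (2 * N * l) := one_le_pow₀ hR.le
  change ‖f (ρ ^ (l : ℤ) * z)‖ ≤ _
  rw [hsol, solveTop, norm_div]
  set w := ρ ^ (-e) * (ρ ^ (l : ℤ) * z) with hw
  have hA : ‖A.eval w‖ / ‖P.eval w‖ ≤ Ca * E ^ l := by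
    rw [Polynomial.eval_eq_sum_range, hCa, Finset.sum_mul]
    refine (div_le_div_of_nonneg_right (norm_sum_le _ _) (norm_nonneg _)).trans ?_
    rw [Finset.sum_div]
    refine Finset.sum_le_sum fun i hi => ?_
    rw [norm_mul, norm_pow, mul_div_assoc, mul_assoc]
    refine mul_le_mul_of_nonneg_left ((hratio z hz l i).trans ?_) (norm_nonneg _)
    refine mul_le_mul_of_nonneg_left ?_ (by have := hκ0 i; positivity)
    have hi : i ≤ A.natDegree := by have := Finset.mem_range.1 hi; omega
    calc (R ^ (2 * N * l)) ^ ((i : ℤ) - P.natDegree) ≤ (R ^ (2 * N * l)) ^ (A.natDegree : ℤ) :=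
          zpow_le_zpow_right₀ hRl (by omega)
      _ = E ^ l := by rw [zpow_natCast, hE, ← pow_mul, ← pow_mul]; congr 1; ring
  have hS : ‖∑ s ∈ S', c s * w ^ j s * f (ρ ^ (m s - e) * (ρ ^ (l : ℤ) * z))‖ / ‖P.eval w‖ ≤
      ∑ s ∈ S', Cs s * R ^ (2 * l * k s) * ‖f (ρ ^ ((l : ℤ) - k s) * z)‖ := by
    refine (div_le_div_of_nonneg_right (norm_sum_le _ _) (norm_nonneg _)).trans ?_
    rw [Finset.sum_div]
    refine Finset.sum_le_sum fun s hs => ?_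
    have e1 : ρ ^ (m s - e) * (ρ ^ (l : ℤ) * z) = ρ ^ ((l : ℤ) - k s) * z := by
      rw [← mul_assoc, ← zpow_add₀ hρ0, (hks s hs).2]; congr 2; ring
    rw [e1, norm_mul, norm_mul, norm_pow, mul_div_right_comm]
    refine mul_le_mul_of_nonneg_right ?_ (norm_nonneg _)
    rw [mul_div_assoc, hCs, mul_assoc]
    refine mul_le_mul_of_nonneg_left ((hratio z hz l (j s)).trans ?_) (norm_nonneg _)
    refine mul_le_mul_of_nonneg_left ?_ (by have := hκ0 (j s); positivity)
    rw [← zpow_natCast R, ← zpow_mul, ← zpow_natCast R]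
    refine zpow_le_zpow_right₀ hR.le ?_
    push_cast
    rw [(hks s hs).2]
    have := hN s (Finset.mem_filter.1 hs).1
    have h2 : (0 : ℤ) ≤ 2 * l := by positivity
    calc (2 * (N : ℤ) * l) * ((j s : ℤ) - P.natDegree) =
        2 * l * (N * ((j s : ℤ) - P.natDegree)) := by ring
      _ ≤ _ := mul_le_mul_of_nonneg_left this h2
  calc ‖A.eval w - ∑ s ∈ S', c s * w ^ j s * f (ρ ^ (m s - e) * (ρ ^ (l : ℤ) * z))‖ / ‖P.eval w‖
      ≤ (‖A.eval w‖ + ‖∑ s ∈ S', c s * w ^ j s * f (ρ ^ (m s - e) * (ρ ^ (l : ℤ) * z))‖) /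
        ‖P.eval w‖ := by gcongr; exact norm_sub_le _ _
    _ ≤ _ := by rw [add_div]; exact add_le_add hA hS

end Growth

/-! ### The discrete `q`-Laplace transform -/

/-- A two-sided sequence that is bounded at `-∞` and of Gaussian growth at `+∞`. -/
structure QuadGrowth (φ : ℤ → ℂ) (B D Q : ℝ) : Prop where
  nonpos : ∀ l : ℤ, l ≤ 0 → ‖φ l‖ ≤ B
  nonneg : ∀ l : ℕ, ‖φ l‖ ≤ B * D ^ l * Q ^ (l ^ 2)

/-- The Laurent series `∑_k φ_k p ^ (-k(k+1)/2) x ^ (-k-1)`. -/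
def laplaceNumer (p : ℂ) (φ : ℤ → ℂ) (x : ℂ) : ℂ :=
  ∑' l : ℤ, φ (-1 - l) * p ^ (-triang l) * x ^ l

theorem summable_inv_pow_natAbs {Q : ℝ} (hQ : 1 < Q) : Summable fun l : ℤ => Q⁻¹ ^ l.natAbs := by
  have h : Summable fun n : ℕ => Q⁻¹ ^ n :=
    summable_geometric_of_lt_one (by positivity) (inv_lt_one_of_one_lt₀ hQ)
  refine Summable.of_nat_of_neg ?_ ?_
  · simpa using h
  · simpa using h

/-- For l ≥ 0 the sequence is bounded and the Theta term remains. For l = -1 - k its growth Q^(k²)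
meets the weight (Q²)^(-k(k+1)/2) = Q^(-k²) Q^(-k), and a geometric term remains as soon as x ≥ D.
This balance fixes the base of the Theta function, |p| = Q². -/
theorem QuadGrowth.norm_term_le {φ : ℤ → ℂ} {B D Q x : ℝ} (h : QuadGrowth φ B D Q) (hB : 0 ≤ B)
    (hD : 1 ≤ D) (hQ : 1 < Q) (hx : D ≤ x) (l : ℤ) :
    ‖φ (-1 - l)‖ * (Q ^ 2) ^ (-triang l) * x ^ l ≤
      B * ((Q ^ 2) ^ (-triang l) * x ^ l + Q * Q⁻¹ ^ l.natAbs) := by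
  have hQ0 : 0 < Q := zero_lt_one.trans hQ
  have hx0 : 0 < x := zero_lt_one.trans_le (hD.trans hx)
  rcases le_or_gt 0 l with hl | hl
  · have h1 := h.nonpos (-1 - l) (by omega)
    calc ‖φ (-1 - l)‖ * (Q ^ 2) ^ (-triang l) * x ^ l ≤ B * (Q ^ 2) ^ (-triang l) * x ^ l := by
          gcongr
      _ = B * ((Q ^ 2) ^ (-triang l) * x ^ l) := by ring
      _ ≤ _ := by gcongr; simp only [le_add_iff_nonneg_right]; positivity
  · obtain ⟨k, hk⟩ : ∃ k : ℕ, l = -1 - k := ⟨(-1 - l).toNat, by omega⟩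
    have h1 := h.nonneg k
    have e1 : -1 - l = k := by omega
    have e2 : l.natAbs = k + 1 := by omega
    have e3 : (Q ^ 2) ^ (-triang l) = (Q ^ (k ^ 2))⁻¹ * Q⁻¹ ^ k := by
      rw [hk, triang_neg_one_sub, zpow_neg, ← zpow_natCast Q 2, ← zpow_mul,
        show ((2 : ℕ) : ℤ) * triang k = ((k ^ 2 + k : ℕ) : ℤ) by
          have := triang_mul_two k
          push_cast; linarith, zpow_natCast, pow_add, mul_inv, inv_pow]
    have e4 : x ^ l = x⁻¹ * x⁻¹ ^ k := by
      rw [hk, zpow_sub₀ hx0.ne', zpow_neg_one, zpow_natCast, inv_pow]; rfl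
    rw [e1, e2]
    calc ‖φ k‖ * (Q ^ 2) ^ (-triang l) * x ^ l
        ≤ (B * D ^ k * Q ^ (k ^ 2)) * (Q ^ 2) ^ (-triang l) * x ^ l := by gcongr
      _ = B * (D * x⁻¹) ^ k * x⁻¹ * Q⁻¹ ^ k := by
        rw [e3, e4, mul_pow]
        have : Q ^ (k ^ 2) ≠ 0 := by positivity
        field_simp
      _ ≤ B * 1 ^ k * 1 * Q⁻¹ ^ k := by
        have h2 : D * x⁻¹ ≤ 1 := by rw [← div_eq_mul_inv]; exact (div_le_one hx0).2 hx
        have h3 : x⁻¹ ≤ 1 := inv_le_one_of_one_le₀ (hD.trans hx)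
        gcongr
      _ = B * (Q * Q⁻¹ ^ (k + 1)) := by rw [pow_succ]; field_simp; simp
      _ ≤ _ := by gcongr; simp only [le_add_iff_nonneg_left]; positivity

section Numer

variable {p : ℂ} {φ : ℤ → ℂ} {B D Q : ℝ}

theorem QuadGrowth.summable (h : QuadGrowth φ B D Q) (hB : 0 ≤ B) (hD : 1 ≤ D) (hQ : 1 < Q)
    (hp : ‖p‖ = Q ^ 2) {x : ℝ} (hx : D ≤ x) :
    Summable fun l : ℤ => ‖φ (-1 - l) * p ^ (-triang l)‖ * x ^ l := by
  have hx0 : 0 < x := zero_lt_one.trans_le (hD.trans hx)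
  refine Summable.of_nonneg_of_le (fun l => by positivity) (fun l => ?_)
    (((summable_gaussian (P := Q ^ 2) (one_lt_pow₀ hQ two_ne_zero) hx0).add
      ((summable_inv_pow_natAbs hQ).mul_left Q)).mul_left B)
  rw [norm_mul, norm_zpow, hp]
  exact h.norm_term_le hB hD hQ hx l

theorem QuadGrowth.hasSum_laplaceNumer (h : QuadGrowth φ B D Q) (hB : 0 ≤ B) (hD : 1 ≤ D)
    (hQ : 1 < Q) (hp : ‖p‖ = Q ^ 2) {x : ℂ} (hx : D ≤ ‖x‖) :
    HasSum (fun l : ℤ => φ (-1 - l) * p ^ (-triang l) * x ^ l) (laplaceNumer p φ x) :=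
  (summable_laurent (h.summable hB hD hQ hp hx)).hasSum

theorem QuadGrowth.differentiableAt_laplaceNumer (h : QuadGrowth φ B D Q) (hB : 0 ≤ B) (hD : 1 ≤ D)
    (hQ : 1 < Q) (hp : ‖p‖ = Q ^ 2) {x : ℂ} (hx : D < ‖x‖) :
    DifferentiableAt ℂ (laplaceNumer p φ) x :=
  differentiableAt_laurent (g := fun l => φ (-1 - l) * p ^ (-triang l)) (by linarith)
    (fun _ hy => h.summable hB hD hQ hp hy.le) hx

theorem QuadGrowth.norm_laplaceNumer_le (h : QuadGrowth φ B D Q) (hB : 0 ≤ B) (hD : 1 ≤ D)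
    (hQ : 1 < Q) (hp : ‖p‖ = Q ^ 2) {x : ℂ} (hx : D ≤ ‖x‖) :
    ‖laplaceNumer p φ x‖ ≤
      B * (1 + Q * ∑' l : ℤ, Q⁻¹ ^ l.natAbs) * realTheta ‖p‖ ‖x‖ := by
  have hx0 : 0 < ‖x‖ := zero_lt_one.trans_le (hD.trans hx)
  have hQ2 : 1 < Q ^ 2 := one_lt_pow₀ hQ two_ne_zero
  have hQ0 : 0 < Q := zero_lt_one.trans hQ
  have h1 : ‖laplaceNumer p φ x‖ ≤
      B * (realTheta ‖p‖ ‖x‖ + Q * ∑' l : ℤ, Q⁻¹ ^ l.natAbs) := by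
    refine tsum_of_norm_bounded (f := fun l : ℤ => φ (-1 - l) * p ^ (-triang l) * x ^ l)
      (((hasSum_realTheta (hp ▸ hQ2) hx0).add
        ((summable_inv_pow_natAbs hQ).hasSum.mul_left Q)).mul_left B) fun l => ?_
    rw [norm_mul, norm_mul, norm_zpow, norm_zpow, hp]
    exact h.norm_term_le hB hD hQ hx l
  have h2 := one_le_realTheta (hp ▸ hQ2) hx0
  have h3 : 0 ≤ ∑' l : ℤ, Q⁻¹ ^ l.natAbs := tsum_nonneg fun _ => by positivity
  refine h1.trans ?_
  rw [mul_assoc]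
  refine mul_le_mul_of_nonneg_left ?_ hB
  rw [add_mul, one_mul]
  exact add_le_add le_rfl (le_mul_of_one_le_right (by positivity) h2)

/-- By quasi-periodicity Θ(p^(k+1) x) = p^(k(k+1)/2) x^(k+1) Θ(x). The common factor Θ(x) comes out,
and the rest is the Laurent series of the numerator with k = -1 - l. -/
theorem QuadGrowth.hasSum_div_qTheta (h : QuadGrowth φ B D Q) (hB : 0 ≤ B) (hD : 1 ≤ D)
    (hQ : 1 < Q) (hp : ‖p‖ = Q ^ 2) {x : ℂ} (hx : D ≤ ‖x‖) (h0 : qTheta p x ≠ 0) :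
    HasSum (fun k : ℤ => φ k / qTheta p (p ^ (k + 1) * x)) (laplaceNumer p φ x / qTheta p x) := by
  have hp1 : 1 < ‖p‖ := hp ▸ one_lt_pow₀ hQ two_ne_zero
  have hp0 : p ≠ 0 := norm_pos_iff.1 (zero_lt_one.trans hp1)
  have hx0 : x ≠ 0 := norm_pos_iff.1 (zero_lt_one.trans_le (hD.trans hx))
  have h1 := (h.hasSum_laplaceNumer hB hD hQ hp hx).div_const (qTheta p x)
  rw [← (Equiv.subLeft (-1 : ℤ)).hasSum_iff] at h1
  refine h1.congr_fun fun k => ?_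
  simp only [Function.comp, Equiv.subLeft_apply]
  rw [qTheta_zpow_mul hp1 hx0, add_sub_cancel_right, triang_neg_one_sub, zpow_neg,
    show (-1 - k) = -(k + 1) by ring, zpow_neg, show -1 - -(k + 1) = k by ring]
  have := zpow_ne_zero (triang k) hp0
  have := zpow_ne_zero (k + 1) hx0
  field_simp

end Numer

/-- In ℂ summability is absolute summability, so finitely many summable residue classes can be
reassembled. -/
theorem hasSum_int_of_residues {n : ℕ} (hn : n ≠ 0) {g : ℤ → ℂ} {a : ℕ → ℂ}
    (h : ∀ r < n, HasSum (fun k : ℤ => g (r + n * k)) (a r)) :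
    HasSum g (∑ r ∈ Finset.range n, a r) := by
  have : NeZero n := ⟨hn⟩
  let E : Fin n × ℤ ≃ ℤ := (Equiv.prodComm _ _).trans (Int.divModEquiv n).symm
  have hE : ∀ x : Fin n × ℤ, E x = (x.1 : ℕ) + n * x.2 := by
    intro x
    simp [E, Int.divModEquiv]
    ring
  have h' : ∀ r : Fin n, HasSum (fun k : ℤ => g (E (r, k))) (a r) := fun r => by
    simp only [hE]
    exact h r r.2
  have hs : Summable fun x : Fin n × ℤ => g (E x) := by
    refine Summable.of_norm ((summable_prod_of_nonneg fun _ => norm_nonneg _).2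
      ⟨fun r => (h' r).summable.norm, Summable.of_finite⟩)
  have h2 := hs.hasSum.prod_fiberwise h'
  have h3 := (hasSum_fintype fun r : Fin n => a r).unique h2
  rw [← E.hasSum_iff, ← Fin.sum_univ_eq_sum_range, h3]
  exact hs.hasSum

/-- The discrete Laplace transform along the spiral `ρ ^ (d ℤ) lam`, where `p = ρ ^ (d n)` is the
base of the Theta function. -/
def spiralLaplace (ρ : ℂ) (d n : ℕ) (lam : ℂ) (f : ℂ → ℂ) (z : ℂ) : ℂ :=
  1 / (n : ℂ) * ∑ r ∈ Finset.range n,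
    laplaceNumer (ρ ^ (d * n)) (fun k : ℤ => f (ρ ^ ((d : ℤ) * (r + n * k)) * lam))
      (ρ ^ (d * r) * lam / z) / qTheta (ρ ^ (d * n)) (ρ ^ (d * r) * lam / z)

/-! ### Convergence of the discrete Laplace transform. -/

section Laplace

variable {ρ : ℂ} {d n : ℕ} {lam : ℂ} {f : ℂ → ℂ} {B D R : ℝ}

/-- For 0 ≤ r < n and k ≥ 0 the index d(r + nk) is at most dn(k+1); expanding (dn(k+1))² gives the
new constants. The new quadratic base R^((dn)²) has square |ρ^(dn)| when |ρ| = R^(2dn), so it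
matches the Theta base. -/
theorem QuadGrowth.residue {φ : ℤ → ℂ} (h : QuadGrowth φ B D R) (hB : 1 ≤ B) (hD : 1 ≤ D)
    (hR : 1 ≤ R) {r : ℕ} (hr : r < n) :
    QuadGrowth (fun k => φ ((d : ℤ) * (r + n * k))) (B * D ^ (d * n) * R ^ ((d * n) ^ 2))
      (D ^ (d * n) * R ^ (2 * (d * n) ^ 2)) (R ^ ((d * n) ^ 2)) := by
  have hD0 : 0 < D := zero_lt_one.trans_le hD
  have hB0 : 0 < B := zero_lt_one.trans_le hB
  have hR0 : 0 < R := zero_lt_one.trans_le hR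
  have hnn : ∀ k : ℕ, ‖φ ((d : ℤ) * (r + n * k))‖ ≤ B * D ^ (d * n) * R ^ ((d * n) ^ 2) *
      (D ^ (d * n) * R ^ (2 * (d * n) ^ 2)) ^ k * (R ^ ((d * n) ^ 2)) ^ (k ^ 2) := by
    intro k
    have h1 := h.nonneg (d * (r + n * k))
    have h2 : d * (r + n * k) ≤ d * n * (k + 1) := by
      rw [mul_assoc]; gcongr; rw [mul_add, mul_one]; omega
    push_cast at h1
    refine h1.trans ?_
    calc B * D ^ (d * (r + n * k)) * R ^ ((d * (r + n * k)) ^ 2)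
        ≤ B * D ^ (d * n * (k + 1)) * R ^ ((d * n * (k + 1)) ^ 2) := by gcongr
      _ = _ := by ring
  refine ⟨fun k hk => ?_, hnn⟩
  have h0 : B ≤ B * D ^ (d * n) * R ^ ((d * n) ^ 2) := by
    have e1 : 1 ≤ D ^ (d * n) := one_le_pow₀ hD
    have e2 : 1 ≤ R ^ ((d * n) ^ 2) := one_le_pow₀ hR
    calc B ≤ B * D ^ (d * n) := le_mul_of_one_le_right hB0.le e1
      _ ≤ _ := le_mul_of_one_le_right (by positivity) e2
  rcases eq_or_lt_of_le hk with rfl | hk'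
  · simpa using hnn 0
  · refine (h.nonpos _ ?_).trans h0
    have : (r : ℤ) + n * k ≤ 0 := by
      have : (n : ℤ) * k ≤ n * (-1) := by gcongr; omega
      omega
    exact mul_nonpos_of_nonneg_of_nonpos (by positivity) this

theorem norm_pow_eq_sq (hρR : ‖ρ‖ = R ^ (2 * (d * n))) :
    ‖ρ ^ (d * n)‖ = (R ^ ((d * n) ^ 2)) ^ 2 := by
  rw [norm_pow, hρR, ← pow_mul, ← pow_mul]; congr 1; ring

theorem one_lt_pow_sq (hd : d ≠ 0) (hn : n ≠ 0) (hR : 1 < R) : 1 < R ^ ((d * n) ^ 2) :=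
  one_lt_pow₀ hR (pow_ne_zero 2 (mul_ne_zero hd hn))

theorem one_le_pow_mul_pow (hD : 1 ≤ D) (hR : 1 < R) :
    1 ≤ D ^ (d * n) * R ^ (2 * (d * n) ^ 2) :=
  one_le_mul_of_one_le_of_one_le (one_le_pow₀ hD) (one_le_pow₀ hR.le)

theorem le_norm_spiral_div (hρ : 1 < ‖ρ‖) {T : ℝ} {z : ℂ} (hz : z ≠ 0)
    (hzs : ‖z‖ * T < ‖lam‖) (i : ℕ) : T < ‖ρ ^ i * lam / z‖ := by
  rw [norm_div, norm_mul, norm_pow, lt_div_iff₀ (norm_pos_iff.2 hz), mul_comm]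
  exact hzs.trans_le (le_mul_of_one_le_left (norm_nonneg _) (one_le_pow₀ hρ.le))

theorem qTheta_spiral_div_ne_zero (hρ : 1 < ‖ρ‖) (hd : d ≠ 0) (hn : n ≠ 0) (hlam : lam ≠ 0)
    {z : ℂ} (hz : z ≠ 0) (hzl : ∀ l : ℤ, z ≠ -(ρ ^ ((d : ℤ) * l) * lam)) (r : ℤ) :
    qTheta (ρ ^ (d * n)) (ρ ^ ((d : ℤ) * r) * lam / z) ≠ 0 := by
  have hρ0 : ρ ≠ 0 := norm_pos_iff.1 (zero_lt_one.trans hρ)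
  have hp1 : 1 < ‖ρ ^ (d * n)‖ := by
    rw [norm_pow]; exact one_lt_pow₀ hρ (mul_ne_zero hd hn)
  have hx0 : ρ ^ ((d : ℤ) * r) * lam / z ≠ 0 :=
    div_ne_zero (mul_ne_zero (zpow_ne_zero _ hρ0) hlam) hz
  refine qTheta_ne_zero hp1 hx0 fun k hk => hzl (r - n * k) ?_
  rw [div_eq_iff hz] at hk
  have e1 : ρ ^ ((d : ℤ) * (r - n * k)) = ρ ^ ((d : ℤ) * r) * ((ρ ^ (d * n)) ^ k)⁻¹ := by
    rw [← zpow_natCast ρ (d * n), ← zpow_mul, ← zpow_neg, ← zpow_add₀ hρ0]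
    congr 1; push_cast; ring
  have := zpow_ne_zero k (pow_ne_zero (d * n) hρ0)
  rw [e1, mul_right_comm, hk]
  field_simp

/-- Off the poles the Laplace transform is given by its defining series. -/
theorem hasSum_spiralLaplace (hρ : 1 < ‖ρ‖) (hd : d ≠ 0) (hn : n ≠ 0) (hR : 1 < R)
    (hρR : ‖ρ‖ = R ^ (2 * (d * n))) (hB : 1 ≤ B) (hD : 1 ≤ D)
    (hf : QuadGrowth (fun l => f (ρ ^ l * lam)) B D R) {z : ℂ} (hz : z ≠ 0)
    (hzs : ‖z‖ * (D ^ (d * n) * R ^ (2 * (d * n) ^ 2)) < ‖lam‖)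
    (hzl : ∀ l : ℤ, z ≠ -(ρ ^ ((d : ℤ) * l) * lam)) :
    HasSum (fun l : ℤ => 1 / (n : ℂ) * (f (ρ ^ ((d : ℤ) * l) * lam) /
      qTheta (ρ ^ (d * n)) (ρ ^ (d * n) * (ρ ^ ((d : ℤ) * l) * lam / z))))
      (spiralLaplace ρ d n lam f z) := by
  have hρ0 : ρ ≠ 0 := norm_pos_iff.1 (zero_lt_one.trans hρ)
  have hR0 : 0 < R := zero_lt_one.trans hR
  have hB1 : 0 ≤ B * D ^ (d * n) * R ^ ((d * n) ^ 2) := by positivity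
  have hlam : lam ≠ 0 := norm_pos_iff.1 (lt_of_le_of_lt (by positivity) hzs)
  refine (hasSum_int_of_residues hn fun r hr => ?_).mul_left _
  have hx := (le_norm_spiral_div hρ hz hzs (d * r)).le
  have hne : qTheta (ρ ^ (d * n)) (ρ ^ (d * r) * lam / z) ≠ 0 :=
    mod_cast qTheta_spiral_div_ne_zero hρ hd hn hlam hz hzl r
  have h1 := (hf.residue (d := d) hB hD hR.le hr).hasSum_div_qTheta hB1
    (one_le_pow_mul_pow hD hR) (one_lt_pow_sq hd hn hR) (norm_pow_eq_sq hρR) hx hne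
  refine h1.congr_fun fun k => ?_
  congr 2
  rw [← zpow_natCast ρ (d * n), ← zpow_mul, ← zpow_natCast ρ (d * r), mul_div_assoc, mul_div_assoc,
    ← mul_assoc, ← mul_assoc, ← zpow_add₀ hρ0, ← zpow_add₀ hρ0]
  congr 2; push_cast; ring

end Laplace

section Laplace

variable {ρ : ℂ} {d n : ℕ} {lam : ℂ} {f : ℂ → ℂ} {B D R : ℝ}

theorem analyticAt_laplaceNumer_spiral (hρ : 1 < ‖ρ‖) (hd : d ≠ 0) (hn : n ≠ 0) (hR : 1 < R)
    (hρR : ‖ρ‖ = R ^ (2 * (d * n))) (hB : 1 ≤ B) (hD : 1 ≤ D)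
    (hf : QuadGrowth (fun l => f (ρ ^ l * lam)) B D R) {z : ℂ} (hz : z ≠ 0)
    (hzs : ‖z‖ * (D ^ (d * n) * R ^ (2 * (d * n) ^ 2)) < ‖lam‖) {r : ℕ} (hr : r < n) :
    AnalyticAt ℂ (fun z => laplaceNumer (ρ ^ (d * n))
      (fun k : ℤ => f (ρ ^ ((d : ℤ) * (r + n * k)) * lam)) (ρ ^ (d * r) * lam / z)) z := by
  have hR0 : 0 < R := zero_lt_one.trans hR
  have hB1 : 0 ≤ B * D ^ (d * n) * R ^ ((d * n) ^ 2) := by positivity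
  have hopen : IsOpen {w : ℂ | w ≠ 0 ∧ ‖w‖ * (D ^ (d * n) * R ^ (2 * (d * n) ^ 2)) < ‖lam‖} :=
    isOpen_ne.inter (isOpen_lt (continuous_norm.mul continuous_const) continuous_const)
  refine DifferentiableOn.analyticAt (s := {w : ℂ | w ≠ 0 ∧
    ‖w‖ * (D ^ (d * n) * R ^ (2 * (d * n) ^ 2)) < ‖lam‖}) (fun w hw => ?_)
    (hopen.mem_nhds ⟨hz, hzs⟩)
  have h1 := (hf.residue (d := d) hB hD hR.le hr).differentiableAt_laplaceNumer hB1
    (one_le_pow_mul_pow hD hR) (one_lt_pow_sq hd hn hR) (norm_pow_eq_sq hρR)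
    (le_norm_spiral_div hρ hw.1 hw.2 (d * r))
  exact (DifferentiableAt.comp w h1
    ((differentiableAt_const _).div differentiableAt_id hw.1)).differentiableWithinAt

theorem analyticAt_qTheta_spiral (hρ : 1 < ‖ρ‖) (hd : d ≠ 0) (hn : n ≠ 0) (hlam : lam ≠ 0) {z : ℂ}
    (hz : z ≠ 0) (r : ℕ) :
    AnalyticAt ℂ (fun z => qTheta (ρ ^ (d * n)) (ρ ^ (d * r) * lam / z)) z := by
  have hρ0 : ρ ≠ 0 := norm_pos_iff.1 (zero_lt_one.trans hρ)
  have hp1 : 1 < ‖ρ ^ (d * n)‖ := by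
    rw [norm_pow]; exact one_lt_pow₀ hρ (mul_ne_zero hd hn)
  refine DifferentiableOn.analyticAt (s := {w : ℂ | w ≠ 0}) (fun w hw => ?_)
    (isOpen_ne.mem_nhds hz)
  have h1 := differentiableAt_qTheta hp1 (div_ne_zero (mul_ne_zero (pow_ne_zero (d * r) hρ0) hlam)
    (show w ≠ 0 from hw))
  exact (DifferentiableAt.comp w h1
    ((differentiableAt_const _).div differentiableAt_id hw)).differentiableWithinAt

theorem meromorphicAt_spiralLaplace (hρ : 1 < ‖ρ‖) (hd : d ≠ 0) (hn : n ≠ 0) (hR : 1 < R)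
    (hρR : ‖ρ‖ = R ^ (2 * (d * n))) (hB : 1 ≤ B) (hD : 1 ≤ D)
    (hf : QuadGrowth (fun l => f (ρ ^ l * lam)) B D R) {z : ℂ} (hz : z ≠ 0)
    (hzs : ‖z‖ * (D ^ (d * n) * R ^ (2 * (d * n) ^ 2)) < ‖lam‖) :
    MeromorphicAt (spiralLaplace ρ d n lam f) z := by
  have hR0 : 0 < R := zero_lt_one.trans hR
  have hlam : lam ≠ 0 := norm_pos_iff.1 (lt_of_le_of_lt (by positivity) hzs)
  refine (MeromorphicAt.const _ z).mul (MeromorphicAt.fun_sum fun r hr => ?_)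
  exact (analyticAt_laplaceNumer_spiral hρ hd hn hR hρR hB hD hf hz hzs
    (Finset.mem_range.1 hr)).meromorphicAt.div
    (analyticAt_qTheta_spiral hρ hd hn hlam hz r).meromorphicAt

theorem analyticAt_spiralLaplace (hρ : 1 < ‖ρ‖) (hd : d ≠ 0) (hn : n ≠ 0) (hR : 1 < R)
    (hρR : ‖ρ‖ = R ^ (2 * (d * n))) (hB : 1 ≤ B) (hD : 1 ≤ D)
    (hf : QuadGrowth (fun l => f (ρ ^ l * lam)) B D R) {z : ℂ} (hz : z ≠ 0)
    (hzs : ‖z‖ * (D ^ (d * n) * R ^ (2 * (d * n) ^ 2)) < ‖lam‖)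
    (hzl : ∀ l : ℤ, z ≠ -(ρ ^ ((d : ℤ) * l) * lam)) :
    AnalyticAt ℂ (spiralLaplace ρ d n lam f) z := by
  have hR0 : 0 < R := zero_lt_one.trans hR
  have hlam : lam ≠ 0 := norm_pos_iff.1 (lt_of_le_of_lt (by positivity) hzs)
  refine analyticAt_const.mul (Finset.analyticAt_fun_sum _ fun r hr => ?_)
  refine (analyticAt_laplaceNumer_spiral hρ hd hn hR hρR hB hD hf hz hzs
    (Finset.mem_range.1 hr)).div (analyticAt_qTheta_spiral hρ hd hn hlam hz r) ?_
  exact mod_cast qTheta_spiral_div_ne_zero hρ hd hn hlam hz hzl r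

/-- Away from its zeros the Theta function is comparable to the sum of the moduli of its terms. -/
theorem exists_realTheta_le (hρ : 1 < ‖ρ‖) {N : ℕ} (hN : N ≠ 0) (hlam : lam ≠ 0) {Z : Set ℂ}
    (hZ : -lam ∈ Z) {C : Set ℂ} (hC : IsCompact C) (hCU : C ⊆ offSpirals ρ Z) :
    ∃ a > 0, ∀ k : ℤ, ∀ c ∈ C, a * realTheta (‖ρ ^ N‖) ‖ρ ^ k * lam / c‖ ≤
      ‖qTheta (ρ ^ N) (ρ ^ k * lam / c)‖ := by
  have hρ0 : ρ ≠ 0 := norm_pos_iff.1 (zero_lt_one.trans hρ)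
  have hp1 : 1 < ‖ρ ^ N‖ := by rw [norm_pow]; exact one_lt_pow₀ hρ hN
  have hp0 : ρ ^ N ≠ 0 := pow_ne_zero _ hρ0
  -- Multiplication of the argument by ρ^N changes |Θ| and the sum of moduli by the same factor. It
  -- is therefore enough to compare them for one exponent in each residue class modulo N, on a
  -- compact set without zeros of Θ.
  set Y : Set ℂ := ⋃ s ∈ Finset.range N, (fun c => ρ ^ s * lam / c) '' C with hY
  have hYc : IsCompact Y := (Finset.range N).isCompact_biUnion fun s _ =>
    hC.image_of_continuousOn (continuousOn_const.div continuousOn_id fun c hc => (hCU hc).1)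
  have hYmem : ∀ x ∈ Y, x ≠ 0 ∧ qTheta (ρ ^ N) x ≠ 0 := by
    intro x hx
    simp only [hY, Set.mem_iUnion, Set.mem_image] at hx
    obtain ⟨s, hs, c, hc, rfl⟩ := hx
    have hx0 := div_ne_zero (mul_ne_zero (pow_ne_zero s hρ0) hlam) (hCU hc).1
    refine ⟨hx0, qTheta_ne_zero hp1 hx0 fun k hk => (hCU hc).2 _ hZ (s - N * k) ?_⟩
    rw [div_eq_iff (hCU hc).1] at hk
    rw [zpow_sub₀ hρ0, zpow_mul, zpow_natCast, zpow_natCast]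
    have := zpow_ne_zero k hp0
    field_simp
    rw [hk]
    ring
  have hreal : ∀ x ∈ Y, 0 < realTheta ‖ρ ^ N‖ ‖x‖ := fun x hx =>
    zero_lt_one.trans_le (one_le_realTheta hp1 (norm_pos_iff.2 (hYmem x hx).1))
  have hcont : ContinuousOn (fun x => ‖qTheta (ρ ^ N) x‖ / realTheta ‖ρ ^ N‖ ‖x‖) Y := by
    intro x hx
    have h0 := (hYmem x hx).1
    refine ContinuousAt.continuousWithinAt (ContinuousAt.div ?_ ?_ (hreal x hx).ne')
    · exact (differentiableAt_qTheta hp1 h0).continuousAt.norm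
    · exact ContinuousAt.comp (f := fun x : ℂ => ‖x‖)
        (continuousAt_realTheta hp1 (norm_pos_iff.2 h0)) continuous_norm.continuousAt
  obtain ⟨a, ha, hle⟩ : ∃ a > 0, ∀ x ∈ Y, a ≤ ‖qTheta (ρ ^ N) x‖ / realTheta ‖ρ ^ N‖ ‖x‖ := by
    rcases Y.eq_empty_or_nonempty with h | h
    · exact ⟨1, one_pos, by simp [h]⟩
    · obtain ⟨x, hx, hmin⟩ := hYc.exists_isMinOn h hcont
      exact ⟨_, div_pos (norm_pos_iff.2 (hYmem x hx).2) (hreal x hx), fun y hy => hmin hy⟩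
  refine ⟨a, ha, fun k c hc => ?_⟩
  set x := ρ ^ (k % N).toNat * lam / c with hx
  have hNpos : (0 : ℤ) < N := by omega
  have hmod := Int.emod_nonneg k hNpos.ne'
  have hxY : x ∈ Y := by
    simp only [hY, Set.mem_iUnion]
    refine ⟨(k % N).toNat, Finset.mem_range.2 ?_, c, hc, rfl⟩
    have := Int.emod_lt_of_pos k hNpos
    omega
  have e1 : ρ ^ k * lam / c = (ρ ^ N) ^ (k / N) * x := by
    rw [hx, mul_div_assoc, mul_div_assoc, ← mul_assoc, ← zpow_natCast ρ N, ← zpow_mul,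
      ← zpow_natCast ρ (k % N).toNat, ← zpow_add₀ hρ0, Int.toNat_of_nonneg hmod]
    congr 2
    rw [Int.mul_ediv_add_emod]
  have hx0 := (hYmem x hxY).1
  rw [e1, qTheta_zpow_mul hp1 hx0, norm_mul, norm_mul, norm_mul, norm_zpow, norm_zpow, norm_zpow,
    realTheta_zpow_mul hp1 (norm_pos_iff.2 hx0)]
  have := (le_div_iff₀ (hreal x hxY)).1 (hle x hxY)
  calc _ = ‖ρ ^ N‖ ^ triang (k / N - 1) * ‖x‖ ^ (k / N) * (a * realTheta ‖ρ ^ N‖ ‖x‖) := by ring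
    _ ≤ _ := mul_le_mul_of_nonneg_left this (by positivity)

/-- The numerator is at most M times the sum of moduli of the Theta series, and the denominator is
at least a times the same sum, because the points stay away from the spiral of -lam. Each quotient
is then at most M / a. -/
theorem exists_bound_spiralLaplace (hρ : 1 < ‖ρ‖) (hd : d ≠ 0) (hn : n ≠ 0) (hR : 1 < R)
    (hρR : ‖ρ‖ = R ^ (2 * (d * n))) (hB : 1 ≤ B) (hD : 1 ≤ D) (hlam : lam ≠ 0)
    (hf : QuadGrowth (fun l => f (ρ ^ l * lam)) B D R) {Z : Set ℂ} (hZf : Z.Finite)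
    (hZ : -lam ∈ Z) {C : Set ℂ} (hC : IsCompact C) (hCU : C ⊆ offSpirals ρ Z) :
    ∃ (l₀ : ℤ) (B' : ℝ), ∀ l ≤ l₀, ∀ c ∈ C, ‖spiralLaplace ρ d n lam f (ρ ^ l * c)‖ ≤ B' := by
  have hρ0 : ρ ≠ 0 := norm_pos_iff.1 (zero_lt_one.trans hρ)
  have hR0 : 0 < R := zero_lt_one.trans hR
  have hp1 : 1 < ‖ρ ^ (d * n)‖ := by
    rw [norm_pow]; exact one_lt_pow₀ hρ (mul_ne_zero hd hn)
  obtain ⟨a, ha, hle⟩ := exists_realTheta_le hρ (mul_ne_zero hd hn) hlam hZ hC hCU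
  obtain ⟨a', b, η, ha', hab, -, hCab, -⟩ := exists_compact_bounds hρ hZf hC hCU
  have hb : 0 < b := ha'.trans_le hab
  set T := D ^ (d * n) * R ^ (2 * (d * n) ^ 2) with hT
  have hT1 : 1 ≤ T := one_le_pow_mul_pow hD hR
  -- For l ≤ -k the dilate ρ^l C lies in the disc where the numerators converge.
  obtain ⟨k, hk⟩ := pow_unbounded_of_one_lt (b * T / ‖lam‖) hρ
  set Q := R ^ ((d * n) ^ 2) with hQ
  set M := B * D ^ (d * n) * Q * (1 + Q * ∑' l : ℤ, Q⁻¹ ^ l.natAbs) with hM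
  have hB1 : 0 ≤ B * D ^ (d * n) * Q := by positivity
  refine ⟨-k, M / a, fun l hl c hc => ?_⟩
  have hc0 : c ≠ 0 := (hCU hc).1
  have hz0 : ρ ^ l * c ≠ 0 := mul_ne_zero (zpow_ne_zero _ hρ0) hc0
  have hlampos : 0 < ‖lam‖ := norm_pos_iff.2 hlam
  have hzs : ‖ρ ^ l * c‖ * T < ‖lam‖ := by
    rw [norm_mul, norm_zpow]
    have h1 : ‖ρ‖ ^ l ≤ ‖ρ‖ ^ (-(k : ℤ)) := zpow_le_zpow_right₀ hρ.le hl
    rw [zpow_neg, zpow_natCast] at h1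
    rw [div_lt_iff₀ hlampos] at hk
    have hρk : 0 < ‖ρ‖ ^ k := by positivity
    calc ‖ρ‖ ^ l * ‖c‖ * T ≤ (‖ρ‖ ^ k)⁻¹ * b * T := by
          gcongr
          exact (hCab c hc).2
      _ = (‖ρ‖ ^ k)⁻¹ * (b * T) := by ring
      _ < (‖ρ‖ ^ k)⁻¹ * (‖ρ‖ ^ k * ‖lam‖) := by gcongr
      _ = ‖lam‖ := by field_simp
  have hterm : ∀ r ∈ Finset.range n, ‖laplaceNumer (ρ ^ (d * n))
      (fun k : ℤ => f (ρ ^ ((d : ℤ) * (r + n * k)) * lam)) (ρ ^ (d * r) * lam / (ρ ^ l * c)) /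
      qTheta (ρ ^ (d * n)) (ρ ^ (d * r) * lam / (ρ ^ l * c))‖ ≤ M / a := by
    intro r hr
    have h1 := (hf.residue (d := d) hB hD hR.le (Finset.mem_range.1 hr)).norm_laplaceNumer_le hB1
      (one_le_pow_mul_pow hD hR) (one_lt_pow_sq hd hn hR) (norm_pow_eq_sq hρR)
      (le_norm_spiral_div hρ hz0 hzs (d * r)).le
    have e1 : ρ ^ (d * r) * lam / (ρ ^ l * c) = ρ ^ (((d * r : ℕ) : ℤ) - l) * lam / c := by
      rw [zpow_sub₀ hρ0, zpow_natCast]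
      field_simp
    have h2 := hle (((d * r : ℕ) : ℤ) - l) c hc
    rw [← e1] at h2
    have h3 : 0 < realTheta ‖ρ ^ (d * n)‖ ‖ρ ^ (d * r) * lam / (ρ ^ l * c)‖ :=
      zero_lt_one.trans_le (one_le_realTheta hp1 (norm_pos_iff.2
        (div_ne_zero (mul_ne_zero (pow_ne_zero _ hρ0) hlam) hz0)))
    rw [norm_div]
    refine (div_le_div₀ ((norm_nonneg _).trans h1) h1 (mul_pos ha h3) h2).trans_eq ?_
    simp only [hM, hQ]
    field_simp
  rw [spiralLaplace, norm_mul, norm_div, norm_one, Complex.norm_natCast]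
  have hn0 : (0 : ℝ) < n := by positivity
  calc _ ≤ 1 / (n : ℝ) * ∑ r ∈ Finset.range n, M / a := by
        gcongr
        exact (norm_sum_le _ _).trans (Finset.sum_le_sum hterm)
    _ = M / a := by rw [Finset.sum_const, Finset.card_range, nsmul_eq_mul]; field_simp

/-- The Laplace transform exchanges `z ^ j σ ^ m` and `p ^ (j(j-1)/2) z ^ j σ ^ (m + N j)`. -/
theorem hasSum_shift_spiralLaplace (hρ : 1 < ‖ρ‖) (hd : d ≠ 0) (hn : n ≠ 0) (hR : 1 < R)
    (hρR : ‖ρ‖ = R ^ (2 * (d * n))) (hB : 1 ≤ B) (hD : 1 ≤ D)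
    (hf : QuadGrowth (fun l => f (ρ ^ l * lam)) B D R) {z : ℂ} (hz : z ≠ 0) (j : ℕ) (i : ℤ)
    (hzs : ‖ρ ^ ((d : ℤ) * i + d * n * j) * z‖ * (D ^ (d * n) * R ^ (2 * (d * n) ^ 2)) < ‖lam‖)
    (hzl : ∀ l : ℤ, z ≠ -(ρ ^ ((d : ℤ) * l) * lam)) :
    HasSum (fun l : ℤ => 1 / (n : ℂ) * ((ρ ^ ((d : ℤ) * l) * lam) ^ j *
      f (ρ ^ ((d : ℤ) * i) * (ρ ^ ((d : ℤ) * l) * lam)) /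
      qTheta (ρ ^ (d * n)) (ρ ^ (d * n) * (ρ ^ ((d : ℤ) * l) * lam / z))))
      (ρ ^ ((d * n : ℤ) * triang ((j : ℤ) - 1)) * z ^ j *
        spiralLaplace ρ d n lam f (ρ ^ ((d : ℤ) * i + d * n * j) * z)) := by
  have hρ0 : ρ ≠ 0 := norm_pos_iff.1 (zero_lt_one.trans hρ)
  have hR0 : 0 < R := zero_lt_one.trans hR
  have hp1 : 1 < ‖ρ ^ (d * n)‖ := by
    rw [norm_pow]; exact one_lt_pow₀ hρ (mul_ne_zero hd hn)
  have hp0 : ρ ^ (d * n) ≠ 0 := pow_ne_zero _ hρ0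
  have hlam : lam ≠ 0 := norm_pos_iff.1 (lt_of_le_of_lt (by positivity) hzs)
  have h1 := hasSum_spiralLaplace hρ hd hn hR hρR hB hD hf
    (mul_ne_zero (zpow_ne_zero _ hρ0) hz) hzs (fun l hl => hzl (l - i - n * j) (by
      have e : ρ ^ ((d : ℤ) * l) = ρ ^ ((d : ℤ) * i + d * n * j) *
          ρ ^ ((d : ℤ) * (l - i - n * j)) := by
        rw [← zpow_add₀ hρ0]; congr 1; ring
      refine mul_left_cancel₀ (zpow_ne_zero ((d : ℤ) * i + d * n * j) hρ0) ?_
      rw [hl, e]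
      ring))
  -- The shift by ρ^(d i) permutes the points of the spiral; afterwards the terms agree one by one,
  -- by the functional equation for the factor (ρ^(dn))^(-j).
  rw [← (Equiv.addRight i).hasSum_iff] at h1
  refine (h1.mul_left (ρ ^ ((d * n : ℤ) * triang ((j : ℤ) - 1)) * z ^ j)).congr_fun fun l => ?_
  simp only [Function.comp, Equiv.coe_addRight]
  set ζ := ρ ^ ((d : ℤ) * l) * lam with hζ
  have hζ0 : ζ ≠ 0 := mul_ne_zero (zpow_ne_zero _ hρ0) hlam
  set y := ρ ^ (d * n) * (ζ / z) with hy
  have hy0 : y ≠ 0 := mul_ne_zero hp0 (div_ne_zero hζ0 hz)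
  have e1 : ρ ^ ((d : ℤ) * (l + i)) * lam = ρ ^ ((d : ℤ) * i) * ζ := by
    rw [hζ, ← mul_assoc, ← zpow_add₀ hρ0]; congr 2; ring
  have e2 : ρ ^ (d * n) * (ρ ^ ((d : ℤ) * i) * ζ / (ρ ^ ((d : ℤ) * i + d * n * j) * z)) =
      (ρ ^ (d * n)) ^ (-(j : ℤ)) * y := by
    rw [hy, zpow_add₀ hρ0, zpow_neg, ← zpow_natCast ρ (d * n), ← zpow_mul]
    push_cast
    have := zpow_ne_zero ((d : ℤ) * i) hρ0
    have := zpow_ne_zero ((d : ℤ) * n * j) hρ0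
    field_simp
  rw [e1, e2, qTheta_zpow_mul hp1 hy0, show -(j : ℤ) - 1 = -1 - j by ring, triang_neg_one_sub,
    show ρ ^ ((d * n : ℤ) * triang ((j : ℤ) - 1)) =
      (ρ ^ (d * n)) ^ (triang (j : ℤ)) * ((ρ ^ (d * n)) ^ j)⁻¹ by
        rw [triang_sub_one, zpow_mul, ← zpow_natCast (ρ ^ (d * n)) j, ← zpow_neg, ← zpow_add₀ hp0,
          ← zpow_natCast ρ (d * n)]
        push_cast
        rfl,
    zpow_neg, zpow_natCast]
  have hyj : y ^ j = (ρ ^ (d * n)) ^ j * (ζ ^ j / z ^ j) := by rw [hy, mul_pow, div_pow]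
  rw [hyj]
  have := zpow_ne_zero (triang (j : ℤ)) hp0
  have := pow_ne_zero j hp0
  have := pow_ne_zero j hζ0
  have := pow_ne_zero j hz
  -- If Θ vanished, both terms would be 0 by the convention x / 0 = 0, so no nonvanishing statement
  -- is required here.
  by_cases h0 : qTheta (ρ ^ (d * n)) y = 0
  · simp [h0]
  field_simp

end Laplace

/-! ### The equation satisfied by the Laplace transform. -/

/-- The polynomial `∑ a_i ρ ^ (t i(i-1)/2) z ^ i` attached to `A = ∑ a_i z ^ i`. -/
def twistPoly (ρ : ℂ) (t : ℤ) (A : Polynomial ℂ) : Polynomial ℂ :=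
  ∑ i ∈ Finset.range (A.natDegree + 1),
    Polynomial.C (A.coeff i * ρ ^ (t * triang ((i : ℤ) - 1))) * Polynomial.X ^ i

theorem eval_twistPoly (ρ : ℂ) (t : ℤ) (A : Polynomial ℂ) (z : ℂ) :
    (twistPoly ρ t A).eval z = ∑ i ∈ Finset.range (A.natDegree + 1),
      A.coeff i * ρ ^ (t * triang ((i : ℤ) - 1)) * z ^ i := by
  simp [twistPoly, Polynomial.eval_finsetSum]

/-- For the constant 1 the numerator series is Θ itself. Combined with the shift rule this gives the
transform of each monomial on the right-hand side of the equation. -/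
theorem spiralLaplace_one {ρ : ℂ} (hρ : 1 < ‖ρ‖) {d n : ℕ} (hd : d ≠ 0) (hn : n ≠ 0) {lam z : ℂ}
    (hlam : lam ≠ 0) (hz : z ≠ 0) (hzl : ∀ l : ℤ, z ≠ -(ρ ^ ((d : ℤ) * l) * lam)) :
    spiralLaplace ρ d n lam (fun _ => 1) z = 1 := by
  have h1 : ∀ r ∈ Finset.range n, laplaceNumer (ρ ^ (d * n))
      (fun _ : ℤ => (1 : ℂ)) (ρ ^ (d * r) * lam / z) /
      qTheta (ρ ^ (d * n)) (ρ ^ (d * r) * lam / z) = 1 := by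
    intro r _
    have h2 : qTheta (ρ ^ (d * n)) (ρ ^ (d * r) * lam / z) ≠ 0 :=
      mod_cast qTheta_spiral_div_ne_zero hρ hd hn hlam hz hzl r
    have h3 : laplaceNumer (ρ ^ (d * n)) (fun _ : ℤ => (1 : ℂ)) (ρ ^ (d * r) * lam / z) =
        qTheta (ρ ^ (d * n)) (ρ ^ (d * r) * lam / z) := by
      simp only [laplaceNumer, one_mul]; rfl
    rw [h3, div_self h2]
  have hn' : (n : ℂ) ≠ 0 := Nat.cast_ne_zero.2 hn
  rw [spiralLaplace, Finset.sum_congr rfl h1, Finset.sum_const, Finset.card_range, nsmul_eq_mul]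
  field_simp

section Equation

variable {ι : Type*} {ρ : ℂ} {S : Finset ι} {c : ι → ℂ} {j : ι → ℕ} {m : ι → ℤ} {t : ℤ}
  {A : Polynomial ℂ} {d n : ℕ} {lam : ℂ} {f : ℂ → ℂ} {B D R : ℝ} {Z : Set ℂ}

/-- The Laplace transform of a solution is a solution of the transformed equation near `0`. -/
theorem exists_shiftOp_spiralLaplace (hρ : 1 < ‖ρ‖) (hd : d ≠ 0) (hn : n ≠ 0) (hR : 1 < R)
    (hρR : ‖ρ‖ = R ^ (2 * (d * n))) (hB : 1 ≤ B) (hD : 1 ≤ D)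
    (hf : QuadGrowth (fun l => f (ρ ^ l * lam)) B D R) (hlam : lam ∈ offSpirals ρ Z)
    (hZ : -lam ∈ Z) (hdm : ∀ s ∈ S, (d : ℤ) ∣ m s)
    (heq : ∀ z ∈ offSpirals ρ Z, shiftOp ρ S (fun s => c s * ρ ^ (t * triang ((j s : ℤ) - 1))) j m
      f z = (twistPoly ρ t A).eval z) :
    ∃ δ > 0, ∀ z ∈ offSpirals ρ Z, ‖z‖ < δ →
      shiftOp ρ S (fun s => c s * ρ ^ ((t + d * n) * triang ((j s : ℤ) - 1))) j
        (fun s => m s + d * n * j s) (spiralLaplace ρ d n lam f) z =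
      (twistPoly ρ (t + d * n) A).eval z := by
  have hρ0 : ρ ≠ 0 := norm_pos_iff.1 (zero_lt_one.trans hρ)
  have hR0 : 0 < R := zero_lt_one.trans hR
  set T := D ^ (d * n) * R ^ (2 * (d * n) ^ 2) with hT
  have hT0 : 0 < T := by positivity
  have hlampos : 0 < ‖lam‖ := norm_pos_iff.2 hlam.1
  -- An upper bound for all the shifts in the transformed operator and on the right-hand side; z is
  -- taken so small that every ρ^k z with k ≤ k₀ remains in the region of convergence.
  set k₀ : ℤ := ∑ s ∈ S, |m s + d * n * j s| + d * n * A.natDegree with hk₀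
  have hsum0 : 0 ≤ ∑ s ∈ S, |m s + d * n * j s| := Finset.sum_nonneg fun _ _ => abs_nonneg _
  refine ⟨‖lam‖ / (‖ρ‖ ^ k₀ * T), by positivity, fun z hz hzδ => ?_⟩
  have hsmall : ∀ k ≤ k₀, ‖ρ ^ k * z‖ * T < ‖lam‖ := by
    intro k hk
    rw [lt_div_iff₀ (by positivity)] at hzδ
    rw [norm_mul, norm_zpow]
    have : ‖ρ‖ ^ k ≤ ‖ρ‖ ^ k₀ := zpow_le_zpow_right₀ hρ.le hk
    calc ‖ρ‖ ^ k * ‖z‖ * T ≤ ‖ρ‖ ^ k₀ * ‖z‖ * T := by gcongr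
      _ = ‖z‖ * (‖ρ‖ ^ k₀ * T) := by ring
      _ < _ := hzδ
  have hzl : ∀ l : ℤ, z ≠ -(ρ ^ ((d : ℤ) * l) * lam) := fun l h =>
    hz.2 _ hZ ((d : ℤ) * l) (by rw [h, mul_neg])
  set θ : ℤ → ℂ := fun l => qTheta (ρ ^ (d * n)) (ρ ^ (d * n) * (ρ ^ ((d : ℤ) * l) * lam / z))
    with hθ
  have hop : HasSum (fun l : ℤ => 1 / (n : ℂ) * ((twistPoly ρ t A).eval (ρ ^ ((d : ℤ) * l) * lam) /
      θ l)) (shiftOp ρ S (fun s => c s * ρ ^ ((t + d * n) * triang ((j s : ℤ) - 1))) j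
        (fun s => m s + d * n * j s) (spiralLaplace ρ d n lam f) z) := by
    have h1 := hasSum_sum (s := S) fun s hs => by
      obtain ⟨i, hi⟩ := hdm s hs
      have hk : (d : ℤ) * i + d * n * j s ≤ k₀ := by
        rw [← hi]
        have h2 := Finset.single_le_sum (f := fun s => |m s + d * n * j s|)
          (fun _ _ => abs_nonneg _) hs
        have h3 := le_abs_self (m s + d * n * j s)
        have h4 : (0 : ℤ) ≤ d * n * A.natDegree := by positivity
        omega
      have h1 := (hasSum_shift_spiralLaplace hρ hd hn hR hρR hB hD hf hz.1 (j s) i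
        (hsmall _ hk) hzl).mul_left (c s * ρ ^ (t * triang ((j s : ℤ) - 1)))
      rw [← hi] at h1
      exact h1
    convert! h1 using 1
    · funext l
      rw [← heq _ (zpow_mul_mem_offSpirals hρ0 hlam _), shiftOp, Finset.sum_div, Finset.mul_sum]
      refine Finset.sum_congr rfl fun s _ => ?_
      simp only [hθ]
      ring
    · rw [shiftOp]
      refine Finset.sum_congr rfl fun s _ => ?_
      rw [add_mul t, zpow_add₀ hρ0]
      ring
  have hpoly : HasSum (fun l : ℤ => 1 / (n : ℂ) * ((twistPoly ρ t A).eval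
      (ρ ^ ((d : ℤ) * l) * lam) / θ l)) ((twistPoly ρ (t + d * n) A).eval z) := by
    have hone : QuadGrowth (fun l => (fun _ : ℂ => (1 : ℂ)) (ρ ^ l * lam)) B D R := by
      refine ⟨fun l _ => by simpa using hB, fun l => ?_⟩
      rw [norm_one]
      exact one_le_mul_of_one_le_of_one_le (one_le_mul_of_one_le_of_one_le hB (one_le_pow₀ hD))
        (one_le_pow₀ hR.le)
    have h1 := hasSum_sum (s := Finset.range (A.natDegree + 1)) fun i hi => by
      have hi := Finset.mem_range.1 hi
      have hk : (d : ℤ) * 0 + d * n * i ≤ k₀ := by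
        rw [mul_zero, zero_add]
        have : (d : ℤ) * n * i ≤ d * n * A.natDegree := by gcongr; omega
        omega
      exact (hasSum_shift_spiralLaplace (f := fun _ => 1) hρ hd hn hR hρR hB hD hone hz.1 i 0
        (hsmall _ hk) hzl).mul_left (A.coeff i * ρ ^ (t * triang ((i : ℤ) - 1)))
    convert! h1 using 1
    · funext l
      rw [eval_twistPoly, Finset.sum_div, Finset.mul_sum]
      refine Finset.sum_congr rfl fun s _ => ?_
      simp only [hθ]
      ring
    · rw [eval_twistPoly]
      refine Finset.sum_congr rfl fun i _ => ?_
      rw [spiralLaplace_one hρ hd hn hlam.1 (mul_ne_zero (zpow_ne_zero _ hρ0) hz.1)]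
      · rw [add_mul t, zpow_add₀ hρ0]
        ring
      · intro l h
        refine hz.2 _ hZ ((d : ℤ) * l - ((d : ℤ) * 0 + d * n * i)) ?_
        rw [zpow_sub₀ hρ0, mul_neg]
        have := zpow_ne_zero ((d : ℤ) * 0 + d * n * i) hρ0
        rw [div_mul_eq_mul_div, ← neg_div, eq_div_iff this, ← h]
        ring
  exact hop.unique hpoly

end Equation

/-! ### Convergence of the iterated Borel transform -/

section Initial

variable {ι : Type*} {ρ : ℂ} {S : Finset ι} {c : ι → ℂ} {j : ι → ℕ} {m : ι → ℤ}
  {A : Polynomial ℂ} {b : ℕ → ℂ}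

/-- In the recursion at index l + j_v, the coefficient b_l appears with weight c_v ρ^(m_v l). Other
terms of the same ordinate carry strictly smaller shifts, so for large l they are absorbed in half
of this one. All remaining terms involve earlier coefficients, with weights that are bounded
relative to ρ^(m_v l). -/
theorem exists_geometric_bound (hρ : 1 < ‖ρ‖) {v : ι} (hv : v ∈ S) (hcv : c v ≠ 0)
    (hj : ∀ s ∈ S, j v ≤ j s) (hm : ∀ s ∈ S, m s ≤ m v)
    (huniq : ∀ s ∈ S, s ≠ v → j s = j v → m s < m v)
    (hrec : ∀ k : ℕ, ∑ s ∈ S, (if j s ≤ k then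
      c s * ρ ^ (m s * ((k - j s : ℕ) : ℤ)) * b (k - j s) else 0) = A.coeff k) :
    ∃ B D : ℝ, 1 ≤ B ∧ 1 ≤ D ∧ ∀ l, ‖b l‖ ≤ B * D ^ l := by
  classical
  have hρ0 : ρ ≠ 0 := norm_pos_iff.1 (zero_lt_one.trans hρ)
  have hρn : 0 < ‖ρ‖ := norm_pos_iff.2 hρ0
  set e := m v with he
  set C₀ : ℝ := ∑ s ∈ S.erase v, ‖c s‖ with hC₀
  set G : ℝ := ∑ s ∈ S.erase v, ‖c s‖ * ‖ρ‖ ^ (-e * ((j s - j v : ℕ) : ℤ)) with hG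
  have hG0 : 0 ≤ G := Finset.sum_nonneg fun _ _ => by positivity
  have hC₀0 : 0 ≤ C₀ := Finset.sum_nonneg fun _ _ => by positivity
  have hcv0 : 0 < ‖c v‖ := norm_pos_iff.2 hcv
  -- From l₀ on, the competing terms of the same ordinate cost at most half of ‖c v‖; passing the
  -- degree of A as well makes the right-hand side of the recursion zero.
  obtain ⟨l₀, hl₀⟩ := pow_unbounded_of_one_lt (2 * C₀ / ‖c v‖) hρ
  set l₁ := max l₀ (A.natDegree + 1) with hl₁
  set D := 1 + 2 * G / ‖c v‖ with hD
  set B := 1 + ∑ l ∈ Finset.range l₁, ‖b l‖ with hB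
  have hB0 : 0 ≤ ∑ l ∈ Finset.range l₁, ‖b l‖ := Finset.sum_nonneg fun _ _ => norm_nonneg _
  have hB1 : 1 ≤ B := by linarith
  have hD1 : 1 ≤ D := by
    have : 0 ≤ 2 * G / ‖c v‖ := by positivity
    linarith
  refine ⟨B, D, hB1, hD1, fun l => ?_⟩
  induction l using Nat.strong_induction_on with
  | _ l ih =>
    rcases lt_or_ge l l₁ with hl | hl
    · have h1 := Finset.single_le_sum (f := fun l => ‖b l‖) (fun _ _ => norm_nonneg _)
        (Finset.mem_range.2 hl)
      have h2 : ‖b l‖ ≤ B := by linarith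
      exact h2.trans (le_mul_of_one_le_right (by linarith) (one_le_pow₀ hD1))
    have hll₀ : l₀ ≤ l := (le_max_left _ _).trans hl
    have hlA : A.natDegree + 1 ≤ l := (le_max_right _ _).trans hl
    obtain ⟨i, rfl⟩ : ∃ i, l = i + 1 := ⟨l - 1, by omega⟩
    have hk := hrec (i + 1 + j v)
    rw [Polynomial.coeff_eq_zero_of_natDegree_lt (by omega), ← Finset.add_sum_erase _ _ hv,
      if_pos (by omega), Nat.add_sub_cancel] at hk
    have hterm : ∀ s ∈ S.erase v, ‖(if j s ≤ i + 1 + j v then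
        c s * ρ ^ (m s * ((i + 1 + j v - j s : ℕ) : ℤ)) * b (i + 1 + j v - j s) else 0)‖ ≤
        ‖ρ‖ ^ (e * ((i + 1 : ℕ) : ℤ)) * (‖c s‖ * ((‖ρ‖ ^ (i + 1))⁻¹ * ‖b (i + 1)‖) +
          ‖c s‖ * ‖ρ‖ ^ (-e * ((j s - j v : ℕ) : ℤ)) * (B * D ^ i)) := by
      intro s hs
      obtain ⟨hsv, hsS⟩ := Finset.mem_erase.1 hs
      have hD0 : 0 < D := zero_lt_one.trans_le hD1
      have hB0 : 0 < B := zero_lt_one.trans_le hB1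
      split_ifs with hle
      · rw [norm_mul, norm_mul, norm_zpow]
        rcases eq_or_lt_of_le (hj s hsS) with h | h
        · rw [← h, Nat.add_sub_cancel]
          have h1 : m s + 1 ≤ e := huniq s hsS hsv h.symm
          have h2 : ‖ρ‖ ^ (m s * ((i + 1 : ℕ) : ℤ)) ≤
              ‖ρ‖ ^ (e * ((i + 1 : ℕ) : ℤ)) * (‖ρ‖ ^ (i + 1))⁻¹ := by
            rw [← zpow_natCast ‖ρ‖ (i + 1), ← zpow_neg, ← zpow_add₀ hρn.ne']
            refine zpow_le_zpow_right₀ hρ.le ?_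
            have : (m s + 1) * ((i + 1 : ℕ) : ℤ) ≤ e * ((i + 1 : ℕ) : ℤ) := by gcongr
            linarith
          calc ‖c s‖ * ‖ρ‖ ^ (m s * ((i + 1 : ℕ) : ℤ)) * ‖b (i + 1)‖
              ≤ ‖c s‖ * (‖ρ‖ ^ (e * ((i + 1 : ℕ) : ℤ)) * (‖ρ‖ ^ (i + 1))⁻¹) * ‖b (i + 1)‖ := by
                gcongr
            _ = ‖ρ‖ ^ (e * ((i + 1 : ℕ) : ℤ)) *
                (‖c s‖ * ((‖ρ‖ ^ (i + 1))⁻¹ * ‖b (i + 1)‖)) := by ring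
            _ ≤ _ := by
              gcongr
              simp only [le_add_iff_nonneg_right]
              positivity
        · obtain ⟨τ, hτ⟩ : ∃ τ, j s = j v + (τ + 1) := ⟨j s - j v - 1, by omega⟩
          have e1 : i + 1 + j v - j s = i - τ := by omega
          have e2 : j s - j v = τ + 1 := by omega
          rw [e1, e2]
          have h1 := ih (i - τ) (by omega)
          have h2 : ‖ρ‖ ^ (m s * ((i - τ : ℕ) : ℤ)) ≤
              ‖ρ‖ ^ (e * ((i + 1 : ℕ) : ℤ)) * ‖ρ‖ ^ (-e * ((τ + 1 : ℕ) : ℤ)) := by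
            rw [← zpow_add₀ hρn.ne']
            refine zpow_le_zpow_right₀ hρ.le ?_
            have h3 : m s * ((i - τ : ℕ) : ℤ) ≤ e * ((i - τ : ℕ) : ℤ) := by
              gcongr; exact hm s hsS
            have h4 : ((i - τ : ℕ) : ℤ) = (i + 1 : ℕ) - (τ + 1 : ℕ) := by omega
            refine h3.trans_eq ?_
            rw [h4]; ring
          have h3 : D ^ (i - τ) ≤ D ^ i := pow_le_pow_right₀ hD1 (by omega)
          calc ‖c s‖ * ‖ρ‖ ^ (m s * ((i - τ : ℕ) : ℤ)) * ‖b (i - τ)‖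
              ≤ ‖c s‖ * (‖ρ‖ ^ (e * ((i + 1 : ℕ) : ℤ)) * ‖ρ‖ ^ (-e * ((τ + 1 : ℕ) : ℤ))) *
                (B * D ^ i) := by
                gcongr
                exact h1.trans (by gcongr)
            _ = ‖ρ‖ ^ (e * ((i + 1 : ℕ) : ℤ)) *
                (‖c s‖ * ‖ρ‖ ^ (-e * ((τ + 1 : ℕ) : ℤ)) * (B * D ^ i)) := by ring
            _ ≤ _ := by
              gcongr
              simp only [le_add_iff_nonneg_left]
              positivity
      · rw [norm_zero]; positivity
    have h1 : ‖c v * ρ ^ (e * ((i + 1 : ℕ) : ℤ)) * b (i + 1)‖ ≤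
        ‖ρ‖ ^ (e * ((i + 1 : ℕ) : ℤ)) * (C₀ * ((‖ρ‖ ^ (i + 1))⁻¹ * ‖b (i + 1)‖) +
          G * (B * D ^ i)) := by
      rw [eq_neg_of_add_eq_zero_left hk, norm_neg]
      refine (norm_sum_le _ _).trans ((Finset.sum_le_sum hterm).trans_eq ?_)
      rw [← Finset.mul_sum, Finset.sum_add_distrib, ← Finset.sum_mul, ← Finset.sum_mul]
    rw [norm_mul, norm_mul, norm_zpow, mul_comm ‖c v‖, mul_assoc] at h1
    have h2 := le_of_mul_le_mul_left h1 (zpow_pos hρn _)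
    have h3 : C₀ * ((‖ρ‖ ^ (i + 1))⁻¹ * ‖b (i + 1)‖) ≤ ‖c v‖ / 2 * ‖b (i + 1)‖ := by
      rw [← mul_assoc]
      refine mul_le_mul_of_nonneg_right ?_ (norm_nonneg _)
      rw [← div_eq_mul_inv, div_le_iff₀ (by positivity)]
      have h4 : ‖ρ‖ ^ l₀ ≤ ‖ρ‖ ^ (i + 1) := pow_le_pow_right₀ hρ.le hll₀
      have h5 := (hl₀.trans_le h4).le
      rw [div_le_iff₀ hcv0] at h5
      linarith
    have h4 : ‖c v‖ * ‖b (i + 1)‖ ≤ 2 * G * (B * D ^ i) := by linarith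
    have h5 : ‖b (i + 1)‖ ≤ 2 * G / ‖c v‖ * (B * D ^ i) := by
      rw [div_mul_eq_mul_div, le_div_iff₀ hcv0]; linarith
    calc ‖b (i + 1)‖ ≤ 2 * G / ‖c v‖ * (B * D ^ i) := h5
      _ ≤ D * (B * D ^ i) := by
        gcongr
        linarith
      _ = _ := by ring

/-- The sum of a convergent formal solution is a solution. -/
theorem exists_sum_of_geometric_bound (hρ : ρ ≠ 0) {B D : ℝ} (hB : 1 ≤ B) (hD : 1 ≤ D)
    (hb : ∀ l, ‖b l‖ ≤ B * D ^ l)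
    (hrec : ∀ k : ℕ, ∑ s ∈ S, (if j s ≤ k then
      c s * ρ ^ (m s * ((k - j s : ℕ) : ℤ)) * b (k - j s) else 0) = A.coeff k) :
    ∃ f : ℂ → ℂ, ∃ δ > 0, (∀ z, ‖z‖ < δ → HasSum (fun l => b l * z ^ l) (f z)) ∧
      (∀ z, ‖z‖ < δ → AnalyticAt ℂ f z) ∧ (∀ z, ‖z‖ < δ → ‖f z‖ ≤ 2 * B) ∧
      ∀ z, ‖z‖ < δ → shiftOp ρ S c j m f z = A.eval z := by
  have hρn : 0 < ‖ρ‖ := norm_pos_iff.2 hρ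
  have hD0 : 0 < D := zero_lt_one.trans_le hD
  have hterm : ∀ z : ℂ, ‖z‖ < 1 / (2 * D) → ∀ l, ‖b l * z ^ l‖ ≤ B * (1 / 2) ^ l := by
    intro z hz l
    rw [norm_mul, norm_pow]
    calc ‖b l‖ * ‖z‖ ^ l ≤ B * D ^ l * (1 / (2 * D)) ^ l := by
          gcongr
          exact hb l
      _ = B * (1 / 2) ^ l := by
        rw [mul_assoc, ← mul_pow]; congr 2; field_simp
  have hgeo : HasSum (fun l : ℕ => B * (1 / 2 : ℝ) ^ l) (B * 2) := hasSum_geometric_two.mul_left B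
  have hsum : ∀ z : ℂ, ‖z‖ < 1 / (2 * D) →
      HasSum (fun l => b l * z ^ l) (∑' l, b l * z ^ l) := fun z hz =>
    (Summable.of_norm_bounded hgeo.summable (hterm z hz)).hasSum
  have hopen : IsOpen {z : ℂ | ‖z‖ < 1 / (2 * D)} := isOpen_lt continuous_norm continuous_const
  set k₀ : ℤ := ∑ s ∈ S, |m s| with hk₀
  set M : ℝ := 1 + ∑ s ∈ S, ‖ρ‖ ^ (m s) with hM
  have hMs : 0 ≤ ∑ s ∈ S, ‖ρ‖ ^ (m s) := Finset.sum_nonneg fun _ _ => by positivity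
  have hM1 : 1 ≤ M := by linarith
  have hM0 : 0 < M := by linarith
  have hδ : 1 / (2 * D) / M ≤ 1 / (2 * D) := div_le_self (by positivity) hM1
  refine ⟨fun z => ∑' l, b l * z ^ l, 1 / (2 * D) / M, by positivity,
    fun z hz => hsum z (hz.trans_le hδ), fun z hz => ?_, fun z hz => ?_, fun z hz => ?_⟩
  · refine DifferentiableOn.analyticAt (s := {z : ℂ | ‖z‖ < 1 / (2 * D)}) ?_
      (hopen.mem_nhds (hz.trans_le hδ))
    exact Complex.differentiableOn_tsum_of_summable_norm hgeo.summable
      (fun l => by fun_prop) hopen fun l w hw => hterm w hw l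
  · rw [mul_comm]
    exact tsum_of_norm_bounded hgeo (hterm z (hz.trans_le hδ))
  · have h1 : HasSum (fun k : ℕ => A.coeff k * z ^ k)
        (shiftOp ρ S c j m (fun z => ∑' l, b l * z ^ l) z) := by
      have h2 := hasSum_sum (s := S) (f := fun s (k : ℕ) => (if j s ≤ k then
          c s * ρ ^ (m s * ((k - j s : ℕ) : ℤ)) * b (k - j s) else 0) * z ^ k)
        (a := fun s => c s * z ^ j s * ∑' l, b l * (ρ ^ m s * z) ^ l) fun s hs => by
        have hz' : ‖ρ ^ m s * z‖ < 1 / (2 * D) := by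
          rw [norm_mul, norm_zpow]
          rw [lt_div_iff₀ hM0] at hz
          have h3 := Finset.single_le_sum (f := fun s => ‖ρ‖ ^ (m s))
            (fun _ _ => by positivity) hs
          have h4 : ‖ρ‖ ^ (m s) ≤ M := by linarith
          calc ‖ρ‖ ^ (m s) * ‖z‖ ≤ M * ‖z‖ := by gcongr
            _ < _ := by rwa [mul_comm]
        have h3 := (hsum _ hz').mul_left (c s * z ^ j s)
        -- The factor z^(j_s) translates the index by j_s; the indices k < j_s not reached carry the
        -- value 0.
        rw [← (add_left_injective (j s)).hasSum_iff]
        · refine h3.congr_fun fun l => ?_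
          simp only [Function.comp]
          rw [if_pos (by omega), Nat.add_sub_cancel, zpow_mul, zpow_natCast, mul_pow, pow_add]
          ring
        · intro k hk
          rw [if_neg, zero_mul]
          intro hle
          exact hk ⟨k - j s, by simp only; omega⟩
      refine h2.congr_fun fun k => ?_
      rw [← Finset.sum_mul, hrec]
    refine h1.unique ?_
    rw [Polynomial.eval_eq_sum_range]
    exact hasSum_sum_of_ne_finset_zero fun k hk => by
      rw [Polynomial.coeff_eq_zero_of_natDegree_lt (by
        rw [Finset.mem_range] at hk; omega), zero_mul]

end Initial

/-! ### Membership in the growth spaces and uniqueness of continuations -/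

section Growth

variable {logq ρ : ℂ} {κ : ℚ} {K' d N : ℕ} {lam : ℂ} {f : ℂ → ℂ}

/-- The domain is the union of the dilates ρ^l V: connected by chaining, and by scaling it contains
discs of proportional radius around the points of the spiral. For the growth, B D^n R^(n²) is
compared with the single term of index n / N of the Theta series, where that series is of its
largest order. -/
theorem memH_of_growth (hρ : 1 < ‖ρ‖) (hN : N ≠ 0)
    (hqK : ∀ l : ℤ, qpow logq ((l : ℂ) / K') = ρ ^ ((d : ℤ) * l))
    (hqκ : ‖qpow logq (1 / (κ : ℂ))‖ = ‖ρ‖ ^ N) {Z : Set ℂ} (hZ : Z.Finite)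
    (hmer : ∀ z, z ≠ 0 → MeromorphicAt f z) (han : ∀ z ∈ offSpirals ρ Z, AnalyticAt ℂ f z)
    {V C : Set ℂ} (hVo : IsOpen V) (hVc : IsConnected V) (hVC : V ⊆ C) (hC : IsCompact C)
    (hCU : C ⊆ offSpirals ρ Z) (hlV : lam ∈ V) (hρlV : ρ * lam ∈ V) {B D R : ℝ} (hR : 1 < R)
    (hρR : ‖ρ‖ = R ^ (2 * N)) (hB : 1 ≤ B) (hD : 1 ≤ D)
    (hneg : ∀ l : ℤ, l ≤ 0 → ∀ z ∈ C, ‖f (ρ ^ l * z)‖ ≤ B)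
    (hpos : ∀ l : ℕ, ∀ z ∈ C, ‖f (ρ ^ (l : ℤ) * z)‖ ≤ B * D ^ l * R ^ (l ^ 2)) :
    MemH logq κ K' lam f := by
  have hρ0 : ρ ≠ 0 := norm_pos_iff.1 (zero_lt_one.trans hρ)
  have hρn : 0 < ‖ρ‖ := norm_pos_iff.2 hρ0
  have hR0 : 0 < R := zero_lt_one.trans hR
  have hlam : lam ≠ 0 := (hCU (hVC hlV)).1
  refine ⟨⟨1, one_pos, fun z hz => hmer z (norm_pos_iff.1 hz.1)⟩, spiralHull ρ V, f,
    ⟨isOpen_spiralHull hρ0 hVo, isConnected_spiralHull hρ0 hVc hlV hρlV, ?_, ?_,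
      ⟨1, one_pos, fun z _ _ _ => Eventually.of_forall fun _ => rfl⟩, ?_⟩⟩
  · obtain ⟨ε, hε, hball⟩ := Metric.isOpen_iff.1 hVo lam hlV
    refine ⟨ε / ‖lam‖, by positivity, fun l z _ hz => ?_⟩
    rw [hqK] at hz
    refine Set.mem_iUnion.2 ⟨(d : ℤ) * l, ρ ^ (-((d : ℤ) * l)) * z, hball ?_, ?_⟩
    · have e1 : ρ ^ (-((d : ℤ) * l)) * z - lam =
          ρ ^ (-((d : ℤ) * l)) * (z - lam * ρ ^ ((d : ℤ) * l)) := by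
        have := zpow_ne_zero ((d : ℤ) * l) hρ0
        rw [zpow_neg]; field_simp
      rw [mem_ball_iff_norm, e1, norm_mul, norm_zpow, zpow_neg, inv_mul_lt_iff₀ (by positivity)]
      refine hz.trans_eq ?_
      rw [norm_mul, norm_zpow]
      field_simp
    · simp only
      rw [← mul_assoc, ← zpow_add₀ hρ0, add_neg_cancel, zpow_zero, one_mul]
  · rintro z hz
    obtain ⟨l, c, hc, rfl⟩ := Set.mem_iUnion.1 hz
    exact han _ (zpow_mul_mem_offSpirals hρ0 (hCU (hVC hc)) l)
  · obtain ⟨a, b, η, ha, -, -, hab, -⟩ := exists_compact_bounds hρ hZ hC hCU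
    -- X absorbs both D^n and the error R^(Nn) caused by rounding n / N down. Dividing X^N by a, the
    -- least modulus on C, gives the argument of Θ modulus at least X^N |ρ|^n.
    set X := D * R ^ N with hX
    have hX1 : 1 ≤ X := one_le_mul_of_one_le_of_one_le hD (one_le_pow₀ hR.le)
    have hX0 : 0 < X := zero_lt_one.trans_le hX1
    set L := B * X ^ N * R ^ (N ^ 2) + 1 with hL
    refine ⟨L, X ^ N / a, by positivity, by positivity, fun z hz hz0 => ?_⟩
    obtain ⟨l, c, hc, rfl⟩ := Set.mem_iUnion.1 hz
    rw [hqκ]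
    have hP : 1 < ‖ρ‖ ^ N := one_lt_pow₀ hρ hN
    simp only
    have hx : 0 < X ^ N / a * ‖ρ ^ l * c‖ := by
      have : 0 < ‖ρ ^ l * c‖ := norm_pos_iff.2 hz0
      positivity
    have hcC := hVC hc
    have hLB : B < L := by
      have : B ≤ B * X ^ N * R ^ (N ^ 2) := by
        rw [mul_assoc]
        exact le_mul_of_one_le_right (by linarith)
          (one_le_mul_of_one_le_of_one_le (one_le_pow₀ hX1) (one_le_pow₀ hR.le))
      linarith
    rcases le_or_gt l 0 with hl | hl
    · have h1 := le_norm_qTheta_ofReal hP hx 0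
      simp only [triang_zero, neg_zero, zpow_zero, mul_one] at h1
      calc ‖f (ρ ^ l * c)‖ ≤ B := hneg l hl c hcC
        _ < L := hLB
        _ ≤ _ := le_mul_of_one_le_right (by linarith) h1
    · obtain ⟨n, rfl⟩ : ∃ n : ℕ, l = n := ⟨l.toNat, by omega⟩
      have h1 := le_norm_qTheta_ofReal hP hx (n / N : ℕ)
      have h2 : B * D ^ n * R ^ (n ^ 2) ≤ B * X ^ N * R ^ (N ^ 2) *
          ((‖ρ‖ ^ N) ^ (-triang ((n / N : ℕ) : ℤ)) *
            (X ^ N / a * ‖ρ ^ (n : ℤ) * c‖) ^ ((n / N : ℕ) : ℤ)) := by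
        set i := n / N with hi
        set r := n % N with hr
        have hnir : n = N * i + r := (Nat.div_add_mod n N).symm
        have hrN : r < N := Nat.mod_lt _ (Nat.pos_of_ne_zero hN)
        have h3 : X ^ N * ‖ρ‖ ^ n ≤ X ^ N / a * ‖ρ ^ (n : ℤ) * c‖ := by
          rw [norm_mul, norm_zpow, zpow_natCast, div_mul_eq_mul_div, le_div_iff₀ ha]
          calc X ^ N * ‖ρ‖ ^ n * a ≤ X ^ N * ‖ρ‖ ^ n * ‖c‖ := by
                gcongr; exact (hab c hcC).1
            _ = _ := by ring
        have h4 : (‖ρ‖ ^ N) ^ (-triang (i : ℤ)) = (R ^ (N ^ 2 * (i * (i + 1))))⁻¹ := by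
          rw [hρR, zpow_neg, ← pow_mul, ← zpow_natCast R (2 * N * N), ← zpow_mul,
            ← zpow_natCast R (N ^ 2 * (i * (i + 1)))]
          congr 2
          push_cast
          rw [← triang_mul_two]; ring
        rw [zpow_natCast, h4]
        have h5 : D ^ n * R ^ (n ^ 2) * R ^ (N ^ 2 * (i * (i + 1))) ≤
            X ^ N * R ^ (N ^ 2) * (X ^ N * ‖ρ‖ ^ n) ^ i := by
          have e1 : X ^ N * R ^ (N ^ 2) * (X ^ N * ‖ρ‖ ^ n) ^ i =
              X ^ (N * (i + 1)) * R ^ (N ^ 2 + 2 * N * n * i) := by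
            rw [hρR]
            ring
          have e2 : X ^ n ≤ X ^ (N * (i + 1)) := pow_le_pow_right₀ hX1 (by
            rw [mul_add, mul_one]; omega)
          have e3 : D ^ n * R ^ (n ^ 2) * R ^ (N ^ 2 * (i * (i + 1))) ≤
              X ^ n * R ^ (N ^ 2 + 2 * N * n * i) := by
            rw [hX, mul_pow, mul_assoc, mul_assoc, ← pow_add, ← pow_mul, ← pow_add]
            -- With n = N i + r the difference of the two sides is N² + N r - r², which is
            -- nonnegative because r < N.
            have : n ^ 2 + N ^ 2 * (i * (i + 1)) ≤ N * n + (N ^ 2 + 2 * N * n * i) := by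
              rw [hnir]
              nlinarith
            have := pow_le_pow_right₀ hR.le this
            gcongr
          rw [e1]
          exact e3.trans (by gcongr)
        have hRpos : 0 < R ^ (N ^ 2 * (i * (i + 1))) := by positivity
        calc B * D ^ n * R ^ (n ^ 2)
            = B * (D ^ n * R ^ (n ^ 2) * R ^ (N ^ 2 * (i * (i + 1)))) *
              (R ^ (N ^ 2 * (i * (i + 1))))⁻¹ := by field_simp
          _ ≤ B * (X ^ N * R ^ (N ^ 2) * (X ^ N * ‖ρ‖ ^ n) ^ i) *
              (R ^ (N ^ 2 * (i * (i + 1))))⁻¹ := by gcongr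
          _ ≤ B * (X ^ N * R ^ (N ^ 2) * (X ^ N / a * ‖ρ ^ (n : ℤ) * c‖) ^ i) *
              (R ^ (N ^ 2 * (i * (i + 1))))⁻¹ := by gcongr
          _ = _ := by ring
      have hterm0 : 0 < (‖ρ‖ ^ N) ^ (-triang ((n / N : ℕ) : ℤ)) *
            (X ^ N / a * ‖ρ ^ (n : ℤ) * c‖) ^ ((n / N : ℕ) : ℤ) := by positivity
      calc ‖f (ρ ^ (n : ℤ) * c)‖ ≤ _ := (hpos n c hcC).trans h2
        _ < L * ((‖ρ‖ ^ N) ^ (-triang ((n / N : ℕ) : ℤ)) *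
            (X ^ N / a * ‖ρ ^ (n : ℤ) * c‖) ^ ((n / N : ℕ) : ℤ)) :=
          mul_lt_mul_of_pos_right (by linarith) hterm0
        _ ≤ _ := mul_le_mul_of_nonneg_left h1 (by positivity)

end Growth

theorem qpow_add (logq α β : ℂ) : qpow logq (α + β) = qpow logq α * qpow logq β := by
  rw [qpow, add_mul, Complex.exp_add]; rfl

theorem isOpen_setOf_eventually_nhdsNE {X : Type*} [TopologicalSpace X] [T1Space X] (p : X → Prop) :
    IsOpen {z | ∀ᶠ w in 𝓝[≠] z, p w} := by
  rw [isOpen_iff_mem_nhds]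
  intro z hz
  rw [Set.mem_ofPred_eq, eventually_nhdsWithin_iff, eventually_nhds_iff] at hz
  obtain ⟨u, hu, huo, hzu⟩ := hz
  filter_upwards [huo.mem_nhds hzu] with y hy
  rcases eq_or_ne y z with rfl | hyz
  · exact eventually_nhdsWithin_iff.2 (eventually_nhds_iff.2 ⟨u, hu, huo, hzu⟩)
  · refine nhdsWithin_le_nhds ?_
    filter_upwards [huo.mem_nhds hy, isOpen_ne.mem_nhds hyz] with w hw hwz using hu w hw hwz

section Continuation

variable {logq : ℂ} {κ : ℚ} {K' : ℕ} {lam : ℂ} {f F : ℂ → ℂ} {Ω : Set ℂ}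

theorem IsGrowthContinuation.spiral_mem (h : IsGrowthContinuation logq κ K' lam f Ω F)
    (hlam : lam ≠ 0) (l : ℤ) : qpow logq ((l : ℂ) / K') * lam ∈ Ω := by
  obtain ⟨ε, hε, hd⟩ := h.discs
  have h0 : qpow logq ((l : ℂ) / K') * lam ≠ 0 := mul_ne_zero (Complex.exp_ne_zero _) hlam
  refine hd l _ h0 ?_
  rw [mul_comm lam, sub_self, norm_zero]
  exact mul_pos hε (norm_pos_iff.2 h0)

/-- Two continuations agree: the continuation of a function meromorphic on `ℂ*` is that function. -/
theorem IsGrowthContinuation.eq_of_analyticAt (h : IsGrowthContinuation logq κ K' lam f Ω F)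
    (hmer : ∀ z, z ≠ 0 → MeromorphicAt f z)
    (hsmall : ∀ δ > 0, ∃ z ∈ Ω, z ≠ 0 ∧ ‖z‖ < δ) {w : ℂ} (hw : w ∈ Ω) (hw0 : w ≠ 0)
    (hfw : AnalyticAt ℂ f w) : F w = f w := by
  obtain ⟨δ, hδ, hcont⟩ := h.continues
  -- Since Ω may contain 0, where nothing is known about f, the small points of Ω are put into A by
  -- hand. On the rest of Ω the identity theorem for meromorphic functions gives the alternative A
  -- or B, and connectedness excludes B.
  set A : Set ℂ := {z | ∀ᶠ y in 𝓝[≠] z, F y = f y} ∪ Metric.ball 0 δ ∩ Ω with hA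
  set B : Set ℂ := {z | ∀ᶠ y in 𝓝[≠] z, F y ≠ f y} ∩ {0}ᶜ with hB
  have hdich : ∀ z ∈ Ω, z ≠ 0 → (∀ᶠ y in 𝓝[≠] z, F y = f y) ∨ ∀ᶠ y in 𝓝[≠] z, F y ≠ f y := by
    intro z hz hz0
    have hm : MeromorphicAt (fun y => F y - f y) z :=
      (h.analytic z hz).meromorphicAt.sub (hmer z hz0)
    rcases hm.eventually_eq_zero_or_eventually_ne_zero with h1 | h1
    · exact Or.inl (h1.mono fun y hy => sub_eq_zero.1 hy)
    · exact Or.inr (h1.mono fun y hy => sub_ne_zero.1 hy)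
  have hAo : IsOpen A := (isOpen_setOf_eventually_nhdsNE _).union (Metric.isOpen_ball.inter h.isOpen)
  have hBo : IsOpen B := (isOpen_setOf_eventually_nhdsNE _).inter isOpen_compl_singleton
  have hdisj : ∀ z, z ∈ Ω → z ∈ A → z ∉ B := by
    intro z hzΩ hzA hzB
    have h1 : ∀ᶠ y in 𝓝[≠] z, F y = f y := by
      rcases hzA with h1 | h1
      · exact h1
      · exact hcont z hzΩ hzB.2 (by simpa using h1.1)
    obtain ⟨y, hy1, hy2⟩ := (h1.and hzB.1).exists
    exact hy2 hy1
  have hsub : Ω ⊆ A := by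
    by_contra hcon
    obtain ⟨z₁, hz₁, hz₁A⟩ := Set.not_subset.1 hcon
    have hcover : Ω ⊆ A ∪ B := by
      intro z hz
      rcases eq_or_ne z 0 with rfl | hz0
      · exact Or.inl (Or.inr ⟨Metric.mem_ball_self hδ, hz⟩)
      · rcases hdich z hz hz0 with h1 | h1
        · exact Or.inl (Or.inl h1)
        · exact Or.inr ⟨h1, hz0⟩
    obtain ⟨z₂, hz₂, hz₂0, hz₂δ⟩ := hsmall δ hδ
    obtain ⟨y, hyΩ, hyA, hyB⟩ := h.isConnected.isPreconnected A B hAo hBo hcover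
      ⟨z₂, hz₂, Or.inr ⟨by simpa using hz₂δ, hz₂⟩⟩
      ⟨z₁, hz₁, (hcover hz₁).resolve_left hz₁A⟩
    exact hdisj y hyΩ hyA hyB
  have hev : ∀ᶠ y in 𝓝[≠] w, F y = f y := by
    rcases hsub hw with h1 | h1
    · exact h1
    · exact hcont w hw hw0 (by simpa using h1.1)
  have t1 : Tendsto F (𝓝[≠] w) (𝓝 (F w)) :=
    (h.analytic w hw).continuousAt.tendsto.mono_left nhdsWithin_le_nhds
  have t2 : Tendsto f (𝓝[≠] w) (𝓝 (f w)) := hfw.continuousAt.tendsto.mono_left nhdsWithin_le_nhds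
  exact tendsto_nhds_unique (t1.congr' hev) t2

/-- Every admissible continuation F has the values of f on the spiral: Ω contains points ρ^(d l) lam
of arbitrarily small modulus, so `IsGrowthContinuation.eq_of_analyticAt` applies. The defining
series is then that of `hasSum_spiralLaplace`, with κ / K' = 1 / n. -/
theorem isQLaplace_of_eq_spiralLaplace {ρ : ℂ} {d n : ℕ} {B D R : ℝ} {g : ℂ → ℂ}
    (hρ : 1 < ‖ρ‖) (hd : d ≠ 0) (hn : n ≠ 0) (hR : 1 < R)
    (hρR : ‖ρ‖ = R ^ (2 * (d * n))) (hB : 1 ≤ B) (hD : 1 ≤ D) (hlam : lam ≠ 0)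
    (hf : QuadGrowth (fun l => f (ρ ^ l * lam)) B D R)
    (hqK : ∀ l : ℤ, qpow logq ((l : ℂ) / K') = ρ ^ ((d : ℤ) * l))
    (hqκ : qpow logq (1 / (κ : ℂ)) = ρ ^ (d * n)) (hκ : (κ : ℂ) / K' = 1 / n)
    (hmer : ∀ z, z ≠ 0 → MeromorphicAt f z) (han : ∀ l : ℤ, AnalyticAt ℂ f (ρ ^ l * lam))
    (hH : MemH logq κ K' lam f) (hg : ∀ z, z ≠ 0 → MeromorphicAt g z)
    (hgf : ∃ δ > 0, ∀ z, ‖z‖ < δ → g z = spiralLaplace ρ d n lam f z) :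
    IsQLaplace logq κ K' lam f g := by
  have hρ0 : ρ ≠ 0 := norm_pos_iff.1 (zero_lt_one.trans hρ)
  have hR0 : 0 < R := zero_lt_one.trans hR
  refine ⟨hH, ⟨1, one_pos, fun z hz => hg z (norm_pos_iff.1 hz.1)⟩, fun Ω F hF => ?_⟩
  obtain ⟨δ, hδ, hgδ⟩ := hgf
  have hlampos : 0 < ‖lam‖ := norm_pos_iff.2 hlam
  have hFf : ∀ l : ℤ, F (ρ ^ ((d : ℤ) * l) * lam) = f (ρ ^ ((d : ℤ) * l) * lam) := by
    intro l
    have hmem : ∀ l : ℤ, ρ ^ ((d : ℤ) * l) * lam ∈ Ω := fun l => hqK l ▸ hF.spiral_mem hlam l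
    refine hF.eq_of_analyticAt hmer (fun η hη => ?_) (hmem l)
      (mul_ne_zero (zpow_ne_zero _ hρ0) hlam) (han _)
    obtain ⟨k, hk⟩ := pow_unbounded_of_one_lt (‖lam‖ / η) hρ
    refine ⟨_, hmem (-k), mul_ne_zero (zpow_ne_zero _ hρ0) hlam, ?_⟩
    have h1 : ‖ρ‖ ^ k ≤ ‖ρ‖ ^ (d * k) :=
      pow_le_pow_right₀ hρ.le (Nat.le_mul_of_pos_left k (Nat.pos_of_ne_zero hd))
    rw [norm_mul, norm_zpow, mul_neg, zpow_neg, ← Nat.cast_mul, zpow_natCast,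
      inv_mul_lt_iff₀ (by positivity)]
    rw [div_lt_iff₀ hη] at hk
    exact hk.trans_le (by gcongr)
  set T := D ^ (d * n) * R ^ (2 * (d * n) ^ 2) with hT
  have hT0 : 0 < T := by positivity
  have hev : ∀ᶠ z in 𝓝[≠] (0 : ℂ), ‖z‖ < δ ∧ ‖z‖ < ‖lam‖ / T :=
    nhdsWithin_le_nhds (((isOpen_lt continuous_norm continuous_const).inter
      (isOpen_lt continuous_norm continuous_const)).mem_nhds
      ⟨by simpa using hδ, by simpa using div_pos hlampos hT0⟩)
  filter_upwards [hev, self_mem_nhdsWithin] with z hz hz0 hzl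
  rw [hgδ z hz.1]
  have h1 := hasSum_spiralLaplace hρ hd hn hR hρR hB hD hf hz0 ((lt_div_iff₀ hT0).1 hz.2)
    (fun l => by rw [← hqK]; exact hzl l)
  refine h1.congr_fun fun l => ?_
  rw [hκ, qpow_add, hqκ, hqK, hFf, mul_assoc, mul_div_assoc]

end Continuation

/-! ### The Newton polygon -/

/-- Two consecutive supporting slopes share a vertex. -/
theorem exists_common_maximizer {S : Finset (ℤ × ℕ)} (hS : S.Nonempty) {τ' τ : ℚ} (hτ : τ' < τ)
    (hno : ∀ σ, τ' < σ → σ < τ → ∀ v ∈ S, ∀ w ∈ S, v.2 ≠ w.2 →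
      (∀ u ∈ S, (u.1 : ℚ) - σ * u.2 ≤ v.1 - σ * v.2) →
      ¬ ∀ u ∈ S, (u.1 : ℚ) - σ * u.2 ≤ w.1 - σ * w.2) :
    ∃ v ∈ S, (∀ u ∈ S, (u.1 : ℚ) - τ * u.2 ≤ v.1 - τ * v.2) ∧
      ∀ u ∈ S, (u.1 : ℚ) - τ' * u.2 ≤ v.1 - τ' * v.2 := by
  classical
  obtain ⟨v₀, hv₀, hmax₀⟩ := S.exists_max_image (fun u => (u.1 : ℚ) - τ * u.2) hS
  -- Among the maximizers for τ, one of largest ordinate is taken: as the parameter decreases from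
  -- τ, points of larger ordinate gain, so this is the one that remains maximal longest.
  obtain ⟨v, hv, hvmax⟩ := (S.filter fun u => ∀ x ∈ S, (x.1 : ℚ) - τ * x.2 ≤ u.1 - τ * u.2).exists_max_image
    (fun u => u.2) ⟨v₀, Finset.mem_filter.2 ⟨hv₀, hmax₀⟩⟩
  obtain ⟨hvS, hvτ⟩ := Finset.mem_filter.1 hv
  refine ⟨v, hvS, hvτ, ?_⟩
  by_contra hcon
  push Not at hcon
  set W := S.filter fun u => (v.1 : ℚ) - τ' * v.2 < u.1 - τ' * u.2 with hW
  have hWne : W.Nonempty := by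
    obtain ⟨u, hu, hlt⟩ := hcon
    exact ⟨u, Finset.mem_filter.2 ⟨hu, hlt⟩⟩
  have hj : ∀ u ∈ S, ∀ σ < τ, (v.1 : ℚ) - σ * v.2 < u.1 - σ * u.2 → (0 : ℚ) < u.2 - v.2 := by
    intro u hu σ hσ hlt
    have h1 := hvτ u hu
    by_contra hneg
    nlinarith
  -- If v ceases to be maximal before τ', then w is a point that catches up with it first, at the
  -- parameter σ. There v and w are both maximal with different ordinates, which `hno` forbids. The
  -- value σ = τ is excluded by the choice of v.
  obtain ⟨w, hw, hwmax⟩ := W.exists_max_image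
    (fun u => ((u.1 : ℚ) - v.1) / ((u.2 : ℚ) - v.2)) hWne
  obtain ⟨hwS, hwlt⟩ := Finset.mem_filter.1 hw
  have hwj := hj w hwS τ' hτ hwlt
  set σ := ((w.1 : ℚ) - v.1) / ((w.2 : ℚ) - v.2) with hσ
  have hσeq : σ * ((w.2 : ℚ) - v.2) = w.1 - v.1 := div_mul_cancel₀ _ hwj.ne'
  have hσ1 : τ' < σ := by
    rw [hσ, lt_div_iff₀ hwj]; linarith
  have hσ2 : σ < τ := by
    have h1 := hvτ w hwS
    have h2 : σ ≤ τ := by rw [hσ, div_le_iff₀ hwj]; linarith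
    refine lt_of_le_of_ne h2 fun h3 => ?_
    rw [h3] at hσeq
    have h4 := hvmax w (Finset.mem_filter.2 ⟨hwS, fun x hx => (hvτ x hx).trans (by linarith)⟩)
    have : (w.2 : ℚ) ≤ v.2 := by exact_mod_cast h4
    linarith
  have hvσ : ∀ u ∈ S, (u.1 : ℚ) - σ * u.2 ≤ v.1 - σ * v.2 := by
    intro u hu
    by_contra hlt
    rw [not_le] at hlt
    have huj := hj u hu σ hσ2 hlt
    have huW : u ∈ W := by
      refine Finset.mem_filter.2 ⟨hu, ?_⟩
      nlinarith
    have h1 := hwmax u huW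
    rw [div_le_iff₀ huj] at h1
    linarith
  refine hno σ hσ1 hσ2 v hvS w hwS (fun h => ?_) hvσ fun u hu => (hvσ u hu).trans (by linarith)
  rw [h] at hwj
  simp at hwj

/-- The support of a `q`-difference operator: the pairs `(i, j)` such that the coefficient of
`z ^ j σ_q ^ i` does not vanish. -/
def QDiffOp.pairs (P : QDiffOp) : Finset (ℤ × ℕ) :=
  P.support.biUnion fun i => (P i).support.map ⟨fun j => (i, j), fun _ _ h => (Prod.mk.inj h).2⟩

theorem QDiffOp.mem_pairs {P : QDiffOp} {x : ℤ × ℕ} : x ∈ P.pairs ↔ (P x.1).coeff x.2 ≠ 0 := by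
  simp only [QDiffOp.pairs, Finset.mem_biUnion, Finsupp.mem_support_iff, Finset.mem_map,
    Polynomial.mem_support_iff]
  constructor
  · rintro ⟨i, _, j, hj, rfl⟩
    exact hj
  · intro h
    exact ⟨x.1, fun h0 => h (by rw [h0, Polynomial.coeff_zero]), x.2, h, rfl⟩

theorem QDiffOp.sum_eq_sum_pairs {M : Type*} [AddCommMonoid M] (P : QDiffOp)
    (g : ℤ → ℕ → ℂ → M) :
    (P.sum fun i b => b.sum fun j c => g i j c) =
      ∑ x ∈ P.pairs, g x.1 x.2 ((P x.1).coeff x.2) := by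
  classical
  rw [QDiffOp.pairs, Finset.sum_biUnion]
  · refine Finset.sum_congr rfl fun i _ => ?_
    rw [Finset.sum_map]
    rfl
  · intro i _ i' _ hne
    rw [Function.onFun, Finset.disjoint_left]
    intro x hx hx'
    obtain ⟨_, _, rfl⟩ := Finset.mem_map.1 hx
    obtain ⟨_, _, h⟩ := Finset.mem_map.1 hx'
    exact hne (Prod.mk.inj h).1.symm

/-- Maximising i - σ j means supporting the polygon from below by a line of slope 1/σ. Two
maximizers of distinct ordinates lie on that line and have distinct abscissas. The half-plane above
the line is convex and contains the generating points, hence the whole polygon. -/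
theorem QDiffOp.isSlope_inv {P : QDiffOp} {σ : ℚ} (hσ : 0 < σ) {v w : ℤ × ℕ} (hv : v ∈ P.pairs)
    (hw : w ∈ P.pairs) (hne : v.2 ≠ w.2)
    (hvm : ∀ u ∈ P.pairs, (u.1 : ℚ) - σ * u.2 ≤ v.1 - σ * v.2)
    (hwm : ∀ u ∈ P.pairs, (u.1 : ℚ) - σ * u.2 ≤ w.1 - σ * w.2) : P.IsSlope σ⁻¹ := by
  wlog hlt : v.2 < w.2 generalizing v w
  · exact this hw hv hne.symm hwm hvm (by omega)
  have hmem : ∀ u ∈ P.pairs, ((u.1 : ℝ), (u.2 : ℝ)) ∈ P.newtonPolygon := by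
    intro u hu
    rw [QDiffOp.mem_pairs] at hu
    refine subset_convexHull ℝ _ ⟨u.1, u.2, fun h0 => hu (by rw [h0, Polynomial.coeff_zero]), ?_, ?_⟩
    · exact_mod_cast Polynomial.natTrailingDegree_le_of_ne_zero hu
    · simp
  have heq : (w.1 : ℚ) - v.1 = σ * (w.2 - v.2) := by
    have h1 := hvm w hw
    have h2 := hwm v hv
    linarith
  have hσR : (0 : ℝ) < σ := by exact_mod_cast hσ
  have heqR : (w.1 : ℝ) - v.1 = σ * (w.2 - v.2) := by exact_mod_cast heq
  have hltR : (v.2 : ℝ) < w.2 := by exact_mod_cast hlt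
  refine ⟨_, hmem v hv, _, hmem w hw, ?_, ?_, ?_⟩
  · have : 0 < (σ : ℝ) * (w.2 - v.2) := mul_pos hσR (by linarith)
    simp only
    linarith
  · simp only
    rw [heqR]
    push_cast
    field_simp
  · have hconv : Convex ℝ {p : ℝ × ℝ | ((σ⁻¹ : ℚ) : ℝ) * p.1 - p.2 ≤
        ((σ⁻¹ : ℚ) : ℝ) * v.1 - v.2} := by
      refine convex_halfSpace_le ⟨fun x y => ?_, fun a x => ?_⟩ _
      · simp only [Prod.fst_add, Prod.snd_add]; ring
      · simp only [Prod.smul_fst, Prod.smul_snd, smul_eq_mul]; ring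
    have hsub : P.newtonPolygon ⊆ {p : ℝ × ℝ | ((σ⁻¹ : ℚ) : ℝ) * p.1 - p.2 ≤
        ((σ⁻¹ : ℚ) : ℝ) * v.1 - v.2} := by
      refine convexHull_min ?_ hconv
      rintro _ ⟨i, j, hi, hj, rfl⟩
      have hu : (i, (P i).natTrailingDegree) ∈ P.pairs := by
        rw [QDiffOp.mem_pairs]
        exact Polynomial.coeff_natTrailingDegree_ne_zero.2 hi
      have h1 := hvm _ hu
      have h1R : (i : ℝ) - σ * ((P i).natTrailingDegree : ℝ) ≤ v.1 - σ * v.2 := by exact_mod_cast h1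
      have hjR : ((P i).natTrailingDegree : ℝ) ≤ j := by exact_mod_cast hj
      rw [Set.mem_ofPred_eq]
      push_cast
      have h2 : (i : ℝ) - σ * j ≤ v.1 - σ * v.2 := by nlinarith
      have h3 := mul_le_mul_of_nonneg_left h2 (inv_pos.2 hσR).le
      have h4 : (σ : ℝ)⁻¹ * ((i : ℝ) - σ * j) = (σ : ℝ)⁻¹ * i - j := by field_simp
      have h5 : (σ : ℝ)⁻¹ * ((v.1 : ℝ) - σ * v.2) = (σ : ℝ)⁻¹ * v.1 - v.2 := by field_simp
      rw [h4, h5] at h3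
      exact h3
    intro p hp
    have := hsub hp
    rw [Set.mem_ofPred_eq] at this
    simp only
    linarith

theorem QDiffOp.pairs_nonempty {P : QDiffOp} {s : ℚ} (h : P.IsSlope s) : P.pairs.Nonempty := by
  obtain ⟨x, hx, -⟩ := h
  obtain ⟨_, i, j, hi, -, -⟩ := convexHull_nonempty_iff.1 ⟨x, hx⟩
  exact ⟨(i, (P i).natTrailingDegree), QDiffOp.mem_pairs.2
    (Polynomial.coeff_natTrailingDegree_ne_zero.2 hi)⟩

/-! ### The successive Borel-Laplace stages -/

/-- The coefficients of the operator conjugated by the Borel transform of total order `K / T`. -/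
def stageCoeff (ρ : ℂ) (c : ℤ × ℕ → ℂ) (T : ℕ) (s : ℤ × ℕ) : ℂ :=
  c s * ρ ^ (-(T : ℤ) * triang ((s.2 : ℤ) - 1))

/-- The exponents of the operator conjugated by the Borel transform of total order `K / T`. -/
def stageShift (K T : ℕ) (s : ℤ × ℕ) : ℤ := K * s.1 - T * s.2

/-- The coefficient of the shift by `ρ ^ (stageShift K T v)`. -/
def stageTop (ρ : ℂ) (S : Finset (ℤ × ℕ)) (c : ℤ × ℕ → ℂ) (K T : ℕ) (v : ℤ × ℕ) : Polynomial ℂ :=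
  topPoly S (stageCoeff ρ c T) Prod.snd (stageShift K T) (stageShift K T v)

/-- A meromorphic solution on `ℂ*` of the conjugated equation, analytic off the spirals through `Z`
and bounded near `0` along the dilates of `C`. -/
structure IsStage (ρ : ℂ) (S : Finset (ℤ × ℕ)) (c : ℤ × ℕ → ℂ) (a : Polynomial ℂ) (Z C : Set ℂ)
    (K T : ℕ) (f : ℂ → ℂ) : Prop where
  mer : ∀ z, z ≠ 0 → MeromorphicAt f z
  an : ∀ z ∈ offSpirals ρ Z, AnalyticAt ℂ f z
  eq : ∀ z ∈ offSpirals ρ Z, shiftOp ρ S (stageCoeff ρ c T) Prod.snd (stageShift K T) f z =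
    (twistPoly ρ (-(T : ℤ)) a).eval z
  bdd : ∃ (l₀ : ℤ) (B : ℝ), ∀ l ≤ l₀, ∀ x ∈ C, ‖f (ρ ^ l * x)‖ ≤ B

section Stage

variable {ρ : ℂ} {S : Finset (ℤ × ℕ)} {c : ℤ × ℕ → ℂ} {a : Polynomial ℂ} {Z V C : Set ℂ}
  {K T T' d n : ℕ} {v : ℤ × ℕ}

/-- Points with equal ordinate and equal shift coincide because K ≠ 0, so nothing can cancel the
contribution of v. -/
theorem coeff_stageTop (hK : K ≠ 0) (hv : v ∈ S) :
    (stageTop ρ S c K T v).coeff v.2 = stageCoeff ρ c T v := by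
  rw [stageTop, topPoly, Polynomial.finsetSum_coeff, Finset.sum_eq_single v]
  · simp
  · intro s hs hne
    obtain ⟨-, hsv⟩ := Finset.mem_filter.1 hs
    rw [Polynomial.coeff_C_mul_X_pow, if_neg]
    intro h
    apply hne
    have hK' : (K : ℤ) ≠ 0 := by exact_mod_cast hK
    simp only [stageShift, h, sub_left_inj] at hsv
    exact Prod.ext (mul_left_cancel₀ hK' hsv) h.symm
  · intro h
    exact (h (Finset.mem_filter.2 ⟨hv, rfl⟩)).elim

theorem stageCoeff_ne_zero (hρ : ρ ≠ 0) (hc : c v ≠ 0) : stageCoeff ρ c T v ≠ 0 :=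
  mul_ne_zero hc (zpow_ne_zero _ hρ)

theorem stageTop_ne_zero (hρ : ρ ≠ 0) (hK : K ≠ 0) (hv : v ∈ S) (hc : c v ≠ 0) :
    stageTop ρ S c K T v ≠ 0 := fun h => by
  have := coeff_stageTop (ρ := ρ) (c := c) (T := T) hK hv
  rw [h, Polynomial.coeff_zero] at this
  exact stageCoeff_ne_zero hρ hc this.symm

/-- A point with the same shift as v at level T and no larger shift at level T' < T satisfies (T -
T') j ≤ (T - T') v.2. Thus v is the upper end of its edge. -/
theorem natDegree_stageTop (hρ : ρ ≠ 0) (hK : K ≠ 0) (hv : v ∈ S) (hc : c v ≠ 0) (hT : T' < T)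
    (hv' : ∀ s ∈ S, stageShift K T' s ≤ stageShift K T' v) :
    (stageTop ρ S c K T v).natDegree = v.2 := by
  refine le_antisymm (Polynomial.natDegree_sum_le_of_forall_le _ _ fun s hs => ?_)
    (Polynomial.le_natDegree_of_ne_zero ?_)
  · obtain ⟨hsS, hsv⟩ := Finset.mem_filter.1 hs
    refine (Polynomial.natDegree_C_mul_X_pow_le _ _).trans ?_
    have h1 := hv' s hsS
    simp only [stageShift] at h1 hsv
    have h2 : (0 : ℤ) < T - T' := by omega
    have h3 : ((T : ℤ) - T') * s.2 ≤ ((T : ℤ) - T') * v.2 := by linarith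
    exact_mod_cast le_of_mul_le_mul_left h3 h2
  · rw [coeff_stageTop hK hv]
    exact stageCoeff_ne_zero hρ hc

theorem exists_pow_eq {x : ℝ} (hx : 1 < x) {N : ℕ} (hN : N ≠ 0) : ∃ R : ℝ, 1 < R ∧ x = R ^ N :=
  ⟨x ^ ((N : ℝ)⁻¹), Real.one_lt_rpow hx (by positivity),
    (Real.rpow_inv_natCast_pow (by linarith) hN).symm⟩

/-- One step of the summation: a solution at level `T` has a Laplace transform, which continues to a
solution at level `T'`. -/
theorem IsStage.exists_laplace {f : ℂ → ℂ} (hf : IsStage ρ S c a Z C K T f) (hρ : 1 < ‖ρ‖)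
    (hZ : Z.Finite) (hc : ∀ s ∈ S, c s ≠ 0) (hK : K ≠ 0) (hd : d ≠ 0) (hn : n ≠ 0)
    (hT : T = T' + d * n) (hdvd : ∀ s ∈ S, (d : ℤ) ∣ stageShift K T s) (hv : v ∈ S)
    (hvT : ∀ s ∈ S, stageShift K T s ≤ stageShift K T v)
    (hvT' : ∀ s ∈ S, stageShift K T' s ≤ stageShift K T' v)
    (hroots : ∀ w, (stageTop ρ S c K T v).IsRoot w → w ∈ Z)
    (hroots' : ∀ w, (stageTop ρ S c K T' v).IsRoot w → w ∈ Z)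
    (hVo : IsOpen V) (hVc : IsConnected V) (hVC : V ⊆ C) (hC : IsCompact C)
    (hCU : C ⊆ offSpirals ρ Z) {lam : ℂ} (hlV : lam ∈ V) (hρlV : ρ * lam ∈ V) (hlZ : -lam ∈ Z)
    {logq : ℂ} {κ : ℚ} {K' : ℕ}
    (hqK : ∀ l : ℤ, qpow logq ((l : ℂ) / K') = ρ ^ ((d : ℤ) * l))
    (hqκ : qpow logq (1 / (κ : ℂ)) = ρ ^ (d * n)) (hκ : (κ : ℂ) / K' = 1 / n) :
    ∃ g : ℂ → ℂ, IsStage ρ S c a Z C K T' g ∧ IsQLaplace logq κ K' lam f g ∧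
      ∀ K'' d'' : ℕ, (∀ l : ℤ, qpow logq ((l : ℂ) / K'') = ρ ^ ((d'' : ℤ) * l)) →
        MemH logq κ K'' lam f := by
  have hρ0 : ρ ≠ 0 := norm_pos_iff.1 (zero_lt_one.trans hρ)
  have hdn : d * n ≠ 0 := mul_ne_zero hd hn
  have hlU : lam ∈ offSpirals ρ Z := hCU (hVC hlV)
  have hTlt : T' < T := by omega
  have hTZ : (T : ℤ) = T' + d * n := by exact_mod_cast hT
  -- With |ρ| = R^(2dn), the growth |ρ|^(l²/(2dn)) reads R^(l²), so only integer exponents occur.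
  obtain ⟨R, hR, hρR⟩ := exists_pow_eq hρ (mul_ne_zero two_ne_zero hdn)
  obtain ⟨l₀, B₀, hB₀⟩ := hf.bdd
  obtain ⟨B, hB, hneg⟩ := exists_bound_zpow_mul hC
    (fun z hz l => zpow_mul_mem_offSpirals hρ0 (hCU hz) l)
    (fun z hz => (hf.an z hz).continuousAt.continuousWithinAt) hB₀ 0
  obtain ⟨D, hD, hpos⟩ := exists_growth_bound (e := stageShift K T v) hρ hZ hvT
    -- As the degree is v.2 and T = T' + dn, the required inequality between shifts at level T is
    -- exactly the maximality of v at level T'.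
    (stageTop_ne_zero hρ0 hK hv (hc v hv)) hroots hR hρR (fun s hs => by
      have h1 := hvT' s hs
      have h2 := natDegree_stageTop hρ0 hK hv (hc v hv) hTlt hvT'
      rw [stageTop] at h2
      rw [h2]
      simp only [stageShift] at h1 ⊢
      push_cast
      rw [hTZ]
      linarith) hf.eq hC hCU hB hneg
  have hQ : QuadGrowth (fun l => f (ρ ^ l * lam)) B D R :=
    ⟨fun l hl => hneg l hl lam (hVC hlV), fun l => hpos l lam (hVC hlV)⟩
  -- The spacing is left free because in the last step the Laplace transform uses q^(1/n), while
  -- membership is also asserted for the finer spacing q^(1/K).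
  have hMemH : ∀ K'' d'' : ℕ, (∀ l : ℤ, qpow logq ((l : ℂ) / K'') = ρ ^ ((d'' : ℤ) * l)) →
      MemH logq κ K'' lam f := fun K'' d'' h =>
    memH_of_growth hρ hdn h (by rw [hqκ, norm_pow]) hZ hf.mer hf.an hVo hVc hVC hC hCU hlV hρlV hR
      hρR hB hD hneg hpos
  obtain ⟨δ₁, hδ₁, heq⟩ := exists_shiftOp_spiralLaplace (c := c) (t := -(T : ℤ)) (A := a)
    (j := Prod.snd) hρ hd hn hR hρR hB hD hQ hlU hlZ hdvd hf.eq
  have e1 : (fun s : ℤ × ℕ => c s * ρ ^ ((-(T : ℤ) + d * n) * triang ((s.2 : ℤ) - 1))) =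
      stageCoeff ρ c T' := by
    funext s
    rw [stageCoeff, hTZ]
    congr 3; ring
  have e2 : (fun s : ℤ × ℕ => stageShift K T s + d * n * s.2) = stageShift K T' := by
    funext s
    simp only [stageShift, hTZ]
    ring
  have e3 : -(T : ℤ) + d * n = -(T' : ℤ) := by rw [hTZ]; ring
  rw [e1, e2, e3] at heq
  set Tr := D ^ (d * n) * R ^ (2 * (d * n) ^ 2) with hTr
  have hTr0 : 0 < Tr := zero_lt_one.trans_le (one_le_pow_mul_pow hD hR)
  have hlam0 : 0 < ‖lam‖ := norm_pos_iff.2 hlU.1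
  set δ := min δ₁ (‖lam‖ / Tr) with hδ
  have hδ0 : 0 < δ := lt_min hδ₁ (by positivity)
  have hzs : ∀ z : ℂ, ‖z‖ < δ → ‖z‖ * Tr < ‖lam‖ := fun z hz =>
    (lt_div_iff₀ hTr0).1 (hz.trans_le (min_le_right _ _))
  have hzl : ∀ z ∈ offSpirals ρ Z, ∀ l : ℤ, z ≠ -(ρ ^ ((d : ℤ) * l) * lam) := fun z hz l h =>
    hz.2 _ hlZ ((d : ℤ) * l) (by rw [h, mul_neg])
  obtain ⟨g, ⟨δ', hδ', hgδ⟩, hgmer, hgan, hgeq⟩ := exists_continuation (e := stageShift K T' v)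
    (f₀ := spiralLaplace ρ d n lam f) hρ hZ hvT' hroots' hδ0
    (fun z hz hzδ => meromorphicAt_spiralLaplace hρ hd hn hR hρR hB hD hQ hz (hzs z hzδ))
    (fun z hz hzδ => analyticAt_spiralLaplace hρ hd hn hR hρR hB hD hQ hz.1 (hzs z hzδ) (hzl z hz))
    (fun z hz hzδ => heq z hz (hzδ.trans_le (min_le_left _ _)))
  refine ⟨g, ⟨hgmer, hgan, hgeq, ?_⟩, ?_, hMemH⟩
  · obtain ⟨l₁, B₁, hB₁⟩ := exists_bound_spiralLaplace hρ hd hn hR hρR hB hD hlU.1 hQ hZ hlZ hC hCU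
    obtain ⟨_, b, _, ha', hab, -, hCab, -⟩ := exists_compact_bounds hρ hZ hC hCU
    have hb : 0 < b := ha'.trans_le hab
    obtain ⟨k, hk⟩ := pow_unbounded_of_one_lt (b / δ') hρ
    refine ⟨min l₁ (-k), B₁, fun l hl x hx => ?_⟩
    rw [hgδ]
    · exact hB₁ l (hl.trans (min_le_left _ _)) x hx
    · have h1 : ‖ρ‖ ^ l ≤ ‖ρ‖ ^ (-(k : ℤ)) :=
        zpow_le_zpow_right₀ hρ.le (hl.trans (min_le_right _ _))
      rw [zpow_neg, zpow_natCast] at h1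
      rw [div_lt_iff₀ hδ'] at hk
      have hρk : 0 < ‖ρ‖ ^ k := by positivity
      rw [norm_mul, norm_zpow]
      calc ‖ρ‖ ^ l * ‖x‖ ≤ (‖ρ‖ ^ k)⁻¹ * b := by
            gcongr
            exact (hCab x hx).2
        _ < (‖ρ‖ ^ k)⁻¹ * (‖ρ‖ ^ k * δ') := by gcongr
        _ = δ' := by field_simp
  · exact isQLaplace_of_eq_spiralLaplace hρ hd hn hR hρR hB hD hlU.1 hQ hqK hqκ hκ hf.mer
      (fun l => hf.an _ (zpow_mul_mem_offSpirals hρ0 hlU l)) (hMemH K' d hqK) hgmer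
      ⟨δ', hδ', hgδ⟩

/-- The formal solution, after the Borel transforms, converges and continues to a solution at the
first level. -/
theorem exists_initial_stage (hρ : 1 < ‖ρ‖)
    (hZ : Z.Finite) (hc : ∀ s ∈ S, c s ≠ 0) (hK : K ≠ 0) (hv : v ∈ S)
    (hvT : ∀ s ∈ S, stageShift K T s ≤ stageShift K T v) (hvj : ∀ s ∈ S, v.2 ≤ s.2)
    (hroots : ∀ w, (stageTop ρ S c K T v).IsRoot w → w ∈ Z) (hC : IsCompact C)
    (hCU : C ⊆ offSpirals ρ Z) {b : ℕ → ℂ}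
    (hrec : ∀ k : ℕ, ∑ s ∈ S, (if s.2 ≤ k then
      c s * ρ ^ ((K : ℤ) * s.1 * ((k - s.2 : ℕ) : ℤ)) * b (k - s.2) else 0) = a.coeff k) :
    ∃ f : ℂ → ℂ, IsStage ρ S c a Z C K T f ∧ ∀ᶠ z in 𝓝 (0 : ℂ), HasSum
      (fun k : ℕ => b k * ρ ^ (-(T : ℤ) * triang ((k : ℤ) - 1)) * z ^ k) (f z) := by
  have hρ0 : ρ ≠ 0 := norm_pos_iff.1 (zero_lt_one.trans hρ)
  set β : ℕ → ℂ := fun k => b k * ρ ^ (-(T : ℤ) * triang ((k : ℤ) - 1)) with hβ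
  have hrec' : ∀ k : ℕ, ∑ s ∈ S, (if s.2 ≤ k then
      stageCoeff ρ c T s * ρ ^ (stageShift K T s * ((k - s.2 : ℕ) : ℤ)) * β (k - s.2) else 0) =
      (twistPoly ρ (-(T : ℤ)) a).coeff k := by
    intro k
    have h1 : (twistPoly ρ (-(T : ℤ)) a).coeff k =
        a.coeff k * ρ ^ (-(T : ℤ) * triang ((k : ℤ) - 1)) := by
      rw [twistPoly, Polynomial.finsetSum_coeff]
      simp only [Polynomial.coeff_C_mul_X_pow]
      rw [Finset.sum_ite_eq]
      split_ifs with h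
      · rfl
      · rw [Polynomial.coeff_eq_zero_of_natDegree_lt (by rw [Finset.mem_range] at h; omega),
          zero_mul]
    rw [h1, ← hrec, Finset.sum_mul]
    refine Finset.sum_congr rfl fun s _ => ?_
    split_ifs with h
    · obtain ⟨l, rfl⟩ := Nat.exists_eq_add_of_le h
      -- The triangular number of a sum splits with the cross term s.2 * l, and this cross term is
      -- what turns the shift K s.1 into K s.1 - T s.2.
      have h2 : -(T : ℤ) * triang (((s.2 + l : ℕ) : ℤ) - 1) =
          -(T : ℤ) * triang ((s.2 : ℤ) - 1) + -(T : ℤ) * s.2 * l +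
            -(T : ℤ) * triang ((l : ℤ) - 1) := by
        rw [show (((s.2 + l : ℕ) : ℤ) - 1) = (s.2 - 1) + l by push_cast; ring, triang_add,
          triang_sub_one (l : ℤ)]
        ring
      have h3 : stageShift K T s * (l : ℤ) = (K : ℤ) * s.1 * l + -(T : ℤ) * s.2 * l := by
        rw [stageShift]; ring
      rw [Nat.add_sub_cancel_left, hβ, stageCoeff, h2, h3, zpow_add₀ hρ0, zpow_add₀ hρ0,
        zpow_add₀ hρ0]
      ring
    · rw [zero_mul]
  obtain ⟨B, D, hB, hD, hbd⟩ := exists_geometric_bound hρ hv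
    (stageCoeff_ne_zero (T := T) hρ0 (hc v hv)) hvj hvT (fun s hs hne hj => by
      refine lt_of_le_of_ne (hvT s hs) fun h => hne ?_
      have hK' : (K : ℤ) ≠ 0 := by exact_mod_cast hK
      simp only [stageShift, hj, sub_left_inj] at h
      exact Prod.ext (mul_left_cancel₀ hK' h) hj) hrec'
  obtain ⟨f₀, δ, hδ, hsum, han, hbound, heq⟩ := exists_sum_of_geometric_bound hρ0 hB hD hbd hrec'
  obtain ⟨f, ⟨δ', hδ', hfδ⟩, hfmer, hfan, hfeq⟩ := exists_continuation (e := stageShift K T v)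
    hρ hZ hvT hroots hδ (fun z _ hzδ => (han z hzδ).meromorphicAt)
    (fun z _ hzδ => han z hzδ) (fun z _ hzδ => heq z hzδ)
  refine ⟨f, ⟨hfmer, hfan, hfeq, ?_⟩, ?_⟩
  · obtain ⟨_, b', _, ha', hab, -, hCab, -⟩ := exists_compact_bounds hρ hZ hC hCU
    have hb : 0 < b' := ha'.trans_le hab
    have hmin : 0 < min δ δ' := lt_min hδ hδ'
    obtain ⟨k, hk⟩ := pow_unbounded_of_one_lt (b' / min δ δ') hρ
    refine ⟨-k, 2 * B, fun l hl x hx => ?_⟩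
    have hsmall : ‖ρ ^ l * x‖ < min δ δ' := by
      have h1 : ‖ρ‖ ^ l ≤ ‖ρ‖ ^ (-(k : ℤ)) := zpow_le_zpow_right₀ hρ.le hl
      rw [zpow_neg, zpow_natCast] at h1
      rw [div_lt_iff₀ hmin] at hk
      have hρk : 0 < ‖ρ‖ ^ k := pow_pos (zero_lt_one.trans hρ) k
      rw [norm_mul, norm_zpow]
      calc ‖ρ‖ ^ l * ‖x‖ ≤ (‖ρ‖ ^ k)⁻¹ * b' := by
            gcongr
            exact (hCab x hx).2
        _ < (‖ρ‖ ^ k)⁻¹ * (‖ρ‖ ^ k * min δ δ') := by gcongr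
        _ = min δ δ' := by field_simp
    rw [hfδ _ (hsmall.trans_le (min_le_right _ _))]
    exact hbound _ (hsmall.trans_le (min_le_left _ _))
  · have hopen : IsOpen {z : ℂ | ‖z‖ < min δ δ'} := isOpen_lt continuous_norm continuous_const
    filter_upwards [hopen.mem_nhds (show ‖(0 : ℂ)‖ < min δ δ' by simpa using ⟨hδ, hδ'⟩)] with z hz
    have hz : ‖z‖ < min δ δ' := hz
    rw [hfδ z (hz.trans_le (min_le_right _ _))]
    exact hsum z (hz.trans_le (min_le_left _ _))

end Stage

/-! ### Reduction to powers of `ρ = q ^ (1 / K)` -/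

theorem qpow_int_mul (logq α : ℂ) (l : ℤ) : qpow logq ((l : ℂ) * α) = qpow logq α ^ l := by
  rw [qpow, mul_assoc, Complex.exp_int_mul]; rfl

/-- Borel multipliers are exponentials, so composition adds the inverses of the orders. -/
theorem coeff_foldr_qBorel (logq : ℂ) (L : List ℚ) (h : PowerSeries ℂ) (k : ℕ) :
    PowerSeries.coeff k (L.foldr (qBorel logq) h) = PowerSeries.coeff k h *
      qpow logq (-((k : ℂ) * ((k : ℂ) - 1)) / 2 * ((L.map fun x : ℚ => x⁻¹).sum : ℚ)) := by
  induction L with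
  | nil => simp [qpow]
  | cons x L ih =>
    rw [List.foldr_cons, qBorel, PowerSeries.coeff_mk, ih, mul_assoc, ← qpow_add, List.map_cons,
      List.sum_cons]
    congr 2
    push_cast
    ring

theorem coeff_qBorelIter (logq : ℂ) {r : ℕ} (κ : Fin r → ℚ) (h : PowerSeries ℂ) (k : ℕ) :
    PowerSeries.coeff k (qBorelIter logq κ h) = PowerSeries.coeff k h *
      qpow logq (-((k : ℂ) * ((k : ℂ) - 1)) / 2 * ((∑ i, (κ i)⁻¹ : ℚ) : ℂ)) := by
  rw [qBorelIter, coeff_foldr_qBorel, List.map_ofFn, List.sum_ofFn]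
  rfl

theorem QDiffOp.onFun_eq_shiftOp (P : QDiffOp) {ρ q : ℂ} {K : ℕ} (hρq : ρ ^ K = q) (f : ℂ → ℂ)
    (z : ℂ) : P.onFun q f z = shiftOp ρ P.pairs (fun s => (P s.1).coeff s.2) Prod.snd
      (fun s => K * s.1) f z := by
  have h := P.sum_eq_sum_pairs fun i j c => c * z ^ j * f (q ^ i * z)
  rw [shiftOp, QDiffOp.onFun]
  simp only [zpow_mul, zpow_natCast, hρq]
  rw [← h]
  refine Finset.sum_congr rfl fun i _ => ?_
  dsimp only
  rw [Polynomial.eval_eq_sum, Polynomial.sum_def, Polynomial.sum_def, Finset.sum_mul]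

theorem Polynomial.coeff_coe_mul_rescale (b : Polynomial ℂ) (h : PowerSeries ℂ) (x : ℂ) (k : ℕ) :
    PowerSeries.coeff k ((b : PowerSeries ℂ) * PowerSeries.rescale x h) =
      b.sum fun j c => if j ≤ k then c * x ^ (k - j) * PowerSeries.coeff (k - j) h else 0 := by
  rw [PowerSeries.coeff_mul, Finset.Nat.sum_antidiagonal_eq_sum_range_succ_mk, Polynomial.sum_def,
    ← Finset.sum_filter]
  simp only [PowerSeries.coeff_rescale, Polynomial.coeff_coe, mul_assoc]
  symm
  refine Finset.sum_subset (fun j hj => ?_) fun j hj hj' => ?_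
  · have := (Finset.mem_filter.1 hj).2
    exact Finset.mem_range.2 (by omega)
  · have : b.coeff j = 0 := by
      by_contra h0
      refine hj' (Finset.mem_filter.2 ⟨Polynomial.mem_support_iff.2 h0, ?_⟩)
      have := Finset.mem_range.1 hj
      omega
    rw [this, zero_mul]

theorem QDiffOp.coeff_onSeries (P : QDiffOp) {ρ q : ℂ} {K : ℕ} (hρq : ρ ^ K = q)
    (h : PowerSeries ℂ) (k : ℕ) : PowerSeries.coeff k (P.onSeries q h) =
      ∑ s ∈ P.pairs, if s.2 ≤ k then (P s.1).coeff s.2 *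
        ρ ^ ((K : ℤ) * s.1 * ((k - s.2 : ℕ) : ℤ)) * PowerSeries.coeff (k - s.2) h else 0 := by
  have h1 := P.sum_eq_sum_pairs fun i j c => if j ≤ k then
    c * (q ^ i) ^ (k - j) * PowerSeries.coeff (k - j) h else 0
  simp only [zpow_mul, zpow_natCast, hρq]
  rw [← h1, QDiffOp.onSeries, Finsupp.sum, map_sum]
  exact Finset.sum_congr rfl fun i _ => Polynomial.coeff_coe_mul_rescale _ _ _ _

/-! ### Inverse slopes and vertices of the Newton polygon. -/

/-- The inverses of the slopes, extended by `0`. -/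
def invSlope {s : ℕ} (μ : Fin (s + 1) → ℚ) (i : ℕ) : ℚ :=
  if h : i < s + 1 then (μ ⟨i, h⟩)⁻¹ else 0

theorem inv_kappa {s : ℕ} (μ : Fin (s + 1) → ℚ) (i : Fin (s + 1)) :
    (kappa μ i)⁻¹ = invSlope μ i - invSlope μ (i + 1) := by
  rw [kappa, inv_inv, invSlope, dif_pos i.2]
  rfl

section Slopes

variable {P : QDiffOp} {s : ℕ} {μ : Fin (s + 1) → ℚ}

theorem slope_pos (hslopes : Set.range μ = P.positiveSlopes) (i : Fin (s + 1)) : 0 < μ i := by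
  have : μ i ∈ P.positiveSlopes := hslopes ▸ Set.mem_range_self i
  exact this.1

theorem invSlope_succ_lt (hμ : StrictMono μ) (hslopes : Set.range μ = P.positiveSlopes) {i : ℕ}
    (hi : i < s + 1) : invSlope μ (i + 1) < invSlope μ i := by
  rw [invSlope, invSlope, dif_pos hi]
  split_ifs with h
  · exact inv_strictAnti₀ (slope_pos hslopes _) (hμ (Fin.mk_lt_mk.2 (Nat.lt_succ_self i)))
  · exact inv_pos.2 (slope_pos hslopes _)

theorem invSlope_antitone (hμ : StrictMono μ) (hslopes : Set.range μ = P.positiveSlopes) :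
    Antitone (invSlope μ) := by
  refine antitone_nat_of_succ_le fun i => ?_
  rcases lt_or_ge i (s + 1) with hi | hi
  · exact (invSlope_succ_lt hμ hslopes hi).le
  · rw [invSlope, invSlope, dif_neg (by omega), dif_neg (by omega)]

theorem eq_invSlope_of_maximizers (hslopes : Set.range μ = P.positiveSlopes) {σ : ℚ} (hσ : 0 < σ)
    {v w : ℤ × ℕ} (hv : v ∈ P.pairs) (hw : w ∈ P.pairs) (hne : v.2 ≠ w.2)
    (hvm : ∀ u ∈ P.pairs, (u.1 : ℚ) - σ * u.2 ≤ v.1 - σ * v.2)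
    (hwm : ∀ u ∈ P.pairs, (u.1 : ℚ) - σ * u.2 ≤ w.1 - σ * w.2) : ∃ i ≤ s, σ = invSlope μ i := by
  have h1 : σ⁻¹ ∈ P.positiveSlopes := ⟨inv_pos.2 hσ, QDiffOp.isSlope_inv hσ hv hw hne hvm hwm⟩
  rw [← hslopes] at h1
  obtain ⟨i, hi⟩ := h1
  refine ⟨i, by omega, ?_⟩
  rw [invSlope, dif_pos i.2, hi, inv_inv]

theorem invSlope_nonneg (hslopes : Set.range μ = P.positiveSlopes) (i : ℕ) : 0 ≤ invSlope μ i := by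
  rw [invSlope]
  split_ifs
  · exact inv_nonneg.2 (slope_pos hslopes _).le
  · exact le_rfl

theorem pairs_nonempty (hslopes : Set.range μ = P.positiveSlopes) : P.pairs.Nonempty := by
  have : μ 0 ∈ P.positiveSlopes := hslopes ▸ Set.mem_range_self 0
  exact QDiffOp.pairs_nonempty this.2

/-- The vertex of the Newton polygon between two consecutive slopes. -/
theorem exists_vertex (hμ : StrictMono μ) (hslopes : Set.range μ = P.positiveSlopes) {i : ℕ}
    (hi : i < s + 1) : ∃ v ∈ P.pairs,
      (∀ u ∈ P.pairs, (u.1 : ℚ) - invSlope μ i * u.2 ≤ v.1 - invSlope μ i * v.2) ∧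
      ∀ u ∈ P.pairs, (u.1 : ℚ) - invSlope μ (i + 1) * u.2 ≤ v.1 - invSlope μ (i + 1) * v.2 := by
  -- A parameter strictly between two consecutive inverse slopes with two maximizers of distinct
  -- ordinates would itself be an inverse slope, contrary to monotonicity.
  refine exists_common_maximizer (pairs_nonempty hslopes) (invSlope_succ_lt hμ hslopes hi)
    fun σ h1 h2 v hv w hw hne hvm hwm => ?_
  obtain ⟨k, -, rfl⟩ := eq_invSlope_of_maximizers hslopes
    ((invSlope_nonneg hslopes (i + 1)).trans_lt h1) hv hw hne hvm hwm
  rcases le_or_gt k i with h | h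
  · exact (invSlope_antitone hμ hslopes h).not_gt h2
  · exact (invSlope_antitone hμ hslopes (show i + 1 ≤ k from h)).not_gt h1

/-- The left vertex of the edge of smallest positive slope has minimal ordinate. -/
theorem exists_first_vertex (hμ : StrictMono μ) (hslopes : Set.range μ = P.positiveSlopes) :
    ∃ v ∈ P.pairs, (∀ u ∈ P.pairs, v.2 ≤ u.2) ∧
      ∀ u ∈ P.pairs, (u.1 : ℚ) - invSlope μ 0 * u.2 ≤ v.1 - invSlope μ 0 * v.2 := by
  set M : ℚ := ∑ u ∈ P.pairs, |(u.1 : ℚ)| with hM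
  have hM0 : 0 ≤ M := Finset.sum_nonneg fun _ _ => abs_nonneg _
  have hle : ∀ u ∈ P.pairs, |(u.1 : ℚ)| ≤ M := fun u hu =>
    Finset.single_le_sum (f := fun u : ℤ × ℕ => |(u.1 : ℚ)|) (fun _ _ => abs_nonneg _) hu
  have h0 := invSlope_nonneg hslopes (μ := μ) 0
  obtain ⟨v, hv, hvB, hv0⟩ := exists_common_maximizer (pairs_nonempty hslopes)
    -- Abscissas differ by at most 2M, so for a parameter exceeding 2M a gain of one unit of
    -- ordinate outweighs any difference of abscissas; a maximizer then has minimal ordinate.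
    (show invSlope μ 0 < invSlope μ 0 + 2 * M + 1 by linarith)
    fun σ h1 h2 v hv w hw hne hvm hwm => by
      obtain ⟨k, -, rfl⟩ := eq_invSlope_of_maximizers hslopes (h0.trans_lt h1) hv hw hne hvm hwm
      exact (invSlope_antitone hμ hslopes (Nat.zero_le k)).not_gt h1
  refine ⟨v, hv, fun u hu => ?_, hv0⟩
  by_contra hlt
  have h1 : (u.2 : ℚ) + 1 ≤ v.2 := by
    have : u.2 + 1 ≤ v.2 := by omega
    exact_mod_cast this
  have h2 := hvB u hu
  have h3 := abs_le.1 (hle u hu)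
  have h4 := abs_le.1 (hle v hv)
  nlinarith

end Slopes

theorem stageShift_le {K T : ℕ} {τ : ℚ} (hT : (T : ℚ) = K * τ) {u v : ℤ × ℕ}
    (h : (u.1 : ℚ) - τ * u.2 ≤ v.1 - τ * v.2) : stageShift K T u ≤ stageShift K T v := by
  have h1 := mul_le_mul_of_nonneg_left h (Nat.cast_nonneg (α := ℚ) K)
  have h2 : ((stageShift K T u : ℤ) : ℚ) ≤ ((stageShift K T v : ℤ) : ℚ) := by
    simp only [stageShift]
    push_cast
    rw [hT]
    linarith
  exact_mod_cast h2

/-- The points of a finite set of discrete spirals have finitely many classes modulo a spiral of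
finite index. -/
theorem exists_finite_classes {logq ρ : ℂ} {n d : ℕ} (hρ : ρ ≠ 0) (hd : d ≠ 0)
    (hn : qpow logq (1 / (n : ℂ)) = ρ ^ d) (Z : Finset ℂ) :
    ∃ E : Set (ℂˣ ⧸ qSpiral logq n), E.Finite ∧ ∀ lam : ℂˣ,
      (QuotientGroup.mk lam : ℂˣ ⧸ qSpiral logq n) ∉ E →
        ∀ w ∈ Z, ∀ l : ℤ, (lam : ℂ) ≠ ρ ^ l * w := by
  classical
  -- A ρ-spiral is the union of d spirals of ratio ρ^d = q^(1/n), with starting points ρ^r w, 0 ≤ r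
  -- < d.
  set A : Finset ℂ := (Finset.range d).biUnion fun r => Z.image fun w => ρ ^ r * w with hA
  refine ⟨QuotientGroup.mk '' (Units.val ⁻¹' (A : Set ℂ)),
    (A.finite_toSet.preimage Units.val_injective.injOn).image _, fun lam hlam w hw l hl => hlam ?_⟩
  have hd0 : (0 : ℤ) < d := by omega
  have hmod := Int.emod_nonneg l hd0.ne'
  have hmod' := Int.emod_lt_of_pos l hd0
  have hw0 : w ≠ 0 := by
    rintro rfl
    rw [mul_zero] at hl
    exact lam.ne_zero hl
  have hu0 : ρ ^ (l % d).toNat * w ≠ 0 := mul_ne_zero (pow_ne_zero _ hρ) hw0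
  refine ⟨Units.mk0 _ hu0, ?_, QuotientGroup.eq.2 ?_⟩
  · simp only [Set.mem_preimage, Units.val_mk0, Finset.mem_coe, hA, Finset.mem_biUnion,
      Finset.mem_range, Finset.mem_image]
    exact ⟨(l % d).toNat, by omega, w, hw, rfl⟩
  · refine Subgroup.mem_zpowers_iff.2 ⟨l / d, Units.ext ?_⟩
    rw [Units.val_zpow_eq_zpow_val, Units.val_mul, Units.val_inv_eq_inv_val, Units.val_mk0]
    change qpow logq (1 / (n : ℂ)) ^ (l / (d : ℤ)) = _
    rw [hn, hl, ← zpow_natCast ρ d, ← zpow_mul, ← zpow_natCast ρ (l % d).toNat,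
      Int.toNat_of_nonneg hmod]
    have h1 : ρ ^ l = ρ ^ (l % d) * ρ ^ ((d : ℤ) * (l / d)) := by
      rw [← zpow_add₀ hρ, Int.emod_add_mul_ediv]
    have := zpow_ne_zero (l % (d : ℤ)) hρ
    rw [h1]
    field_simp

/-! ### Orders and exponents -/

/-- Euclidean division: a nonzero remainder of N modulo n would be a smaller admissible denominator.
-/
theorem dvd_of_isLeast_mul_natCast {x : ℚ} {n N m M : ℕ}
    (hn : IsLeast {N : ℕ | 0 < N ∧ ∃ m : ℕ, 0 < m ∧ (N : ℚ) / x = m} n) (hm : (n : ℚ) / x = m)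
    (hm0 : 0 < m) (hM : (N : ℚ) / x = M) : n ∣ N := by
  have hn0 : 0 < n := hn.1.1
  have hx : 0 < x := by
    by_contra h
    have h1 : (n : ℚ) / x ≤ 0 := div_nonpos_of_nonneg_of_nonpos (Nat.cast_nonneg n) (not_lt.1 h)
    have h2 : (0 : ℚ) < m := by exact_mod_cast hm0
    linarith
  by_contra hdvd
  have hr : 0 < N % n := Nat.pos_of_ne_zero fun h => hdvd (Nat.dvd_of_mod_eq_zero h)
  have h1 : ((N % n : ℕ) : ℚ) / x = (M : ℚ) - (N / n : ℕ) * m := by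
    have : (N : ℚ) = (n : ℚ) * (N / n : ℕ) + (N % n : ℕ) := by
      exact_mod_cast (Nat.div_add_mod N n).symm
    rw [← hm, ← hM]
    rw [this]
    ring
  have h2 : 0 < ((N % n : ℕ) : ℚ) / x := div_pos (by exact_mod_cast hr) hx
  have h3 : N / n * m < M := by
    rw [h1, sub_pos] at h2
    exact_mod_cast h2
  refine absurd (hn.2 ⟨hr, M - N / n * m, by omega, ?_⟩) (not_le.2 (Nat.mod_lt N hn0))
  rw [h1, Nat.cast_sub h3.le, Nat.cast_mul]

/-- Descending induction on i from the value 0 beyond the last slope: K times an inverse slope is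
the sum of the integers K/κ_k over k ≥ i. -/
theorem exists_natCast_eq_mul_invSlope {s K : ℕ} {μ : Fin (s + 1) → ℚ}
    (hK : ∀ i, ∃ m : ℕ, 0 < m ∧ (K : ℚ) / kappa μ i = m) (i : ℕ) :
    ∃ t : ℕ, (t : ℚ) = K * invSlope μ i := by
  suffices h : ∀ k i : ℕ, s + 1 ≤ i + k → ∃ t : ℕ, (t : ℚ) = K * invSlope μ i from
    h (s + 1) i (by omega)
  intro k
  induction k with
  | zero =>
    intro i hi
    exact ⟨0, by rw [invSlope, dif_neg (by omega)]; simp⟩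
  | succ k ih =>
    intro i hi
    obtain ⟨t, ht⟩ := ih (i + 1) (by omega)
    rcases lt_or_ge i (s + 1) with h | h
    · obtain ⟨m, -, hm⟩ := hK ⟨i, h⟩
      refine ⟨t + m, ?_⟩
      rw [Nat.cast_add, ht, ← hm, div_eq_mul_inv, inv_kappa]
      ring
    · exact ⟨0, by rw [invSlope, dif_neg (by omega)]; simp⟩

/-- A telescoping sum: the composite of all the Borel transforms has the order of the smallest
positive slope. -/
theorem sum_inv_kappa {s : ℕ} (μ : Fin (s + 1) → ℚ) : ∑ i, (kappa μ i)⁻¹ = invSlope μ 0 := by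
  simp only [inv_kappa]
  rw [Fin.sum_univ_eq_sum_range (fun i => invSlope μ i - invSlope μ (i + 1)) (s + 1),
    Finset.sum_range_sub', invSlope, invSlope, dif_neg (lt_irrefl (s + 1)), sub_zero]

theorem qpow_eq_zpow {logq α : ℂ} {K : ℕ} (l : ℤ) (h : α = l * (1 / (K : ℂ))) :
    qpow logq α = qpow logq (1 / (K : ℂ)) ^ l := by
  rw [h, qpow_int_mul]

theorem one_lt_norm_of_pow {ρ : ℂ} {K : ℕ} (h : 1 < ‖ρ ^ K‖) : 1 < ‖ρ‖ := by
  by_contra h1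
  rw [norm_pow] at h
  exact absurd h (not_lt.2 (pow_le_one₀ (norm_nonneg _) (not_lt.1 h1)))

theorem two_mul_triang_sub_one (k : ℤ) : 2 * triang (k - 1) = k * (k - 1) := by
  have := triang_mul_two (k - 1)
  linarith

/-- The spiral of -lam never meets lam, since ρ^l = -1 would force |ρ|^l = 1, hence l = 0. Adding
-lam to the excluded points therefore imposes no new condition on lam. -/
theorem self_mem_offSpirals {ρ lam : ℂ} {Z : Finset ℂ} (hρ : 1 < ‖ρ‖) (hlam : lam ≠ 0)
    (h : ∀ w ∈ Z, ∀ l : ℤ, lam ≠ ρ ^ l * w) :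
    lam ∈ offSpirals ρ (insert (-lam) (Z : Set ℂ)) := by
  refine ⟨hlam, fun w hw l => ?_⟩
  rcases hw with rfl | hw
  · intro hl
    have h1 : ρ ^ l = -1 := by
      apply mul_right_cancel₀ hlam
      linear_combination hl
    have h2 : ‖ρ‖ ^ l = 1 := by rw [← norm_zpow, h1, norm_neg, norm_one]
    have h3 : l = 0 := (zpow_right_injective₀ (zero_lt_one.trans hρ) hρ.ne')
      (h2.trans (zpow_zero _).symm)
    rw [h3, zpow_zero] at h1
    norm_num at h1
  · exact h w hw l

theorem stageCoeff_zero (ρ : ℂ) (c : ℤ × ℕ → ℂ) : stageCoeff ρ c 0 = c := by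
  funext s; simp [stageCoeff]

theorem stageShift_zero (K : ℕ) : stageShift K 0 = fun s : ℤ × ℕ => (K : ℤ) * s.1 := by
  funext s; simp [stageShift]

theorem eval_twistPoly_zero (ρ : ℂ) (a : Polynomial ℂ) (z : ℂ) :
    (twistPoly ρ 0 a).eval z = a.eval z := by
  rw [eval_twistPoly, Polynomial.eval_eq_sum_range]
  simp


/-! ### The chain of stages and the main theorem. -/

theorem exists_coe_fin_sequence {α : Type*} {s : ℕ} {p : ℕ → α → Prop}
    {r : Fin (s + 1) → α → α → Prop} {x₀ : α} (h₀ : p 0 x₀)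
    (h : ∀ (i : Fin (s + 1)) (x : α), p i x → ∃ y, p (i + 1) y ∧ r i x y) :
    ∃ f : Fin (s + 2) → α, f 0 = x₀ ∧ (∀ i : Fin (s + 2), p i (f i)) ∧
      ∀ i : Fin (s + 1), r i (f i.castSucc) (f i.succ) := by
  classical
  choose! G hG using h
  -- Past the last index the sequence is continued by a constant; these values play no role.
  let F : ℕ → α := fun i => Nat.rec x₀ (fun k x => if hk : k < s + 1 then G ⟨k, hk⟩ x else x) i
  have hF : ∀ k (hk : k < s + 1), F (k + 1) = G ⟨k, hk⟩ (F k) := fun k hk => dif_pos hk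
  have hp : ∀ k, k < s + 2 → p k (F k) := by
    intro k
    induction k with
    | zero => exact fun _ => h₀
    | succ k ih =>
      intro hk
      have hk' : k < s + 1 := by omega
      rw [hF k hk']
      exact (hG ⟨k, hk'⟩ _ (ih (by omega))).1
  refine ⟨fun i => F i, rfl, fun i => hp i i.2, fun i => ?_⟩
  have := (hG i (F i) (hp i (by omega))).2
  simp only [Fin.val_castSucc, Fin.val_succ]
  rwa [hF i i.2]

theorem theorem1p10
    (q logq : ℂ) (hq : 1 < ‖q‖) (hlogq : Complex.exp logq = q)
    (h : PowerSeries ℂ) (P : QDiffOp) (a : Polynomial ℂ)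
    (hP : P.onSeries q h = (a : PowerSeries ℂ))
    -- the positive slopes `μ 0 < ⋯ < μ s`, of which there are `r = s + 1 ≥ 1`
    (s : ℕ) (μ : Fin (s + 1) → ℚ) (hμ : StrictMono μ)
    (hslopes : Set.range μ = P.positiveSlopes)
    (K n : ℕ)
    (hK : IsLeast {N : ℕ | 0 < N ∧ ∀ i, ∃ m : ℕ, 0 < m ∧ (N : ℚ) / kappa μ i = m} K)
    (hn : IsLeast {N : ℕ | 0 < N ∧ ∃ m : ℕ, 0 < m ∧ (N : ℚ) / kappa μ (Fin.last s) = m} n) :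
    ∃ E : Set (ℂˣ ⧸ qSpiral logq n), E.Finite ∧
      ∀ lam : ℂˣ, (QuotientGroup.mk lam : ℂˣ ⧸ qSpiral logq n) ∉ E →
        -- `f 0` is the sum of the iterated Borel transform, `f (i + 1)` is the Laplace transform
        -- of `f i`, and `f (s + 1)` is the Borel-Laplace sum of `h`
        ∃ f : Fin (s + 2) → ℂ → ℂ,
          (∀ᶠ z in nhds (0 : ℂ), HasSum
            (fun k : ℕ => PowerSeries.coeff k (qBorelIter logq (kappa μ) h) * z ^ k) (f 0 z)) ∧
          (∀ i : Fin (s + 1), MemH logq (kappa μ i) K lam (f i.castSucc)) ∧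
          (∀ i : Fin (s + 1), IsQLaplace logq (kappa μ i) (if i = Fin.last s then n else K) lam
            (f i.castSucc) (f i.succ)) ∧
          MeromorphicOn (f (Fin.last (s + 1))) {0}ᶜ ∧
          (∀ z : ℂ, z ≠ 0 → ∀ᶠ w in nhdsWithin z {z}ᶜ,
            P.onFun q (f (Fin.last (s + 1))) w = a.eval w) := by
  classical
  have hK0 : 0 < K := hK.1.1
  have hKQ : (K : ℚ) ≠ 0 := by exact_mod_cast hK0.ne'
  have hKC : (K : ℂ) ≠ 0 := by exact_mod_cast hK0.ne'
  obtain ⟨hn0, m, hm0, hm⟩ := hn.1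
  have hnC : (n : ℂ) ≠ 0 := by exact_mod_cast hn0.ne'
  choose N hN0 hN using hK.1.2
  choose T hT using exists_natCast_eq_mul_invSlope hK.1.2
  set ρ : ℂ := qpow logq (1 / (K : ℂ)) with hρdef
  have hρq : ρ ^ K = q := by
    have := qpow_eq_zpow (logq := logq) (K := K) (α := 1) K (by simp [hKC])
    rw [zpow_natCast] at this
    rw [hρdef, ← this, qpow, one_mul, hlogq]
  have hρ : 1 < ‖ρ‖ := one_lt_norm_of_pow (K := K) (by rwa [hρq])
  have hρ0 : ρ ≠ 0 := norm_pos_iff.1 (zero_lt_one.trans hρ)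
  have hTN : ∀ i : Fin (s + 1), T i = T (i + 1) + N i := fun i => by
    have h1 := hN i
    rw [div_eq_mul_inv, inv_kappa, mul_sub, ← hT, ← hT] at h1
    have h2 : (T i : ℚ) = T (i + 1) + N i := by linarith
    exact_mod_cast h2
  have hTs : T (s + 1) = 0 := by
    have := hT (s + 1)
    rw [invSlope, dif_neg (lt_irrefl _), mul_zero] at this
    exact_mod_cast this
  -- The last Laplace transform runs over the coarser spiral q^(ℤ/n) λ = ρ^(dℤ) λ, with d = K / n.
  obtain ⟨d, hd⟩ : n ∣ K := dvd_of_isLeast_mul_natCast hn hm hm0 (hN (Fin.last s))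
  have hd0 : d ≠ 0 := by
    rintro rfl
    omega
  have hdm : d * m = N (Fin.last s) := by
    have h1 := hN (Fin.last s)
    rw [hd, Nat.cast_mul, mul_comm, mul_div_assoc, hm] at h1
    exact_mod_cast h1
  have hκ : ∀ i, (kappa μ i : ℂ) = K / N i := fun i => by
    have hNi : (N i : ℚ) ≠ 0 := by exact_mod_cast (hN0 i).ne'
    have h1 : kappa μ i = K / N i := by
      have h2 := hN i
      have h3 : kappa μ i ≠ 0 := by
        intro h0
        rw [h0, div_zero] at h2
        exact hNi h2.symm
      rw [div_eq_iff h3] at h2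
      rw [eq_div_iff hNi, h2, mul_comm]
    rw [h1]
    push_cast
    rfl
  have hNC : ∀ i, (N i : ℂ) ≠ 0 := fun i => by exact_mod_cast (hN0 i).ne'
  have hqκ : ∀ i, qpow logq (1 / (kappa μ i : ℂ)) = ρ ^ N i := fun i => by
    rw [qpow_eq_zpow (K := K) (N i), zpow_natCast]
    rw [hκ, one_div_div, Int.cast_natCast]
    ring
  have hqK : ∀ l : ℤ, qpow logq ((l : ℂ) / K) = ρ ^ (((1 : ℕ) : ℤ) * l) := fun l => by
    rw [Nat.cast_one, one_mul]
    exact qpow_eq_zpow l (by ring)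
  have hdC : (d : ℂ) ≠ 0 := by exact_mod_cast hd0
  have hKdC : (K : ℂ) = n * d := by exact_mod_cast hd
  have hqn : ∀ l : ℤ, qpow logq ((l : ℂ) / n) = ρ ^ ((d : ℤ) * l) := fun l => by
    refine qpow_eq_zpow _ ?_
    rw [hKdC]
    push_cast
    field_simp
  set c : ℤ × ℕ → ℂ := fun x => (P x.1).coeff x.2 with hcdef
  have hc : ∀ x ∈ P.pairs, c x ≠ 0 := fun x hx => QDiffOp.mem_pairs.1 hx
  -- The roots of the leading coefficients at all levels, for every point of the support and not
  -- only for vertices: a finite set independent of lam that contains every possible source of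
  -- singularities.
  set Z₀ : Finset ℂ := (Finset.range (s + 2)).biUnion fun k => P.pairs.biUnion fun v =>
    (stageTop ρ P.pairs c K (T k) v).roots.toFinset with hZ₀
  obtain ⟨E, hE, hE'⟩ := exists_finite_classes (logq := logq) (n := n) hρ0 hd0
    (by simpa using hqn 1) Z₀
  refine ⟨E, hE, fun lam hlam => ?_⟩
  -- The spiral of -lam is added because the Theta denominators vanish there.
  set Z : Set ℂ := insert (-(lam : ℂ)) (Z₀ : Set ℂ) with hZdef
  have hZ : Z.Finite := Z₀.finite_toSet.insert _
  obtain ⟨V, C, hVo, hVc, hVC, hC, hCU, hlV, hρlV⟩ := exists_connected_nhd hρ hZ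
    (self_mem_offSpirals hρ lam.ne_zero (hE' lam hlam))
  have hroots : ∀ k < s + 2, ∀ v ∈ P.pairs, ∀ w,
      (stageTop ρ P.pairs c K (T k) v).IsRoot w → w ∈ Z := fun k hk v hv w hw =>
    Set.mem_insert_of_mem _ (Finset.mem_coe.2 (Finset.mem_biUnion.2 ⟨k, Finset.mem_range.2 hk,
      Finset.mem_biUnion.2 ⟨v, hv, Multiset.mem_toFinset.2
        ((Polynomial.mem_roots (stageTop_ne_zero hρ0 hK0.ne' hv (hc v hv))).2 hw)⟩⟩))
  obtain ⟨v₀, hv₀, hv₀j, hv₀m⟩ := exists_first_vertex hμ hslopes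
  obtain ⟨f₀, hf₀, hsum⟩ := exists_initial_stage (a := a) (T := T 0) hρ hZ hc hK0.ne' hv₀
    (fun x hx => stageShift_le (hT 0) (hv₀m x hx)) hv₀j (hroots 0 (by omega) v₀ hv₀) hC hCU
    (b := fun k => PowerSeries.coeff k h) (fun k => by
      rw [← QDiffOp.coeff_onSeries P hρq, hP, Polynomial.coeff_coe])
  obtain ⟨f, rfl, hst, hLap⟩ := exists_coe_fin_sequence
    (p := fun i f => IsStage ρ P.pairs c a Z C K (T i) f)
    (r := fun i f g => IsQLaplace logq (kappa μ i) (if i = Fin.last s then n else K) lam f g ∧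
      MemH logq (kappa μ i) K lam f) hf₀ fun i f hf => by
    obtain ⟨v, hv, hv1, hv2⟩ := exists_vertex hμ hslopes i.2
    -- One descent with an arbitrary factorization N_i = d' n': d' = 1 and n' = N_i for the
    -- intermediate transforms, d' = d and n' = m for the last one.
    have hstep : ∀ d' n' K' : ℕ, d' ≠ 0 → n' ≠ 0 → d' * n' = N i →
        (∀ x ∈ P.pairs, (d' : ℤ) ∣ stageShift K (T i) x) →
        (∀ l : ℤ, qpow logq ((l : ℂ) / K') = ρ ^ ((d' : ℤ) * l)) →
        (kappa μ i : ℂ) / K' = 1 / n' → ∃ g, IsStage ρ P.pairs c a Z C K (T (i + 1)) g ∧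
          IsQLaplace logq (kappa μ i) K' lam f g ∧ MemH logq (kappa μ i) K lam f := by
      intro d' n' K' hd' hn' hdn hdvd hq' hκ'
      obtain ⟨g, hg, hg', hM⟩ := hf.exists_laplace hρ hZ hc hK0.ne' hd' hn'
        (by rw [hdn]; exact hTN i) hdvd hv (fun x hx => stageShift_le (hT i) (hv1 x hx))
        (fun x hx => stageShift_le (hT (i + 1)) (hv2 x hx)) (hroots i (by omega) v hv)
        (hroots (i + 1) (by omega) v hv) hVo hVc hVC hC hCU hlV hρlV (Set.mem_insert _ _) hq'
        (by rw [hdn]; exact hqκ i) hκ'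
      exact ⟨g, hg, hg', hM K 1 hqK⟩
    rcases eq_or_ne i (Fin.last s) with rfl | hi
    · rw [if_pos rfl]
      refine hstep d m n hd0 hm0.ne' hdm (fun x _ => ?_) hqn ?_
      -- At the last level both K and T are multiples of d, so all shifts are too, and the operator
      -- acts along the coarse spiral.
      · have h1 : T (Fin.last s : Fin (s + 1)) = d * m := by
          rw [hTN, hdm, Fin.val_last, hTs, zero_add]
        rw [stageShift, h1, hd]
        exact ⟨n * x.1 - m * x.2, by push_cast; ring⟩
      · have hmC : (m : ℂ) ≠ 0 := by exact_mod_cast hm0.ne'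
        rw [hκ, ← hdm, hKdC]
        push_cast
        field_simp
    · rw [if_neg hi]
      refine hstep 1 (N i) K one_ne_zero (hN0 i).ne' (one_mul _) (fun x _ => by simp) hqK ?_
      have := hNC i
      rw [hκ]
      field_simp
  refine ⟨f, ?_, fun i => (hLap i).2, fun i => (hLap i).1, fun z hz => (hst _).mer z hz,
    fun z hz => ?_⟩
  · filter_upwards [hsum] with z hz
    convert hz using 3 with k
    rw [coeff_qBorelIter, sum_inv_kappa]
    congr 1
    refine qpow_eq_zpow _ ?_
    have h1 : ((invSlope μ 0 : ℚ) : ℂ) = (T 0 : ℂ) / K := by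
      rw [eq_div_iff hKC, mul_comm]
      exact_mod_cast (hT 0).symm
    have h2 : 2 * ((triang ((k : ℤ) - 1) : ℤ) : ℂ) = (k : ℂ) * ((k : ℂ) - 1) := by
      exact_mod_cast two_mul_triang_sub_one k
    rw [h1, ← h2]
    push_cast
    ring
  -- At level 0 every conjugating factor is 1, and the equation of the stage is the original one.
  · have hlast := (hst (Fin.last (s + 1))).eq
    rw [Fin.val_last, hTs, stageCoeff_zero, stageShift_zero] at hlast
    filter_upwards [offSpirals_mem_nhdsNE hρ hZ hz] with w hw
    rw [QDiffOp.onFun_eq_shiftOp P hρq, hlast w hw, Nat.cast_zero, neg_zero, eval_twistPoly_zero]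

end
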